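/- Throughout, manifolds are smooth, finite-dimensional, Hausdorff and second countable. An action of a Lie group on a manifold is called principal if its orbit space is a manifold for which the quotient projection is a (locally trivial) principal bundle. Let $\mathbb{R}^\times$ be either $\mathbb{R}^+$ or $\mathbb{R}\setminus\{0\}$, let $(S,\omega)$ be a symplectic manifold and $H\in C^\infty(S)$. For $F\in C^\infty(S)$ let $X_F^\omega$ be the Hamiltonian vector field, $i_{X_F^\omega}\omega=dF$, and put $\{F_1,F_2\}_S=X^\omega_{F_1}(F_2)$. Let $\phi:\mathbb{R}^\times\times S\to S$ be a scaling symmetry, i.e. a principal action with $\phi_s^*\omega=s\,\omega$ and $H\circ\phi_s=sH$ for all $s$, with quotient ${\bf p_S}:S\to C=S/\mathbb{R}^\times$. Let $G$ be a Lie group with a principal action $\Phi^S$ on $S$ such that $(\Phi^S_g)^*\omega=\omega$, $H\circ\Phi^S_g=H$ and $\Phi^S_g\circ\phi_s=\phi_s\circ\Phi^S_g$ for all $g,s$. Assume that the induced action $\Phi^C$ of $G$ on $C$ is principal, with quotient $\wp_C:C\to C/G$. Let $\Delta$ be the infinitesimal generator of $\phi$, $\lambda=-i_\Delta\omega$, $\mathcal{D}=T{\bf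 p_S}(\ker\lambda)$, and let $\mathcal{D}^o\subset T^*C$ be the annihilator of $\mathcal{D}$. For a real line bundle $L\to K$, a Kirillov bracket is a Lie bracket $[\cdot,\cdot]$ on $\Gamma(L^*)$ such that for every $h_2\in\Gamma(L^*)$ there is a vector field $X_{h_2}$ on $K$, the symbol of $[\cdot,h_2]$, with $[fh_1,h_2]=f[h_1,h_2]+X_{h_2}(f)h_1$ for all $f\in C^\infty(K)$ and $h_1\in\Gamma(L^*)$. Then: 0. $\ker\lambda$ is ${\bf p_S}$-projectable onto $\mathcal{D}$, $(C,\mathcal{D})$ is a contact manifold, and $\mathcal{D}^o\to C$ is a line bundle, a smooth subbundle of $T^*C$. For $x\in S$ there is a covector $a_x\in\mathcal{D}^o_{{\bf p_S}(x)}$ with $a_x\circ T_x{\bf p_S}=\lambda_x$, and $h\mapsto H_h$, $H_h(x)=h({\bf p_S}(x))(a_x)$, is a bijection from $\Gamma((\mathcal{D}^o)^*)$ onto the smooth functions $F$ on $S$ with $F\circ\phi_s=sF$ for all $s$. There is a Kirillov bracket $[\cdot,\cdot]_{(\mathcal{D}^o)^*}$ on $\Gamma((\mathcal{D}^o)^*)$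 with $\{H_{h_1},H_{h_2}\}_S=-H_{[h_1,h_2]_{(\mathcal{D}^o)^*}}$. 1. The cotangent lift of $\Phi^C$ restricts to a smooth representation $(\Phi^{\mathcal{D}^o},\Phi^C)$ of $G$ on the line bundle $\mathcal{D}^o\to C$. It is compatible with the Kirillov bracket: the bracket of two $G$-equivariant sections of $(\mathcal{D}^o)^*$ is $G$-equivariant. The orbit space $\mathcal{D}^o/G\to C/G$ is a real line bundle (the orbit map $\mathcal{D}^o\to\mathcal{D}^o/G$ being smooth and a linear isomorphism on each fibre), and there is a one-to-one correspondence $h\mapsto h^G$ between the $G$-equivariant sections $h$ of $(\mathcal{D}^o)^*\to C$ and the sections of the dual bundle $(\mathcal{D}^o/G)^*\cong(\mathcal{D}^o)^*/G\to C/G$, given by $h^G(\wp_C(c))([\alpha])=h(c)(\alpha)$ for $\alpha\in\mathcal{D}^o_c$. 2. There is a Kirillov bracket $[\cdot,\cdot]_{(\mathcal{D}^o)^*/G}$ on $\Gamma((\mathcal{D}^o)^*/G)$ with $([h_1,h_2]_{(\mathcal{D}^o)^*})^G=[h_1^G,h_2^G]_{(\mathcal{D}^o)^*/G}$ for all $G$-equivariant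 $h_1,h_2\in\Gamma((\mathcal{D}^o)^*)$. 3. The section $h_H$ of $(\mathcal{D}^o)^*$ with $H_{h_H}=H$ is $G$-equivariant. The symbol $X_{h_H}$ of $[\cdot,h_H]_{(\mathcal{D}^o)^*}$ is the ${\bf p_S}$-projection of $X_H^\omega$, it is $G$-invariant, and its $\wp_C$-projection is the symbol $X_{h_H^G}$ of $[\cdot,h_H^G]_{(\mathcal{D}^o)^*/G}$. Hence $X_H^\omega$ is $(\wp_C\circ{\bf p_S})$-projectable onto $C/G$, with projection $X_{h_H^G}$. -/

import Mathlib

open Bundle Manifold ContDiff Topology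

noncomputable section

/-! ## The scaling groups -/

/-- The two multiplicative groups of scalings: the positive reals and the nonzero reals. -/
inductive ScalingKind
  | positive
  | nonzero

/-- The open subset of the real line underlying the scaling group of the given kind. -/
def scalingSet : ScalingKind → TopologicalSpace.Opens ℝ
  | .positive => ⟨Set.Ioi 0, isOpen_Ioi⟩
  | .nonzero => ⟨{0}ᶜ, isOpen_compl_singleton⟩

/-- The scaling group, an open submanifold of the real line: either the positive or the nonzero
real numbers, with multiplication. -/
abbrev ScalingGroup (κ : ScalingKind) : Type := ↥(scalingSet κ)

namespace ScalingGroup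

variable {κ : ScalingKind}

theorem ne_zero (s : ScalingGroup κ) : (s : ℝ) ≠ 0 := by
  cases κ
  · exact ne_of_gt s.2
  · exact s.2

theorem mem_of_pos {t : ℝ} (ht : 0 < t) : t ∈ scalingSet κ := by
  cases κ
  · exact ht
  · exact ne_of_gt ht

theorem mul_mem {s t : ℝ} (hs : s ∈ scalingSet κ) (ht : t ∈ scalingSet κ) :
    s * t ∈ scalingSet κ := by
  cases κ
  · exact mul_pos (Set.mem_Ioi.1 hs) (Set.mem_Ioi.1 ht)
  · exact mul_ne_zero hs ht

theorem inv_mem {s : ℝ} (hs : s ∈ scalingSet κ) : s⁻¹ ∈ scalingSet κ := by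
  cases κ
  · exact inv_pos.2 (Set.mem_Ioi.1 hs)
  · exact inv_ne_zero hs

instance : CommGroup (ScalingGroup κ) where
  mul s t := ⟨s.1 * t.1, mul_mem s.2 t.2⟩
  one := ⟨1, mem_of_pos one_pos⟩
  inv s := ⟨s.1⁻¹, inv_mem s.2⟩
  mul_assoc a b c := Subtype.ext (mul_assoc a.1 b.1 c.1)
  one_mul a := Subtype.ext (one_mul a.1)
  mul_one a := Subtype.ext (mul_one a.1)
  mul_comm a b := Subtype.ext (mul_comm a.1 b.1)
  inv_mul_cancel a := Subtype.ext (inv_mul_cancel₀ a.ne_zero)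

/-- The one-parameter subgroup `t ↦ exp t`. -/
def exp (κ : ScalingKind) (t : ℝ) : ScalingGroup κ := ⟨Real.exp t, mem_of_pos (Real.exp_pos t)⟩

end ScalingGroup

/-! ## Principal bundles -/

/-- `pr : M → K` is a (smooth) principal bundle for the action of `G` on `M`: the action is smooth
and free, its orbits are the fibres of `pr`, and near each point of `K` there are a smooth section
`σ` and a smooth map `τ` to `G` such that `x ↦ (pr x, τ x)` and `(k, g) ↦ g • σ k` are mutually
inverse, that is, an equivariant local trivialization. -/
structure IsPrincipalBundle {EG EM EK : Type*}
    [NormedAddCommGroup EG] [NormedSpace ℝ EG] [NormedAddCommGroup EM] [NormedSpace ℝ EM]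
    [NormedAddCommGroup EK] [NormedSpace ℝ EK]
    (G : Type*) {M K : Type*} [TopologicalSpace G] [ChartedSpace EG G] [Group G]
    [TopologicalSpace M] [ChartedSpace EM M] [TopologicalSpace K] [ChartedSpace EK K]
    [MulAction G M] (pr : M → K) : Prop where
  contMDiffSMul : ContMDiffSMul 𝓘(ℝ, EG) 𝓘(ℝ, EM) ∞ G M
  contMDiff : ContMDiff 𝓘(ℝ, EM) 𝓘(ℝ, EK) ∞ pr
  surjective : Function.Surjective pr
  eq_iff : ∀ x y : M, pr x = pr y ↔ ∃ g : G, g • x = y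
  free : ∀ (g : G) (x : M), g • x = x → g = 1
  locallyTrivial : ∀ k : K, ∃ (U : Set K) (σ : K → M) (τ : M → G), IsOpen U ∧ k ∈ U ∧
    ContMDiffOn 𝓘(ℝ, EK) 𝓘(ℝ, EM) ∞ σ U ∧
    ContMDiffOn 𝓘(ℝ, EM) 𝓘(ℝ, EG) ∞ τ (pr ⁻¹' U) ∧
    (∀ y ∈ U, pr (σ y) = y) ∧ ∀ x ∈ pr ⁻¹' U, τ x • σ (pr x) = x

/-! ## Differential forms, symplectic and contact structures -/

section Forms

variable {E M : Type*} [NormedAddCommGroup E] [NormedSpace ℝ E]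
  [TopologicalSpace M] [ChartedSpace E M]

/-- Smoothness of a vector field. -/
def SmoothVectorField [IsManifold 𝓘(ℝ, E) ∞ M] (X : ∀ x : M, TangentSpace 𝓘(ℝ, E) x) : Prop :=
  ContMDiff 𝓘(ℝ, E) (𝓘(ℝ, E).prod 𝓘(ℝ, E)) ∞
    (fun x => (TotalSpace.mk' E x (X x) : TangentBundle 𝓘(ℝ, E) M))

/-- The exterior derivative of a 1-form, evaluated on two vector fields. -/
def extDerivOne (η : ∀ x : M, TangentSpace 𝓘(ℝ, E) x →L[ℝ] ℝ)
    (X Y : ∀ x : M, TangentSpace 𝓘(ℝ, E) x) (x : M) : ℝ :=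
  mvfderiv 𝓘(ℝ, E) (fun y => η y (Y y)) x (X x)
    - mvfderiv 𝓘(ℝ, E) (fun y => η y (X y)) x (Y x)
    - η x (VectorField.mlieBracket 𝓘(ℝ, E) X Y x)

/-- The exterior derivative of a 2-form, evaluated on three vector fields. -/
def extDerivTwo (Ω : ∀ x : M, TangentSpace 𝓘(ℝ, E) x →L[ℝ] TangentSpace 𝓘(ℝ, E) x →L[ℝ] ℝ)
    (X Y Z : ∀ x : M, TangentSpace 𝓘(ℝ, E) x) (x : M) : ℝ :=
  mvfderiv 𝓘(ℝ, E) (fun y => Ω y (Y y) (Z y)) x (X x)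
    - mvfderiv 𝓘(ℝ, E) (fun y => Ω y (X y) (Z y)) x (Y x)
    + mvfderiv 𝓘(ℝ, E) (fun y => Ω y (X y) (Y y)) x (Z x)
    - Ω x (VectorField.mlieBracket 𝓘(ℝ, E) X Y x) (Z x)
    + Ω x (VectorField.mlieBracket 𝓘(ℝ, E) X Z x) (Y x)
    - Ω x (VectorField.mlieBracket 𝓘(ℝ, E) Y Z x) (X x)

variable [IsManifold 𝓘(ℝ, E) ∞ M]

/-- A symplectic form: a smooth, closed, nondegenerate 2-form. -/
structure IsSymplectic
    (Ω : ∀ x : M, TangentSpace 𝓘(ℝ, E) x →L[ℝ] TangentSpace 𝓘(ℝ, E) x →L[ℝ] ℝ) : Prop where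
  contMDiff : ContMDiff 𝓘(ℝ, E) (𝓘(ℝ, E).prod 𝓘(ℝ, E →L[ℝ] E →L[ℝ] ℝ)) ∞
    (fun x => (TotalSpace.mk' (E →L[ℝ] E →L[ℝ] ℝ) x (Ω x) :
      TotalSpace (E →L[ℝ] E →L[ℝ] ℝ)
        (fun x : M => TangentSpace 𝓘(ℝ, E) x →L[ℝ]
          TangentSpace 𝓘(ℝ, E) x →L[ℝ] Bundle.Trivial M ℝ x)))
  alternating : ∀ (x : M) (v : TangentSpace 𝓘(ℝ, E) x), Ω x v v = 0
  nondegenerate : ∀ (x : M) (v : TangentSpace 𝓘(ℝ, E) x), (∀ w, Ω x v w = 0) → v = 0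
  closed : ∀ X Y Z : ∀ x : M, TangentSpace 𝓘(ℝ, E) x,
    SmoothVectorField X → SmoothVectorField Y → SmoothVectorField Z →
    ∀ x, extDerivTwo Ω X Y Z x = 0

/-- The Hamiltonian vector field `X_F` of `F`, given by `Ω(X_F, ·) = dF`. -/
def hamiltonianVectorField
    (Ω : ∀ x : M, TangentSpace 𝓘(ℝ, E) x →L[ℝ] TangentSpace 𝓘(ℝ, E) x →L[ℝ] ℝ)
    (F : M → ℝ) (x : M) : TangentSpace 𝓘(ℝ, E) x :=
  (Ω x).inverse (mvfderiv 𝓘(ℝ, E) F x)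

/-- The Poisson bracket `{F₁, F₂} = X_{F₁}(F₂)` of a symplectic form. -/
def poissonBracket
    (Ω : ∀ x : M, TangentSpace 𝓘(ℝ, E) x →L[ℝ] TangentSpace 𝓘(ℝ, E) x →L[ℝ] ℝ)
    (F₁ F₂ : M → ℝ) (x : M) : ℝ :=
  mvfderiv 𝓘(ℝ, E) F₂ x (hamiltonianVectorField Ω F₁ x)

/-- Smoothness of a 1-form on a set, as a section of the cotangent bundle. -/
def SmoothOneFormOn (η : ∀ x : M, TangentSpace 𝓘(ℝ, E) x →L[ℝ] ℝ) (U : Set M) : Prop :=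
  ContMDiffOn 𝓘(ℝ, E) (𝓘(ℝ, E).prod 𝓘(ℝ, E →L[ℝ] ℝ)) ∞
    (fun x => (TotalSpace.mk' (E →L[ℝ] ℝ) x (η x) :
      TotalSpace (E →L[ℝ] ℝ)
        (fun x : M => TangentSpace 𝓘(ℝ, E) x →L[ℝ] Bundle.Trivial M ℝ x))) U

/-- `η` is a contact form at `x`: it does not vanish at `x` and `dη` is nondegenerate on the
kernel of `η` at `x` (equivalently, `dim M = 2n + 1` and `η ∧ (dη)ⁿ ≠ 0` at `x`). -/
def IsContactFormAt (η : ∀ x : M, TangentSpace 𝓘(ℝ, E) x →L[ℝ] ℝ) (x : M) : Prop :=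
  η x ≠ 0 ∧
  ∀ X : (∀ x : M, TangentSpace 𝓘(ℝ, E) x), SmoothVectorField X → η x (X x) = 0 →
    (∀ Y : (∀ x : M, TangentSpace 𝓘(ℝ, E) x), SmoothVectorField Y → η x (Y x) = 0 →
      extDerivOne η X Y x = 0) → X x = 0

/-- A contact structure: a distribution which is locally the kernel of a contact form. -/
def IsContactStructure (D : ∀ x : M, Submodule ℝ (TangentSpace 𝓘(ℝ, E) x)) : Prop :=
  ∀ x : M, ∃ (U : Set M) (η : ∀ y : M, TangentSpace 𝓘(ℝ, E) y →L[ℝ] ℝ),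
    IsOpen U ∧ x ∈ U ∧ SmoothOneFormOn η U ∧
    ∀ y ∈ U, IsContactFormAt η y ∧ ∀ v, v ∈ D y ↔ η y v = 0

/-- The annihilator `D°` of a distribution `D`, a family of subspaces of the cotangent spaces. -/
def annihilator (D : ∀ x : M, Submodule ℝ (TangentSpace 𝓘(ℝ, E) x)) (x : M) :
    Submodule ℝ (TangentSpace 𝓘(ℝ, E) x →L[ℝ] ℝ) where
  carrier := {α | ∀ v ∈ D x, α v = 0}
  add_mem' {α β} hα hβ v hv := by
    change (α + β) v = 0
    rw [add_apply, hα v hv, hβ v hv, add_zero]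
  zero_mem' v _ := rfl
  smul_mem' t α hα v hv := by
    change (t • α) v = 0
    rw [smul_apply, hα v hv, smul_zero]

/-- A vector bundle structure on the annihilator `D°` makes it a smooth subbundle of the cotangent
bundle: a section of `D°` is smooth at a point exactly when it is smooth there as a 1-form. -/
def IsCotangentSubbundle (D : ∀ x : M, Submodule ℝ (TangentSpace 𝓘(ℝ, E) x))
    [TopologicalSpace (TotalSpace ℝ fun x => annihilator D x)]
    [FiberBundle ℝ fun x => annihilator D x] : Prop :=
  ∀ (α : ∀ x : M, annihilator D x) (x : M),
    ContMDiffAt 𝓘(ℝ, E) (𝓘(ℝ, E).prod 𝓘(ℝ, ℝ)) ∞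
      (fun y => (TotalSpace.mk' ℝ y (α y) : TotalSpace ℝ fun x => annihilator D x)) x ↔
    ContMDiffAt 𝓘(ℝ, E) (𝓘(ℝ, E).prod 𝓘(ℝ, E →L[ℝ] ℝ)) ∞
      (fun y => (TotalSpace.mk' (E →L[ℝ] ℝ) y (α y).1 :
        TotalSpace (E →L[ℝ] ℝ)
          (fun x : M => TangentSpace 𝓘(ℝ, E) x →L[ℝ] Bundle.Trivial M ℝ x))) x

/-- The cotangent lift of a transformation `g`, sending a covector `α` at `x` to
`α ∘ (T_x g)⁻¹` at `g • x`. -/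
def cotangentLift {G : Type*} [Group G] [MulAction G M] (g : G) (x : M)
    (α : TangentSpace 𝓘(ℝ, E) x →L[ℝ] ℝ) : TangentSpace 𝓘(ℝ, E) (g • x) →L[ℝ] ℝ :=
  α.comp (mfderiv 𝓘(ℝ, E) 𝓘(ℝ, E) (fun y => g • y) x).inverse

end Forms

/-! ## Line bundles and Kirillov structures -/

section LineBundles

variable {E K : Type*} [NormedAddCommGroup E] [NormedSpace ℝ E]
  [TopologicalSpace K] [ChartedSpace E K]

/-- The smooth sections of the dual of a real line bundle `L → K`. -/
abbrev DualSection (E : Type*) [NormedAddCommGroup E] [NormedSpace ℝ E] {K : Type*}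
    [TopologicalSpace K] [ChartedSpace E K] (L : K → Type*)
    [∀ k, AddCommGroup (L k)] [∀ k, Module ℝ (L k)] [∀ k, TopologicalSpace (L k)]
    [TopologicalSpace (TotalSpace ℝ L)] [FiberBundle ℝ L] [VectorBundle ℝ ℝ L] :=
  ContMDiffSection 𝓘(ℝ, E) (ℝ →L[ℝ] ℝ) ∞ (fun k => L k →L[ℝ] Bundle.Trivial K ℝ k)

variable (L : K → Type*) [∀ k, AddCommGroup (L k)] [∀ k, Module ℝ (L k)]
  [∀ k, TopologicalSpace (L k)] [TopologicalSpace (TotalSpace ℝ L)] [FiberBundle ℝ L]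
  [VectorBundle ℝ ℝ L]

variable {L} in
/-- The product of a smooth function and a smooth section of the dual bundle. -/
def DualSection.smulFun (f : K → ℝ) (hf : ContMDiff 𝓘(ℝ, E) 𝓘(ℝ, ℝ) ∞ f)
    (h : DualSection E L) : DualSection E L :=
  ⟨f • (fun k => h k), hf.smul_section h.contMDiff⟩

/-- A Kirillov structure on a real line bundle `L → K`: a Lie bracket on the sections of the dual
bundle such that `[·, h]` is a derivation for each `h`, with symbol a vector field on `K`. -/
structure KirillovStructure (E : Type*) [NormedAddCommGroup E] [NormedSpace ℝ E] {K : Type*}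
    [TopologicalSpace K] [ChartedSpace E K] [IsManifold 𝓘(ℝ, E) ∞ K] (L : K → Type*)
    [∀ k, AddCommGroup (L k)] [∀ k, Module ℝ (L k)] [∀ k, TopologicalSpace (L k)]
    [TopologicalSpace (TotalSpace ℝ L)] [FiberBundle ℝ L] [VectorBundle ℝ ℝ L] where
  bracket : DualSection E L →ₗ[ℝ] DualSection E L →ₗ[ℝ] DualSection E L
  bracket_self : ∀ h, bracket h h = 0
  jacobi : ∀ h₁ h₂ h₃, bracket h₁ (bracket h₂ h₃) + bracket h₂ (bracket h₃ h₁)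
    + bracket h₃ (bracket h₁ h₂) = 0
  /-- The symbol of the derivation `[·, h]`. -/
  symbol : DualSection E L → ∀ k : K, TangentSpace 𝓘(ℝ, E) k
  smooth_symbol : ∀ h, SmoothVectorField (symbol h)
  leibniz : ∀ (f : K → ℝ) (hf : ContMDiff 𝓘(ℝ, E) 𝓘(ℝ, ℝ) ∞ f) (h₁ h₂ : DualSection E L) (k : K),
    bracket (h₁.smulFun f hf) h₂ k =
      f k • bracket h₁ h₂ k + mvfderiv 𝓘(ℝ, E) f k (symbol h₂ k) • h₁ k

variable {L} in
/-- `G`-equivariance of a section `h` of the dual bundle, for an action of `G` on the total space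
of `L`: `h(g · k)(g · v) = h(k)(v)` for `v` in the fibre at `k`. -/
def DualSection.IsEquivariant (G : Type*) [Group G] [MulAction G (TotalSpace ℝ L)]
    (h : DualSection E L) : Prop :=
  ∀ (g : G) (z : TotalSpace ℝ L), h (g • z).proj (g • z).snd = h z.proj z.snd

end LineBundles

/-! ## Orbit spaces of line bundles -/

section OrbitBundle

variable (G : Type*) [Group G] {C B : Type*} (L : C → Type*) [MulAction G (TotalSpace ℝ L)]
  (pr : C → B)

/-- The fibre over `b` of the orbit space `L/G → B`, for a map `pr : C → B` whose fibres are the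
orbits in the base: the set of orbits of points of `L` which lie over `b`. -/
def OrbitFiber (b : B) : Type _ :=
  {o : MulAction.orbitRel.Quotient G (TotalSpace ℝ L) //
    ∃ z : TotalSpace ℝ L, Quotient.mk _ z = o ∧ pr z.proj = b}

/-- The orbit of a point of `L`, as a point of the orbit space. -/
def orbitClass (z : TotalSpace ℝ L) : OrbitFiber G L pr (pr z.proj) :=
  ⟨Quotient.mk _ z, z, rfl, rfl⟩

/-- A line bundle structure on the orbit space `L/G → B` is the quotient structure: the orbit map
`L → L/G` is smooth and restricts to a linear isomorphism on each fibre. -/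
def IsQuotientLineBundle {EC EB : Type*} [NormedAddCommGroup EC] [NormedSpace ℝ EC]
    [NormedAddCommGroup EB] [NormedSpace ℝ EB]
    [TopologicalSpace C] [ChartedSpace EC C] [TopologicalSpace B] [ChartedSpace EB B]
    [∀ c, AddCommGroup (L c)] [∀ c, Module ℝ (L c)] [∀ c, TopologicalSpace (L c)]
    [TopologicalSpace (TotalSpace ℝ L)] [FiberBundle ℝ L]
    [∀ b, AddCommGroup (OrbitFiber G L pr b)] [∀ b, Module ℝ (OrbitFiber G L pr b)]
    [∀ b, TopologicalSpace (OrbitFiber G L pr b)]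
    [TopologicalSpace (TotalSpace ℝ (OrbitFiber G L pr))] [FiberBundle ℝ (OrbitFiber G L pr)] :
    Prop :=
  ContMDiff (𝓘(ℝ, EC).prod 𝓘(ℝ, ℝ)) (𝓘(ℝ, EB).prod 𝓘(ℝ, ℝ)) ∞
    (fun z : TotalSpace ℝ L =>
      (TotalSpace.mk' ℝ (pr z.proj) (orbitClass G L pr z) :
        TotalSpace ℝ (OrbitFiber G L pr))) ∧
  ∀ c : C, ∃ q : L c ≃ₗ[ℝ] OrbitFiber G L pr (pr c),
    ∀ v : L c, q v = orbitClass G L pr (TotalSpace.mk' ℝ c v)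

end OrbitBundle

/-! ## Scaling symmetries and symplectic symmetries -/

section Symmetries

variable {E S : Type*} [NormedAddCommGroup E] [NormedSpace ℝ E]
  [TopologicalSpace S] [ChartedSpace E S]

/-- A scaling symmetry of `(S, Ω, H)`, with quotient projection `p : S → C`: a principal action of
the scaling group for which `Ω` and `H` are homogeneous of degree one. -/
structure IsScalingSymmetry (κ : ScalingKind) [MulAction (ScalingGroup κ) S]
    (Ω : ∀ x : S, TangentSpace 𝓘(ℝ, E) x →L[ℝ] TangentSpace 𝓘(ℝ, E) x →L[ℝ] ℝ) (H : S → ℝ)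
    {EC C : Type*} [NormedAddCommGroup EC] [NormedSpace ℝ EC]
    [TopologicalSpace C] [ChartedSpace EC C] (p : S → C) : Prop where
  principal : IsPrincipalBundle (EG := ℝ) (EM := E) (EK := EC) (ScalingGroup κ) p
  form : ∀ (s : ScalingGroup κ) (x : S) (v w : TangentSpace 𝓘(ℝ, E) x),
    Ω (s • x) (mfderiv 𝓘(ℝ, E) 𝓘(ℝ, E) (fun y => s • y) x v)
      (mfderiv 𝓘(ℝ, E) 𝓘(ℝ, E) (fun y => s • y) x w) = (s : ℝ) * Ω x v w
  function : ∀ (s : ScalingGroup κ) (x : S), H (s • x) = (s : ℝ) * H x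

/-- A symplectic `G`-symmetry of `(S, Ω, H)`, with quotient projection `q : S → P`: a principal
action of `G` which leaves `Ω` and `H` invariant. -/
structure IsSymplecticSymmetry {EG : Type*} [NormedAddCommGroup EG] [NormedSpace ℝ EG]
    (G : Type*) [Group G] [TopologicalSpace G] [ChartedSpace EG G] [MulAction G S]
    (Ω : ∀ x : S, TangentSpace 𝓘(ℝ, E) x →L[ℝ] TangentSpace 𝓘(ℝ, E) x →L[ℝ] ℝ) (H : S → ℝ)
    {EP P : Type*} [NormedAddCommGroup EP] [NormedSpace ℝ EP]
    [TopologicalSpace P] [ChartedSpace EP P] (q : S → P) : Prop where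
  principal : IsPrincipalBundle (EG := EG) (EM := E) (EK := EP) G q
  form : ∀ (g : G) (x : S) (v w : TangentSpace 𝓘(ℝ, E) x),
    Ω (g • x) (mfderiv 𝓘(ℝ, E) 𝓘(ℝ, E) (fun y => g • y) x v)
      (mfderiv 𝓘(ℝ, E) 𝓘(ℝ, E) (fun y => g • y) x w) = Ω x v w
  function : ∀ (g : G) (x : S), H (g • x) = H x

/-- The infinitesimal generator `Δ` of the scaling action, `Δ(x) = d/dt (exp t • x)` at `t = 0`. -/
def scalingGenerator (κ : ScalingKind) [MulAction (ScalingGroup κ) S] (x : S) :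
    TangentSpace 𝓘(ℝ, E) x :=
  have h : ScalingGroup.exp κ 0 • x = x := by
    rw [show ScalingGroup.exp κ 0 = 1 from Subtype.ext Real.exp_zero, one_smul]
  h ▸ (mfderiv 𝓘(ℝ, ℝ) 𝓘(ℝ, E) (fun t : ℝ => ScalingGroup.exp κ t • x) 0 (1 : ℝ) :
    TangentSpace 𝓘(ℝ, E) (ScalingGroup.exp κ 0 • x))

/-- The 1-form `λ = -i_Δ Ω`. -/
def liouvilleForm (κ : ScalingKind) [MulAction (ScalingGroup κ) S]
    (Ω : ∀ x : S, TangentSpace 𝓘(ℝ, E) x →L[ℝ] TangentSpace 𝓘(ℝ, E) x →L[ℝ] ℝ) (x : S) :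
    TangentSpace 𝓘(ℝ, E) x →L[ℝ] ℝ :=
  -(Ω x (scalingGenerator κ x))

/-- The distribution `D` on `C`, the image `Tp(ker λ)` of the kernel of `λ` under the projection
`p : S → C`: `D_c` is spanned by the vectors `T_x p (v)` with `p x = c` and `λ_x(v) = 0`. -/
def projectedDistribution (κ : ScalingKind) [MulAction (ScalingGroup κ) S]
    (Ω : ∀ x : S, TangentSpace 𝓘(ℝ, E) x →L[ℝ] TangentSpace 𝓘(ℝ, E) x →L[ℝ] ℝ)
    {EC C : Type*} [NormedAddCommGroup EC] [NormedSpace ℝ EC]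
    [TopologicalSpace C] [ChartedSpace EC C] (p : S → C) (c : C) :
    Submodule ℝ (TangentSpace 𝓘(ℝ, EC) c) :=
  Submodule.span ℝ {w | ∃ z : TangentBundle 𝓘(ℝ, E) S, liouvilleForm κ Ω z.proj z.snd = 0 ∧
    tangentMap 𝓘(ℝ, E) 𝓘(ℝ, EC) p z = (⟨c, w⟩ : TangentBundle 𝓘(ℝ, EC) C)}

end Symmetries

end

/-! Everything is read off from functions on S. Homogeneity of Ω makes λ at x the pullback of a
covector a_x at p(x), with a_(s x) = s a_x, and a_x spans the line D° there because λ vanishes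
nowhere and Tp is onto. Hence a section of the dual of D° is the same thing as a smooth function of
degree one on S. If F has degree one, then X_F is invariant under scalings, since Ω and dF are
multiplied by the same factor. So degree-one functions are closed under the Poisson bracket and X_F
projects to the base. Minus the Poisson bracket, moved to sections, is a Kirillov bracket: Jacobi is
closedness of Ω, the Leibniz rule is that of the Poisson bracket for functions pulled back from the
base, and the symbol is the projection of X_F.

This argument needs only a fibration whose fibres are the orbits of transformations with scaling
factors (`IsScaledFibration`), a homogeneous frame of lines on the base (`IsHomogeneousFrame`) and a
homogeneous symplectic form. `exists_kirillovStructure` is therefore applied twice: to S → C with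
the scaling group, and to S → C/G with the products of a scaling and an element of G, weighted by
the scaling alone. The frame of the second bundle consists of the orbits of the first frame. Its
degree-one functions are the G-invariant ones, that is, the equivariant sections. Both brackets are
thus minus the same Poisson bracket, and both symbols attached to H are projections of the same X_H;
nothing has to be reduced from C to C/G by hand.

For the contact condition (`isContactFormAt_sectionForm`), let σ be a local section of S → C and η =
σ*λ. Euler's identity gives λ(X_F) = F, so η pairs with the projection of X_F to F ∘ σ, and Lie
brackets of projections are projections of Hamiltonian fields of Poisson brackets. If F and G vanish
at σ(y), then dη at y on the two projections is a Poisson bracket at σ(y). Choosing X_G equal to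
Tσ(X) and letting dF run through all differentials pulled back from C forces X to vanish at y. -/

noncomputable section

set_option linter.unusedSectionVars false

/-! ### Smooth line bundles glued from local frames. -/

section LineBundleConstruction

variable {E K : Type*} [NormedAddCommGroup E] [NormedSpace ℝ E]
  [TopologicalSpace K] [ChartedSpace E K] (L : K → Type*)
  [∀ k, AddCommGroup (L k)] [∀ k, Module ℝ (L k)] [∀ k, TopologicalSpace (L k)]

/-- The pretrivialization of a family of lines given by a family of frames over an open set. -/
def framePretrivialization (U : Set K) (hU : IsOpen U) (e : ∀ k, ℝ ≃L[ℝ] L k) :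
    Pretrivialization ℝ (TotalSpace.proj : TotalSpace ℝ L → K) where
  toFun z := (z.proj, (e z.proj).symm z.snd)
  invFun p := ⟨p.1, e p.1 p.2⟩
  source := TotalSpace.proj ⁻¹' U
  target := U ×ˢ Set.univ
  map_source' z hz := ⟨hz, trivial⟩
  map_target' p hp := hp.1
  left_inv' z _ := by simp
  right_inv' p _ := by simp
  open_target := hU.prod isOpen_univ
  baseSet := U
  open_baseSet := hU
  source_eq := rfl
  target_eq := rfl
  proj_toFun _ _ := rfl

theorem framePretrivialization_symm_apply (U : Set K) (hU : IsOpen U) (e : ∀ k, ℝ ≃L[ℝ] L k)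
    {k : K} (hk : k ∈ U) (t : ℝ) :
    (framePretrivialization L U hU e).symm k t = e k t := by
  rw [Pretrivialization.symm_apply _ (by exact hk)]
  rfl

/-- The vector prebundle determined by a covering family of local frames of a family of lines. -/
def framePrebundle {ι : Type*} (U : ι → Set K) (hU : ∀ i, IsOpen (U i))
    (i₀ : K → ι) (hi₀ : ∀ k, k ∈ U (i₀ k)) (e : ι → ∀ k, ℝ ≃L[ℝ] L k)
    (htrans : ∀ i j, ContinuousOn (fun k => (e j k).symm (e i k 1)) (U i ∩ U j)) :
    VectorPrebundle ℝ ℝ L where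
  pretrivializationAtlas := Set.range fun i => framePretrivialization L (U i) (hU i) (e i)
  pretrivialization_linear' := by
    rintro _ ⟨i, rfl⟩
    exact ⟨fun b _ => (e i b).symm.toLinearEquiv.toLinearMap.isLinear⟩
  pretrivializationAt k := framePretrivialization L (U (i₀ k)) (hU _) (e (i₀ k))
  mem_base_pretrivializationAt := hi₀
  pretrivialization_mem_atlas k := ⟨i₀ k, rfl⟩
  exists_coordChange := by
    rintro _ ⟨i, rfl⟩ _ ⟨j, rfl⟩
    -- A linear endomorphism of the real line is multiplication by its value at 1.
    refine ⟨fun k => ContinuousLinearMap.toSpanSingleton ℝ ((e j k).symm (e i k 1)), ?_, ?_⟩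
    · exact (ContinuousLinearMap.toSpanSingletonCLE (𝕜 := ℝ) (E := ℝ)).continuous.comp_continuousOn
        (htrans i j)
    · intro k hk t
      have h := framePretrivialization_symm_apply L (U i) (hU i) (e i) hk.1 t
      dsimp only
      rw [h]
      change t • (e j k).symm (e i k 1) = (e j k).symm (e i k t)
      rw [← map_smul, ← map_smul, smul_eq_mul, mul_one]
  totalSpaceMk_isInducing k := by
    have h : IsInducing (fun t : ℝ => (k, t)) := (isEmbedding_prodMkRight k).isInducing
    exact h.comp (e (i₀ k) k).symm.toHomeomorph.isInducing

/-- In rank one a cocycle is a family of real functions, and their smoothness is all that the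
prebundle needs. Smoothness of the given frames is recorded because it ties the otherwise anonymous
bundle structure to them. -/
theorem exists_lineBundle {ι : Type*} (U : ι → Set K) (hU : ∀ i, IsOpen (U i))
    (hcov : ∀ k, ∃ i, k ∈ U i) (e : ι → ∀ k, ℝ ≃L[ℝ] L k)
    (htrans : ∀ i j, ContMDiffOn 𝓘(ℝ, E) 𝓘(ℝ, ℝ) ∞ (fun k => (e j k).symm (e i k 1)) (U i ∩ U j)) :
    ∃ (_ : TopologicalSpace (TotalSpace ℝ L)) (_ : FiberBundle ℝ L) (_ : VectorBundle ℝ ℝ L)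
      (_ : ContMDiffVectorBundle ∞ ℝ L 𝓘(ℝ, E)),
      ∀ i, ContMDiffOn 𝓘(ℝ, E) (𝓘(ℝ, E).prod 𝓘(ℝ, ℝ)) ∞
        (fun k => (TotalSpace.mk' ℝ k (e i k 1) : TotalSpace ℝ L)) (U i) := by
  choose i₀ hi₀ using hcov
  let a := framePrebundle L U hU i₀ hi₀ e fun i j => (htrans i j).continuousOn
  have ha : a.IsContMDiff 𝓘(ℝ, E) ∞ := by
    constructor
    rintro _ ⟨i, rfl⟩ _ ⟨j, rfl⟩
    refine ⟨fun k => ContinuousLinearMap.toSpanSingleton ℝ ((e j k).symm (e i k 1)), ?_, ?_⟩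
    · exact (ContinuousLinearMap.toSpanSingletonCLE (𝕜 := ℝ) (E := ℝ)).contDiff.contMDiff.comp_contMDiffOn
        (htrans i j)
    · intro k hk t
      have h := framePretrivialization_symm_apply L (U i) (hU i) (e i) hk.1 t
      dsimp only
      rw [h]
      change t • (e j k).symm (e i k 1) = (e j k).symm (e i k t)
      rw [← map_smul, ← map_smul, smul_eq_mul, mul_one]
  let := a.totalSpaceTopology
  let := a.toFiberBundle
  let := a.toVectorBundle
  refine ⟨a.totalSpaceTopology, a.toFiberBundle, a.toVectorBundle, a.contMDiffVectorBundle _, ?_⟩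
  intro i k hk
  refine ContMDiffAt.contMDiffWithinAt ?_
  rw [Bundle.contMDiffAt_section]
  -- The preferred trivialization is the inverse of a frame, so the coordinate of another frame is a
  -- transition function.
  have : (fun b => (trivializationAt ℝ L k (TotalSpace.mk' ℝ b (e i b 1))).2) =
      fun b => (e (i₀ k) b).symm (e i b 1) := rfl
  rw [this]
  exact (htrans i (i₀ k)).contMDiffAt (((hU i).inter (hU _)).mem_nhds ⟨hk, hi₀ k⟩)

end LineBundleConstruction

/-! ### Smooth sections and pairings in vector bundles. -/

section BundleLemmas

variable {E K F : Type*} [NormedAddCommGroup E] [NormedSpace ℝ E]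
  [TopologicalSpace K] [ChartedSpace E K] [NormedAddCommGroup F] [NormedSpace ℝ F]
  {V : K → Type*} [∀ k, AddCommGroup (V k)] [∀ k, Module ℝ (V k)] [∀ k, TopologicalSpace (V k)]
  [TopologicalSpace (TotalSpace F V)] [FiberBundle F V] [VectorBundle ℝ F V]
  {EM HM M : Type*} [NormedAddCommGroup EM] [NormedSpace ℝ EM] [TopologicalSpace HM]
  {IM : ModelWithCorners ℝ EM HM} [TopologicalSpace M] [ChartedSpace HM M]

/-- In a basis, g y is a finite sum of coordinate functionals tensored with the values g y (b i). -/
theorem contMDiffAt_clm_of_forall {W : Type*} [NormedAddCommGroup W] [NormedSpace ℝ W]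
    [FiniteDimensional ℝ F] {g : M → F →L[ℝ] W} {x : M}
    (h : ∀ v, ContMDiffAt IM 𝓘(ℝ, W) ∞ (fun y => g y v) x) :
    ContMDiffAt IM 𝓘(ℝ, F →L[ℝ] W) ∞ g x := by
  let b := Module.finBasis ℝ F
  let c := fun i => LinearMap.toContinuousLinearMap (b.coord i)
  have : g = fun y => ∑ i, ContinuousLinearMap.smulRightL ℝ F W (c i) (g y (b i)) := by
    funext y
    ext v
    have hv := congrArg (g y) (b.sum_repr v)
    rw [map_sum] at hv
    simp [← hv, c]
  rw [this]
  exact ContMDiffAt.sum fun i _ =>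
    (ContinuousLinearMap.contMDiff (ContinuousLinearMap.smulRightL ℝ F W (c i))).contMDiffAt.comp x
      (h (b i))

/-- Smoothness of a section of the dual of a vector bundle, tested on a local trivialization. -/
theorem contMDiffAt_dual_section [FiniteDimensional ℝ F]
    {φ : ∀ k, V k →L[ℝ] Bundle.Trivial K ℝ k} {k₀ : K}
    (h : ∀ v, ContMDiffAt 𝓘(ℝ, E) 𝓘(ℝ, ℝ) ∞
      (fun k => (φ k ((trivializationAt F V k₀).symm k v) : ℝ)) k₀) :
    ContMDiffAt 𝓘(ℝ, E) (𝓘(ℝ, E).prod 𝓘(ℝ, F →L[ℝ] ℝ)) ∞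
      (fun k => (TotalSpace.mk' (F →L[ℝ] ℝ) k (φ k) :
        TotalSpace (F →L[ℝ] ℝ) (fun k => V k →L[ℝ] Bundle.Trivial K ℝ k))) k₀ := by
  rw [contMDiffAt_hom_bundle]
  refine ⟨contMDiffAt_id, contMDiffAt_clm_of_forall fun v => ?_⟩
  refine (h v).congr_of_eventuallyEq ?_
  filter_upwards [(trivializationAt F V k₀).open_baseSet.mem_nhds
    (FiberBundle.mem_baseSet_trivializationAt' k₀)] with k hk
  change (Trivialization.continuousLinearMapAt ℝ (Bundle.Trivial.trivialization K ℝ) k)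
    (φ k ((trivializationAt F V k₀).symmL ℝ k v)) = _
  rw [Bundle.Trivial.continuousLinearMapAt_trivialization, Trivialization.symmL_apply _ hk]
  rfl

/-- These sections have constant coordinates; forms are tested on them. -/
theorem contMDiffAt_trivialization_symm [ContMDiffVectorBundle ∞ F V 𝓘(ℝ, E)] (k₀ : K) (v : F) :
    ContMDiffAt 𝓘(ℝ, E) (𝓘(ℝ, E).prod 𝓘(ℝ, F)) ∞
      (fun k => (TotalSpace.mk' F k ((trivializationAt F V k₀).symm k v) : TotalSpace F V)) k₀ := by
  have hk₀ := FiberBundle.mem_baseSet_trivializationAt' (F := F) (E := V) k₀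
  rw [contMDiffAt_section]
  refine (contMDiffAt_const (c := v)).congr_of_eventuallyEq ?_
  filter_upwards [(trivializationAt F V k₀).open_baseSet.mem_nhds hk₀] with k hk
  rw [Trivialization.mk_symm _ hk, Trivialization.apply_symm_apply' _ hk]

/-- Pairing of a smooth section of the dual bundle with a smooth map to the bundle. -/
theorem ContMDiffAt.dual_apply {φ : ∀ k, V k →L[ℝ] Bundle.Trivial K ℝ k} {b : M → K}
    {v : ∀ m, V (b m)} {m₀ : M}
    (hφ : ContMDiffAt 𝓘(ℝ, E) (𝓘(ℝ, E).prod 𝓘(ℝ, F →L[ℝ] ℝ)) ∞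
      (fun k => (TotalSpace.mk' (F →L[ℝ] ℝ) k (φ k) :
        TotalSpace (F →L[ℝ] ℝ) (fun k => V k →L[ℝ] Bundle.Trivial K ℝ k))) (b m₀))
    (hv : ContMDiffAt IM (𝓘(ℝ, E).prod 𝓘(ℝ, F)) ∞
      (fun m => (TotalSpace.mk' F (b m) (v m) : TotalSpace F V)) m₀) :
    ContMDiffAt IM 𝓘(ℝ, ℝ) ∞ (fun m => (φ (b m) (v m) : ℝ)) m₀ := by
  have hb : ContMDiffAt IM 𝓘(ℝ, E) ∞ b m₀ := (contMDiffAt_totalSpace.1 hv).1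
  have := ContMDiffAt.clm_bundle_apply (E₂ := Bundle.Trivial K ℝ) (F₂ := ℝ) (hφ.comp m₀ hb) hv
  exact (contMDiffAt_totalSpace.1 this).2

theorem ContMDiffAt.smul_along {f : M → ℝ} {b : M → K} {v : ∀ m, V (b m)} {m₀ : M}
    (hf : ContMDiffAt IM 𝓘(ℝ, ℝ) ∞ f m₀)
    (hv : ContMDiffAt IM (𝓘(ℝ, E).prod 𝓘(ℝ, F)) ∞
      (fun m => (TotalSpace.mk' F (b m) (v m) : TotalSpace F V)) m₀) :
    ContMDiffAt IM (𝓘(ℝ, E).prod 𝓘(ℝ, F)) ∞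
      (fun m => (TotalSpace.mk' F (b m) (f m • v m) : TotalSpace F V)) m₀ := by
  have hb : ContMDiffAt IM 𝓘(ℝ, E) ∞ b m₀ := (contMDiffAt_totalSpace.1 hv).1
  rw [contMDiffAt_totalSpace] at hv ⊢
  refine ⟨hv.1, (hf.smul hv.2).congr_of_eventuallyEq ?_⟩
  filter_upwards [hb.continuousAt ((trivializationAt F V (b m₀)).open_baseSet.mem_nhds
    (FiberBundle.mem_baseSet_trivializationAt' _))] with m hm
  exact ((trivializationAt F V (b m₀)).linear ℝ hm).map_smul _ _

end BundleLemmas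

/-! ### Homogeneous frames, and sections as homogeneous functions. -/

section ScaledFibrations

variable {ES EK S K J : Type*} [NormedAddCommGroup ES] [NormedSpace ℝ ES]
  [NormedAddCommGroup EK] [NormedSpace ℝ EK]
  [TopologicalSpace S] [ChartedSpace ES S] [TopologicalSpace K] [ChartedSpace EK K]

/-- A locally trivial smooth fibration `pr : S → K` whose fibres are the orbits of a family of
smooth transformations `act j`, each with a nonzero scaling factor `χ j` which depends smoothly on
the point in local trivializations. -/
structure IsScaledFibration (act : J → S → S) (χ : J → ℝ) (pr : S → K) : Prop where
  contMDiff_act : ∀ j, ContMDiff 𝓘(ℝ, ES) 𝓘(ℝ, ES) ∞ (act j)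
  contMDiff : ContMDiff 𝓘(ℝ, ES) 𝓘(ℝ, EK) ∞ pr
  surjective : Function.Surjective pr
  eq_iff : ∀ x y : S, pr x = pr y ↔ ∃ j, act j x = y
  ne_zero : ∀ j, χ j ≠ 0
  locallyTrivial : ∀ k : K, ∃ (U : Set K) (ν : K → S) (r : S → ℝ), IsOpen U ∧ k ∈ U ∧
    ContMDiffOn 𝓘(ℝ, EK) 𝓘(ℝ, ES) ∞ ν U ∧ ContMDiffOn 𝓘(ℝ, ES) 𝓘(ℝ, ℝ) ∞ r (pr ⁻¹' U) ∧
    (∀ y ∈ U, pr (ν y) = y) ∧ ∀ x ∈ pr ⁻¹' U, ∃ j, act j (ν (pr x)) = x ∧ χ j = r x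

variable {act : J → S → S} {χ : J → ℝ} {pr : S → K}

theorem IsScaledFibration.pr_act (hpr : IsScaledFibration (ES := ES) (EK := EK) act χ pr) (j : J)
    (x : S) : pr (act j x) = pr x :=
  ((hpr.eq_iff x (act j x)).2 ⟨j, rfl⟩).symm

variable {L : K → Type*} [∀ k, AddCommGroup (L k)] [∀ k, Module ℝ (L k)]
  [∀ k, TopologicalSpace (L k)]

/-- A family of frames `A x` of the line `L (pr x)` which is homogeneous along the fibres. -/
def IsHomogeneousFrame (act : J → S → S) (χ : J → ℝ) (pr : S → K)
    (A : ∀ x : S, ℝ ≃L[ℝ] L (pr x)) : Prop :=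
  ∀ j x t, (TotalSpace.mk' ℝ (pr (act j x)) (A (act j x) t) : TotalSpace ℝ L) =
    TotalSpace.mk' ℝ (pr x) (A x (χ j * t))

/-- Moves a frame along an equality of base points; comparing in the total space avoids casts
between fibres. -/
theorem exists_frame_eq (A : ∀ x : S, ℝ ≃L[ℝ] L (pr x)) {x : S} {k : K} (h : pr x = k) :
    ∃ e : ℝ ≃L[ℝ] L k, ∀ t, (TotalSpace.mk' ℝ k (e t) : TotalSpace ℝ L) =
      TotalSpace.mk' ℝ (pr x) (A x t) := by
  subst h
  exact ⟨A x, fun _ => rfl⟩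

theorem exists_frame_coordinate (hpr : Function.Surjective pr) (A : ∀ x : S, ℝ ≃L[ℝ] L (pr x))
    (z : TotalSpace ℝ L) : ∃ x t, z = TotalSpace.mk' ℝ (pr x) (A x t) := by
  obtain ⟨k, v⟩ := z
  obtain ⟨x, rfl⟩ := hpr k
  exact ⟨x, (A x).symm v, by rw [ContinuousLinearEquiv.apply_symm_apply]⟩

theorem frame_mk_inj {A : ∀ x : S, ℝ ≃L[ℝ] L (pr x)} {x : S} {t t' : ℝ}
    (h : (TotalSpace.mk' ℝ (pr x) (A x t) : TotalSpace ℝ L) = TotalSpace.mk' ℝ (pr x) (A x t')) :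
    t = t' :=
  (A x).injective (TotalSpace.mk_injective (F := ℝ) (pr x) h)

/-- A homogeneous frame determines a smooth line bundle for which the frame is smooth. -/
theorem IsScaledFibration.exists_lineBundle
    (hpr : IsScaledFibration (ES := ES) (EK := EK) act χ pr)
    {A : ∀ x : S, ℝ ≃L[ℝ] L (pr x)} (hA : IsHomogeneousFrame act χ pr A) :
    ∃ (_ : TopologicalSpace (TotalSpace ℝ L)) (_ : FiberBundle ℝ L) (_ : VectorBundle ℝ ℝ L)
      (_ : ContMDiffVectorBundle ∞ ℝ L 𝓘(ℝ, EK)),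
      ContMDiff 𝓘(ℝ, ES) (𝓘(ℝ, EK).prod 𝓘(ℝ, ℝ)) ∞
        (fun x => (TotalSpace.mk' ℝ (pr x) (A x 1) : TotalSpace ℝ L)) := by
  choose U ν r hU hmem hν hr hpν hact using hpr.locallyTrivial
  have hframe : ∀ i k, ∃ e : ℝ ≃L[ℝ] L k, k ∈ U i → ∀ t,
      (TotalSpace.mk' ℝ k (e t) : TotalSpace ℝ L) =
        TotalSpace.mk' ℝ (pr (ν i k)) (A (ν i k) t) := by
    intro i k
    by_cases hk : k ∈ U i
    · obtain ⟨e, he⟩ := exists_frame_eq A (hpν i k hk)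
      exact ⟨e, fun _ => he⟩
    -- Outside U i any frame serves as a default value.
    · obtain ⟨x, hx⟩ := hpr.surjective k
      obtain ⟨e, -⟩ := exists_frame_eq A hx
      exact ⟨e, fun h => absurd h hk⟩
  choose e he using hframe
  have hAe : ∀ i x, x ∈ pr ⁻¹' U i →
      (TotalSpace.mk' ℝ (pr x) (A x 1) : TotalSpace ℝ L) =
        TotalSpace.mk' ℝ (pr x) (e i (pr x) (r i x)) := by
    intro i x hx
    obtain ⟨j, hj, hχ⟩ := hact i x hx
    have h := hA j (ν i (pr x)) 1
    rw [hj, mul_one, hχ, ← he i (pr x) hx] at h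
    exact h
  obtain ⟨i₁, i₂, i₃, i₄, hsec⟩ := _root_.exists_lineBundle (E := EK) L U hU
    (fun k => ⟨k, hmem k⟩) e (by
      intro i j
      -- The frame e i is A at the point ν i k, and A at any point over U j is e j multiplied by r
      -- j. So the transition function is r j ∘ ν i.
      have h : ContMDiffOn 𝓘(ℝ, EK) 𝓘(ℝ, ℝ) ∞ (fun k => r j (ν i k)) (U i ∩ U j) :=
        (hr j).comp ((hν i).mono Set.inter_subset_left) fun k hk => by
          change pr (ν i k) ∈ U j
          rw [hpν i k hk.1]
          exact hk.2
      refine h.congr fun k hk => ?_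
      have hmem' : ν i k ∈ pr ⁻¹' U j := by
        change pr (ν i k) ∈ U j
        rw [hpν i k hk.1]
        exact hk.2
      have h₁ := (he i k hk.1 1).trans (hAe j (ν i k) hmem')
      rw [hpν i k hk.1] at h₁
      have h₂ := TotalSpace.mk_injective (F := ℝ) k h₁
      rw [h₂, ContinuousLinearEquiv.symm_apply_apply])
  refine ⟨i₁, i₂, i₃, i₄, fun x => ?_⟩
  have hx : pr x ∈ U (pr x) := hmem _
  have hs := (hsec (pr x)).contMDiffAt ((hU (pr x)).mem_nhds hx)
  have hs' := hs.comp x (hpr.contMDiff x)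
  have hopen : pr ⁻¹' U (pr x) ∈ 𝓝 x :=
    ((hU (pr x)).preimage hpr.contMDiff.continuous).mem_nhds hx
  refine (ContMDiffAt.smul_along ((hr (pr x)).contMDiffAt hopen) hs').congr_of_eventuallyEq ?_
  filter_upwards [hopen] with y hy
  rw [hAe (pr x) y hy, ← map_smul, smul_eq_mul, mul_one]

section Bundle

variable [TopologicalSpace (TotalSpace ℝ L)] [FiberBundle ℝ L] [VectorBundle ℝ ℝ L]
  {A : ∀ x : S, ℝ ≃L[ℝ] L (pr x)}

theorem contMDiff_frame (hAsm : ContMDiff 𝓘(ℝ, ES) (𝓘(ℝ, EK).prod 𝓘(ℝ, ℝ)) ∞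
      (fun x => (TotalSpace.mk' ℝ (pr x) (A x 1) : TotalSpace ℝ L))) :
    ContMDiff (𝓘(ℝ, ℝ).prod 𝓘(ℝ, ES)) (𝓘(ℝ, EK).prod 𝓘(ℝ, ℝ)) ∞
      (fun p : ℝ × S => (TotalSpace.mk' ℝ (pr p.2) (A p.2 p.1) : TotalSpace ℝ L)) := by
  intro p
  have h := ContMDiffAt.smul_along (contMDiff_fst p) ((hAsm p.2).comp p contMDiffAt_snd)
  refine h.congr_of_eventuallyEq (.of_forall fun q => ?_)
  dsimp only
  rw [← map_smul, smul_eq_mul, mul_one]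

/-- The frame map `(t, x) ↦ A x t` has local smooth sections. -/
theorem IsScaledFibration.exists_local_lift [ContMDiffVectorBundle ∞ ℝ L 𝓘(ℝ, EK)]
    (hpr : IsScaledFibration (ES := ES) (EK := EK) act χ pr)
    (hAsm : ContMDiff 𝓘(ℝ, ES) (𝓘(ℝ, EK).prod 𝓘(ℝ, ℝ)) ∞
      (fun x => (TotalSpace.mk' ℝ (pr x) (A x 1) : TotalSpace ℝ L))) (z₀ : TotalSpace ℝ L) :
    ∃ (t : TotalSpace ℝ L → ℝ) (s : TotalSpace ℝ L → S),
      ContMDiffAt (𝓘(ℝ, EK).prod 𝓘(ℝ, ℝ)) 𝓘(ℝ, ℝ) ∞ t z₀ ∧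
      ContMDiffAt (𝓘(ℝ, EK).prod 𝓘(ℝ, ℝ)) 𝓘(ℝ, ES) ∞ s z₀ ∧
      ∀ᶠ z in 𝓝 z₀, z = TotalSpace.mk' ℝ (pr (s z)) (A (s z) (t z)) := by
  obtain ⟨U, ν, r, hU, hmem, hν, -, hpν, -⟩ := hpr.locallyTrivial z₀.proj
  have hproj : ContMDiffAt (𝓘(ℝ, EK).prod 𝓘(ℝ, ℝ)) 𝓘(ℝ, EK) ∞
      (TotalSpace.proj : TotalSpace ℝ L → K) z₀ := Bundle.contMDiff_proj L z₀
  have hs : ContMDiffAt (𝓘(ℝ, EK).prod 𝓘(ℝ, ℝ)) 𝓘(ℝ, ES) ∞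
      (fun z : TotalSpace ℝ L => ν z.proj) z₀ :=
    (hν.contMDiffAt (hU.mem_nhds hmem)).comp z₀ hproj
  let T := trivializationAt ℝ L z₀.proj
  have hbase : z₀.proj ∈ T.baseSet := FiberBundle.mem_baseSet_trivializationAt' _
  have hnum : ContMDiffAt (𝓘(ℝ, EK).prod 𝓘(ℝ, ℝ)) 𝓘(ℝ, ℝ) ∞
      (fun z : TotalSpace ℝ L => (T z).2) z₀ :=
    (contMDiffAt_totalSpace.1 (contMDiffAt_id (x := z₀))).2
  have hνz : pr (ν z₀.proj) = z₀.proj := hpν _ hmem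
  have hden : ContMDiffAt (𝓘(ℝ, EK).prod 𝓘(ℝ, ℝ)) 𝓘(ℝ, ℝ) ∞
      (fun z : TotalSpace ℝ L => (T (TotalSpace.mk' ℝ (pr (ν z.proj)) (A (ν z.proj) 1))).2) z₀ := by
    have h := (contMDiffAt_totalSpace.1 ((hAsm (ν z₀.proj)).comp z₀ hs)).2
    simp only [Function.comp_def] at h
    rw [hνz] at h
    exact h
  -- The coordinate of z in the frame at ν is a quotient of two coordinates in a trivialization; the
  -- denominator is nonzero because a frame is injective.
  have key : ∀ z : TotalSpace ℝ L, z.proj ∈ U → z.proj ∈ T.baseSet →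
      ((T (TotalSpace.mk' ℝ (pr (ν z.proj)) (A (ν z.proj) 1))).2 ≠ 0 ∧
      z = TotalSpace.mk' ℝ (pr (ν z.proj)) (A (ν z.proj)
        ((T z).2 / (T (TotalSpace.mk' ℝ (pr (ν z.proj)) (A (ν z.proj) 1))).2))) := by
    rintro ⟨k, v⟩ hkU hkT
    obtain ⟨e, he⟩ := exists_frame_eq A (hpν k hkU)
    dsimp only at hkU hkT ⊢
    rw [← he, ← he]
    let l := T.linearEquivAt ℝ k hkT
    have hl : ∀ w : L k, (T (TotalSpace.mk' ℝ k w)).2 = l w := fun w => rfl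
    have hne : l (e 1) ≠ 0 := by
      rw [ne_eq, LinearEquiv.map_eq_zero_iff, ContinuousLinearEquiv.map_eq_zero_iff]
      exact one_ne_zero
    have hv : (T (⟨k, v⟩ : TotalSpace ℝ L)).2 = l v := rfl
    rw [hl, hv]
    refine ⟨hne, ?_⟩
    have : v = e (l v / l (e 1)) := by
      apply l.injective
      have h1 : e (l v / l (e 1)) = (l v / l (e 1)) • e 1 := by
        rw [← map_smul, smul_eq_mul, mul_one]
      rw [h1, map_smul, smul_eq_mul, div_mul_cancel₀ _ hne]
    exact congrArg (TotalSpace.mk' ℝ k) this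
  refine ⟨_, _, hnum.div₀ hden (key z₀ hmem hbase).1, hs, ?_⟩
  filter_upwards [hproj.continuousAt (hU.mem_nhds hmem),
    hproj.continuousAt (T.open_baseSet.mem_nhds hbase)] with z h₁ h₂
  exact (key z h₁ h₂).2

theorem contMDiff_dual_frame
    (hAsm : ContMDiff 𝓘(ℝ, ES) (𝓘(ℝ, EK).prod 𝓘(ℝ, ℝ)) ∞
      (fun x => (TotalSpace.mk' ℝ (pr x) (A x 1) : TotalSpace ℝ L)))
    (h : DualSection EK L) :
    ContMDiff 𝓘(ℝ, ES) 𝓘(ℝ, ℝ) ∞ (fun x => (h (pr x) (A x 1) : ℝ)) :=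
  fun x => ContMDiffAt.dual_apply (h.contMDiff (pr x)) (hAsm x)

theorem dual_frame_act (hA : IsHomogeneousFrame act χ pr A) (h : DualSection EK L) (j : J) (x : S) :
    (h (pr (act j x)) (A (act j x) 1) : ℝ) = χ j * h (pr x) (A x 1) := by
  have := congrArg (fun z : TotalSpace ℝ L => (h z.proj z.snd : ℝ)) (hA j x 1)
  refine this.trans ?_
  change h (pr x) (A x (χ j * 1)) = _
  rw [← smul_eq_mul, map_smul]
  exact (h (pr x)).map_smul (χ j) (A x 1)

theorem dual_section_ext (hpr : Function.Surjective pr) {h h' : DualSection EK L}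
    (H : ∀ x, (h (pr x) (A x 1) : ℝ) = h' (pr x) (A x 1)) : h = h' := by
  apply ContMDiffSection.ext
  intro k
  obtain ⟨x, rfl⟩ := hpr k
  ext v
  obtain ⟨t, rfl⟩ := (A x).surjective v
  have ht : A x t = t • A x 1 := by rw [← map_smul, smul_eq_mul, mul_one]
  rw [ht]
  refine ((h (pr x)).map_smul t (A x 1)).trans (Eq.trans ?_ ((h' (pr x)).map_smul t (A x 1)).symm)
  exact congrArg (fun c : ℝ => t * c) (H x)

/-- The functional sends A x t to t F(x). Passing to act j x moves a factor χ j from the frame to F,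
so the choice of x is immaterial. Smoothness follows by lifting a local frame of L to pairs (t, x).
-/
theorem IsScaledFibration.exists_dual_section [ContMDiffVectorBundle ∞ ℝ L 𝓘(ℝ, EK)]
    (hpr : IsScaledFibration (ES := ES) (EK := EK) act χ pr)
    (hA : IsHomogeneousFrame act χ pr A)
    (hAsm : ContMDiff 𝓘(ℝ, ES) (𝓘(ℝ, EK).prod 𝓘(ℝ, ℝ)) ∞
      (fun x => (TotalSpace.mk' ℝ (pr x) (A x 1) : TotalSpace ℝ L)))
    {F : S → ℝ} (hF : ContMDiff 𝓘(ℝ, ES) 𝓘(ℝ, ℝ) ∞ F) (hFact : ∀ j x, F (act j x) = χ j * F x) :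
    ∃ h : DualSection EK L, ∀ x, (h (pr x) (A x 1) : ℝ) = F x := by
  have hex : ∀ k, ∃ φ : L k →L[ℝ] ℝ, ∀ (v : L k) (x : S) (t : ℝ),
      (TotalSpace.mk' ℝ k v : TotalSpace ℝ L) = TotalSpace.mk' ℝ (pr x) (A x t) →
        φ v = t * F x := by
    intro k
    obtain ⟨y, rfl⟩ := hpr.surjective k
    refine ⟨F y • ((A y).symm : L (pr y) →L[ℝ] ℝ), fun v x t h => ?_⟩
    obtain ⟨j, rfl⟩ := (hpr.eq_iff y x).1 (congrArg TotalSpace.proj h)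
    rw [hA j y t] at h
    obtain rfl := TotalSpace.mk_injective (F := ℝ) (pr y) h
    simp [hFact]
    ring
  choose φ hφ using hex
  refine ⟨⟨φ, fun k₀ => contMDiffAt_dual_section fun v => ?_⟩, fun x => ?_⟩
  · have hsymm := contMDiffAt_trivialization_symm (E := EK) (V := L) (F := ℝ) k₀ v
    obtain ⟨t, s, ht, hs, hz⟩ := hpr.exists_local_lift hAsm
      (TotalSpace.mk' ℝ k₀ ((trivializationAt ℝ L k₀).symm k₀ v))
    have hFt := (ht.comp k₀ hsymm).mul (hF.contMDiffAt.comp k₀ (hs.comp k₀ hsymm))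
    refine hFt.congr_of_eventuallyEq ?_
    filter_upwards [hsymm.continuousAt.eventually hz] with k hk
    exact hφ k _ _ _ hk
  · exact (hφ (pr x) (A x 1) x 1 rfl).trans (one_mul _)

end Bundle
end ScaledFibrations

/-! ### Derivatives along vector fields, and the Lie bracket as a commutator. -/

section TangentCalculus

variable {E M E' N E'' N' : Type*} [NormedAddCommGroup E] [NormedSpace ℝ E]
  [TopologicalSpace M] [ChartedSpace E M] [IsManifold 𝓘(ℝ, E) ∞ M]
  [NormedAddCommGroup E'] [NormedSpace ℝ E']
  [TopologicalSpace N] [ChartedSpace E' N] [IsManifold 𝓘(ℝ, E') ∞ N]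
  [NormedAddCommGroup E''] [NormedSpace ℝ E'']
  [TopologicalSpace N'] [ChartedSpace E'' N']

/-- Pushing forward a smooth family of tangent vectors by a smooth map. -/
theorem ContMDiffAt.mfderiv_along {b : N' → M} {v : ∀ m, TangentSpace 𝓘(ℝ, E) (b m)} {f : M → N}
    {m₀ : N'} (hf : ContMDiffAt 𝓘(ℝ, E) 𝓘(ℝ, E') ∞ f (b m₀))
    (hv : ContMDiffAt 𝓘(ℝ, E'') (𝓘(ℝ, E).prod 𝓘(ℝ, E)) ∞
      (fun m => (TotalSpace.mk' E (b m) (v m) : TangentBundle 𝓘(ℝ, E) M)) m₀) :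
    ContMDiffAt 𝓘(ℝ, E'') (𝓘(ℝ, E').prod 𝓘(ℝ, E')) ∞
      (fun m => (TotalSpace.mk' E' (f (b m)) (mfderiv 𝓘(ℝ, E) 𝓘(ℝ, E') f (b m) (v m)) :
        TangentBundle 𝓘(ℝ, E') N)) m₀ := by
  have hb : ContMDiffAt 𝓘(ℝ, E'') 𝓘(ℝ, E) ∞ b m₀ := (contMDiffAt_totalSpace.1 hv).1
  have h := (hf.mfderiv_const (m := ∞) le_rfl).comp m₀ hb
  exact ContMDiffAt.clm_apply_of_inCoordinates (b₂ := fun m => f (b m))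
    (E₂ := fun y => TangentSpace 𝓘(ℝ, E') y) h hv (hf.comp m₀ hb)

theorem ContMDiffAt.mvfderiv_along {b : N' → M} {v : ∀ m, TangentSpace 𝓘(ℝ, E) (b m)} {f : M → ℝ}
    {m₀ : N'} (hf : ContMDiffAt 𝓘(ℝ, E) 𝓘(ℝ, ℝ) ∞ f (b m₀))
    (hv : ContMDiffAt 𝓘(ℝ, E'') (𝓘(ℝ, E).prod 𝓘(ℝ, E)) ∞
      (fun m => (TotalSpace.mk' E (b m) (v m) : TangentBundle 𝓘(ℝ, E) M)) m₀) :
    ContMDiffAt 𝓘(ℝ, E'') 𝓘(ℝ, ℝ) ∞ (fun m => mvfderiv 𝓘(ℝ, E) f (b m) (v m)) m₀ := by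
  have h := (contMDiffAt_totalSpace.1 (hf.mfderiv_along hv)).2
  simp only [trivializationAt_model_space_apply] at h
  exact h

variable [CompleteSpace E]

open VectorField

/-- A vector field read in the chart at `x₀`. -/
def chartVectorField (x₀ : M) (X : ∀ x : M, TangentSpace 𝓘(ℝ, E) x) : E → E :=
  mpullbackWithin 𝓘(ℝ, E) 𝓘(ℝ, E) (extChartAt 𝓘(ℝ, E) x₀).symm X (Set.range 𝓘(ℝ, E))

/-- The derivative of the inverse chart, produced by the chain rule, cancels its inverse in the
pulled-back field. -/
theorem fderiv_comp_extChartAt_symm {f : M → ℝ} {x₀ : M} {e : E}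
    (he : e ∈ (extChartAt 𝓘(ℝ, E) x₀).target) (X : ∀ x : M, TangentSpace 𝓘(ℝ, E) x)
    (hf : MDifferentiableAt 𝓘(ℝ, E) 𝓘(ℝ, ℝ) f ((extChartAt 𝓘(ℝ, E) x₀).symm e)) :
    fderiv ℝ (f ∘ (extChartAt 𝓘(ℝ, E) x₀).symm) e (chartVectorField x₀ X e) =
      mvfderiv 𝓘(ℝ, E) f ((extChartAt 𝓘(ℝ, E) x₀).symm e)
        (X ((extChartAt 𝓘(ℝ, E) x₀).symm e)) := by
  have hA := isInvertible_mfderivWithin_extChartAt_symm he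
  have hd := mdifferentiableWithinAt_extChartAt_symm he
  have hcomp := mfderiv_comp_mfderivWithin e hf hd
    (by rw [ModelWithCorners.range_eq_univ]; exact uniqueMDiffWithinAt_univ _)
  have h1 : fderiv ℝ (f ∘ (extChartAt 𝓘(ℝ, E) x₀).symm) e =
      mfderivWithin 𝓘(ℝ, E) 𝓘(ℝ, ℝ) (f ∘ (extChartAt 𝓘(ℝ, E) x₀).symm) (Set.range 𝓘(ℝ, E)) e := by
    rw [ModelWithCorners.range_eq_univ, mfderivWithin_univ, mfderiv_eq_fderiv]
  rw [h1, hcomp]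
  change mfderiv 𝓘(ℝ, E) 𝓘(ℝ, ℝ) f _ (mfderivWithin 𝓘(ℝ, E) 𝓘(ℝ, E) _ _ e
    ((mfderivWithin 𝓘(ℝ, E) 𝓘(ℝ, E) _ _ e).inverse _)) = _
  rw [hA.self_apply_inverse]
  rfl

theorem SmoothVectorField.differentiableAt_chart {X : ∀ x : M, TangentSpace 𝓘(ℝ, E) x}
    (hX : SmoothVectorField X) (x : M) :
    DifferentiableAt ℝ (chartVectorField x X) (extChartAt 𝓘(ℝ, E) x x) := by
  have h := ((hX x).mdifferentiableAt (by simp)).mdifferentiableWithinAt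
    (s := Set.univ) |>.differentiableWithinAt_mpullbackWithin_vectorField
  have hs : (extChartAt 𝓘(ℝ, E) x).symm ⁻¹' Set.univ ∩ Set.range 𝓘(ℝ, E) = Set.univ := by
    rw [Set.preimage_univ, Set.univ_inter, ModelWithCorners.range_eq_univ]
  have h' : DifferentiableWithinAt ℝ (chartVectorField x X)
    ((extChartAt 𝓘(ℝ, E) x).symm ⁻¹' Set.univ ∩ Set.range 𝓘(ℝ, E)) (extChartAt 𝓘(ℝ, E) x x) := h
  rwa [hs, differentiableWithinAt_univ] at h'

theorem mlieBracket_eq_lieBracket_chart (X Y : ∀ x : M, TangentSpace 𝓘(ℝ, E) x) (x : M) :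
    mlieBracket 𝓘(ℝ, E) X Y x = lieBracket ℝ (chartVectorField x X) (chartVectorField x Y)
      (extChartAt 𝓘(ℝ, E) x x) := by
  have hs : (extChartAt 𝓘(ℝ, E) x).symm ⁻¹' Set.univ ∩ Set.range 𝓘(ℝ, E) = Set.univ := by
    rw [Set.preimage_univ, Set.univ_inter, ModelWithCorners.range_eq_univ]
  have hid : ∀ w : E, (ContinuousLinearMap.id ℝ E).inverse w = w := fun w => by simp
  rw [mlieBracket, mlieBracketWithin_apply, mfderiv_extChartAt_self]
  refine (hid _).trans ?_
  change lieBracketWithin ℝ (chartVectorField x X) (chartVectorField x Y) _ _ = _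
  rw [hs, lieBracketWithin_univ]

/-- Symmetry of second derivatives, read in the chart at x. It underlies the Jacobi identity, the
vanishing of d(df) and the brackets of projected fields. -/
theorem mvfderiv_mlieBracket {f : M → ℝ} {X Y : ∀ x : M, TangentSpace 𝓘(ℝ, E) x} {x : M}
    (hf : ContMDiff 𝓘(ℝ, E) 𝓘(ℝ, ℝ) ∞ f) (hX : SmoothVectorField X) (hY : SmoothVectorField Y) :
    mvfderiv 𝓘(ℝ, E) f x (mlieBracket 𝓘(ℝ, E) X Y x) =
      mvfderiv 𝓘(ℝ, E) (fun y => mvfderiv 𝓘(ℝ, E) f y (Y y)) x (X x) -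
      mvfderiv 𝓘(ℝ, E) (fun y => mvfderiv 𝓘(ℝ, E) f y (X y)) x (Y x) := by
  set φ := extChartAt 𝓘(ℝ, E) x with hφ
  have hsymm : φ.symm (φ x) = x := extChartAt_to_inv x
  have hmd : ∀ {g : M → ℝ}, ContMDiff 𝓘(ℝ, E) 𝓘(ℝ, ℝ) ∞ g → ∀ y,
      MDifferentiableAt 𝓘(ℝ, E) 𝓘(ℝ, ℝ) g y := fun hg y => hg.mdifferentiable (by simp) y
  have hXf : ContMDiff 𝓘(ℝ, E) 𝓘(ℝ, ℝ) ∞ (fun y => mvfderiv 𝓘(ℝ, E) f y (X y)) :=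
    fun y => ContMDiffAt.mvfderiv_along (b := fun y => y) (hf y) (hX y)
  have hYf : ContMDiff 𝓘(ℝ, E) 𝓘(ℝ, ℝ) ∞ (fun y => mvfderiv 𝓘(ℝ, E) f y (Y y)) :=
    fun y => ContMDiffAt.mvfderiv_along (b := fun y => y) (hf y) (hY y)
  -- An identity of germs, since it is differentiated once more below.
  have key : ∀ {g : M → ℝ} (Z : ∀ x : M, TangentSpace 𝓘(ℝ, E) x),
      ContMDiff 𝓘(ℝ, E) 𝓘(ℝ, ℝ) ∞ g →
      (fun e => fderiv ℝ (g ∘ φ.symm) e (chartVectorField x Z e))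
      =ᶠ[𝓝 (φ x)] fun e => mvfderiv 𝓘(ℝ, E) g (φ.symm e) (Z (φ.symm e)) := by
    intro g Z hg
    filter_upwards [extChartAt_target_mem_nhds (I := 𝓘(ℝ, E)) x] with e he
    exact fderiv_comp_extChartAt_symm he Z (hmd hg _)
  have key' : ∀ {g : M → ℝ} (Z : ∀ x : M, TangentSpace 𝓘(ℝ, E) x),
      ContMDiff 𝓘(ℝ, E) 𝓘(ℝ, ℝ) ∞ g →
      fderiv ℝ (g ∘ φ.symm) (φ x) (chartVectorField x Z (φ x)) = mvfderiv 𝓘(ℝ, E) g x (Z x) := by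
    intro g Z hg
    exact (key Z hg).self_of_nhds.trans (congrArg (fun y => mvfderiv 𝓘(ℝ, E) g y (Z y)) hsymm)
  have hf' : ContDiffAt ℝ ∞ (f ∘ φ.symm) (φ x) := by
    have h := (hf.contMDiffAt (x := φ.symm (φ x))).comp (φ x)
      ((contMDiffOn_extChartAt_symm (I := 𝓘(ℝ, E)) (n := ∞) x).contMDiffAt
        (extChartAt_target_mem_nhds x))
    exact h.contDiffAt
  have hbr := fderiv_apply_lieBracket (n := ∞) hf'
    (by simp [minSmoothness_of_isRCLikeNormedField]; exact WithTop.coe_le_coe.2 le_top)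
    (hY.differentiableAt_chart x) (hX.differentiableAt_chart x)
  have e1 := (key Y hf).fderiv_eq (𝕜 := ℝ)
  have e2 := (key X hf).fderiv_eq (𝕜 := ℝ)
  rw [e1, e2] at hbr
  rw [← key' X hYf, ← key' Y hXf, mlieBracket_eq_lieBracket_chart]
  refine Eq.trans ?_ hbr
  rw [(hmd hf x).mvfderiv, ModelWithCorners.range_eq_univ, fderivWithin_univ]
  rfl

end TangentCalculus

/-! ### Functions with prescribed differential. -/

section Functions

variable {E M : Type*} [NormedAddCommGroup E] [NormedSpace ℝ E] [FiniteDimensional ℝ E]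
  [TopologicalSpace M] [ChartedSpace E M] [IsManifold 𝓘(ℝ, E) ∞ M] [T2Space M]

/-- Existence of smooth functions with a prescribed differential and small support. -/
theorem exists_contMDiff_mvfderiv_eq {x : M} {U : Set M} (hU : U ∈ 𝓝 x)
    (l : TangentSpace 𝓘(ℝ, E) x →L[ℝ] ℝ) :
    ∃ f : M → ℝ, ContMDiff 𝓘(ℝ, E) 𝓘(ℝ, ℝ) ∞ f ∧ f x = 0 ∧ mvfderiv 𝓘(ℝ, E) f x = l ∧
      tsupport f ⊆ U := by
  obtain ⟨χ, hχ, -⟩ := (SmoothBumpFunction.nhds_basis_support (I := 𝓘(ℝ, E)) hU).mem_iff.1 hU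
  let l' : E →L[ℝ] ℝ := l
  -- The functional l read in the chart centred at x, to be cut off by the bump. Its differential at
  -- x is l because the chart has identity derivative at its centre.
  let g : M → ℝ := fun y => l' (extChartAt 𝓘(ℝ, E) x y - extChartAt 𝓘(ℝ, E) x x)
  have hl : ContMDiff 𝓘(ℝ, E) 𝓘(ℝ, ℝ) ∞ fun e => l' (e - extChartAt 𝓘(ℝ, E) x x) :=
    (l'.contDiff.comp (contDiff_id.sub contDiff_const)).contMDiff
  have hg : ContMDiffOn 𝓘(ℝ, E) 𝓘(ℝ, ℝ) ∞ g (chartAt E x).source :=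
    hl.comp_contMDiffOn (contMDiffOn_extChartAt (I := 𝓘(ℝ, E)))
  have hfg : (fun y => χ y • g y) =ᶠ[𝓝 x] g := by
    filter_upwards [χ.eventuallyEq_one] with y hy
    rw [hy, Pi.one_apply, one_smul]
  refine ⟨fun y => χ y • g y, χ.contMDiff_smul hg, ?_, ?_, ?_⟩
  · simp [g]
  · have h1 : HasMFDerivAt 𝓘(ℝ, E) 𝓘(ℝ, E) (extChartAt 𝓘(ℝ, E) x) x
        (ContinuousLinearMap.id ℝ E) := by
      have h := (mdifferentiableAt_extChartAt (I := 𝓘(ℝ, E)) (mem_chart_source E x)).hasMFDerivAt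
      rwa [mfderiv_extChartAt_self] at h
    have h2 : HasMFDerivAt 𝓘(ℝ, E) 𝓘(ℝ, ℝ) (fun e => l' (e - extChartAt 𝓘(ℝ, E) x x))
        (extChartAt 𝓘(ℝ, E) x x) l' :=
      (l'.hasFDerivAt.comp _ ((hasFDerivAt_id _).sub_const _)).hasMFDerivAt
    have h3 := ((h2.comp x h1).congr_of_eventuallyEq hfg).mfderiv
    exact h3
  · exact (tsupport_smul_subset_left _ _).trans hχ

theorem eq_of_forall_mvfderiv_eq {x : M} {v w : TangentSpace 𝓘(ℝ, E) x}
    (h : ∀ f : M → ℝ, ContMDiff 𝓘(ℝ, E) 𝓘(ℝ, ℝ) ∞ f →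
      mvfderiv 𝓘(ℝ, E) f x v = mvfderiv 𝓘(ℝ, E) f x w) : v = w := by
  have hE : ∀ v w : E, (∀ l : E →L[ℝ] ℝ, l v = l w) → v = w := fun v w h =>
    eq_of_sub_eq_zero (SeparatingDual.eq_zero_of_forall_dual_eq_zero (R := ℝ) fun l => by
      rw [map_sub, h, sub_self])
  refine hE v w fun l => ?_
  obtain ⟨f, hf, -, hl, -⟩ := exists_contMDiff_mvfderiv_eq (x := x) Filter.univ_mem l
  have h' := h f hf
  rw [hl] at h'
  exact h'

end Functions

/-! ### Nondegenerate forms and Hamiltonian vector fields. -/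

section LinearAlgebra

theorem finrank_continuousDual (V : Type*) [NormedAddCommGroup V] [NormedSpace ℝ V]
    [FiniteDimensional ℝ V] : Module.finrank ℝ (V →L[ℝ] ℝ) = Module.finrank ℝ V := by
  rw [← (LinearMap.toContinuousLinearMap (𝕜 := ℝ) (E := V) (F' := ℝ)).finrank_eq]
  exact Subspace.dual_finrank_eq

/-- Nondegeneracy is injectivity, and V and its dual have equal dimension. Hence `inverse` in
`hamiltonianVectorField` is a genuine inverse and not its default value. -/
theorem isInvertible_of_nondegenerate {V : Type*} [NormedAddCommGroup V] [NormedSpace ℝ V]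
    [FiniteDimensional ℝ V] {f : V →L[ℝ] V →L[ℝ] ℝ} (hf : ∀ v, (∀ w, f v w = 0) → v = 0) :
    f.IsInvertible := by
  have hinj : Function.Injective f.toLinearMap := by
    rw [← LinearMap.ker_eq_bot, LinearMap.ker_eq_bot']
    exact fun v hv => hf v fun w => by
      have : f v = 0 := hv
      rw [this]; rfl
  exact ⟨(LinearEquiv.ofInjectiveOfFinrankEq f.toLinearMap hinj
    (finrank_continuousDual V).symm).toContinuousLinearEquiv, by ext; rfl⟩

end LinearAlgebra

section Hamiltonian

variable {E M : Type*} [NormedAddCommGroup E] [NormedSpace ℝ E] [FiniteDimensional ℝ E]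
  [TopologicalSpace M] [ChartedSpace E M] [IsManifold 𝓘(ℝ, E) ∞ M]
  {Ω : ∀ x : M, TangentSpace 𝓘(ℝ, E) x →L[ℝ] TangentSpace 𝓘(ℝ, E) x →L[ℝ] ℝ}

theorem IsSymplectic.isInvertible (hΩ : IsSymplectic Ω) (x : M) : (Ω x).IsInvertible :=
  isInvertible_of_nondegenerate (V := E) (hΩ.nondegenerate x)

theorem IsSymplectic.apply_hamiltonianVectorField (hΩ : IsSymplectic Ω) (F : M → ℝ) (x : M) :
    Ω x (hamiltonianVectorField Ω F x) = mvfderiv 𝓘(ℝ, E) F x :=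
  (hΩ.isInvertible x).self_apply_inverse _

theorem IsSymplectic.swap (hΩ : IsSymplectic Ω) (x : M) (v w : TangentSpace 𝓘(ℝ, E) x) :
    Ω x v w = -Ω x w v := by
  have h := hΩ.alternating x (v + w)
  simp only [map_add, add_apply, hΩ.alternating, zero_add, add_zero] at h
  linarith

theorem IsSymplectic.eq_of_apply_eq (hΩ : IsSymplectic Ω) {x : M} {v w : TangentSpace 𝓘(ℝ, E) x}
    (h : ∀ u, Ω x v u = Ω x w u) : v = w := by
  refine eq_of_sub_eq_zero (hΩ.nondegenerate x _ fun u => ?_)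
  rw [map_sub, sub_apply, h, sub_self]

/-- In a trivialization the field is the inverse of the coordinate expression B of Ω applied to that
of dF, and inversion of operators is smooth at an invertible one. -/
theorem IsSymplectic.smooth_hamiltonianVectorField (hΩ : IsSymplectic Ω) {F : M → ℝ}
    (hF : ContMDiff 𝓘(ℝ, E) 𝓘(ℝ, ℝ) ∞ F) : SmoothVectorField (hamiltonianVectorField Ω F) := by
  intro x₀
  rw [contMDiffAt_section]
  let T := trivializationAt E (TangentSpace 𝓘(ℝ, E) : M → Type _) x₀
  have hx₀ : x₀ ∈ T.baseSet := FiberBundle.mem_baseSet_trivializationAt' x₀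
  let Tl : M → E →L[ℝ] E := fun y => T.symmL ℝ y
  let ψ : M → E →L[ℝ] ℝ := fun y => (mvfderiv 𝓘(ℝ, E) F y : E →L[ℝ] ℝ).comp (Tl y)
  let B : M → E →L[ℝ] E →L[ℝ] ℝ := fun y =>
    (ContinuousLinearMap.precomp ℝ (Tl y)).comp ((Ω y : E →L[ℝ] E →L[ℝ] ℝ).comp (Tl y))
  have hsymm : ∀ v, ContMDiffAt 𝓘(ℝ, E) (𝓘(ℝ, E).prod 𝓘(ℝ, E)) ∞
      (fun y => (TotalSpace.mk' E y (T.symm y v) : TangentBundle 𝓘(ℝ, E) M)) x₀ :=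
    fun v => contMDiffAt_trivialization_symm x₀ v
  have hTl : ∀ y ∈ T.baseSet, ∀ v, Tl y v = T.symm y v := fun y hy v => T.symmL_apply hy v
  have hψ : ContMDiffAt 𝓘(ℝ, E) 𝓘(ℝ, E →L[ℝ] ℝ) ∞ ψ x₀ := by
    refine contMDiffAt_clm_of_forall fun v => ?_
    refine (ContMDiffAt.mvfderiv_along (b := fun y => y) (hF x₀) (hsymm v)).congr_of_eventuallyEq ?_
    filter_upwards [T.open_baseSet.mem_nhds hx₀] with y hy
    exact congrArg (mvfderiv 𝓘(ℝ, E) F y) (hTl y hy v)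
  have hB : ContMDiffAt 𝓘(ℝ, E) 𝓘(ℝ, E →L[ℝ] E →L[ℝ] ℝ) ∞ B x₀ := by
    refine contMDiffAt_clm_of_forall fun v => contMDiffAt_clm_of_forall fun w => ?_
    have h1 := ContMDiffAt.clm_bundle_apply (hΩ.contMDiff x₀) (hsymm v)
    have h2 := ContMDiffAt.dual_apply h1 (hsymm w)
    refine h2.congr_of_eventuallyEq ?_
    filter_upwards [T.open_baseSet.mem_nhds hx₀] with y hy
    change Ω y (Tl y v) (Tl y w) = _
    rw [hTl y hy v, hTl y hy w]
  have hleft : ∀ y ∈ T.baseSet, ∀ v, (T ⟨y, Tl y v⟩).2 = v := fun y hy v => by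
    rw [hTl y hy v]
    exact congrArg Prod.snd (T.apply_mk_symm hy v)
  have hright : ∀ y ∈ T.baseSet, ∀ u : TangentSpace 𝓘(ℝ, E) y, Tl y (T ⟨y, u⟩).2 = u :=
    fun y hy u => by
      rw [hTl y hy]
      exact T.symm_apply_apply_mk hy u
  have hnd : ∀ y ∈ T.baseSet, (B y).IsInvertible := fun y hy =>
    isInvertible_of_nondegenerate fun v hv => by
      have h0 : Tl y v = 0 := hΩ.nondegenerate y _ fun u => by
        have := hv (T ⟨y, u⟩).2
        change Ω y (Tl y v) (Tl y (T ⟨y, u⟩).2) = 0 at this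
        rwa [hright y hy u] at this
      rw [← hleft y hy v, h0]
      exact (T.linear ℝ hy).map_zero
  have hcoord : (fun y => (T ⟨y, hamiltonianVectorField Ω F y⟩).2) =ᶠ[𝓝 x₀]
      fun y => (B y).inverse (ψ y) := by
    filter_upwards [T.open_baseSet.mem_nhds hx₀] with y hy
    symm
    rw [(hnd y hy).inverse_apply_eq]
    ext v
    change mvfderiv 𝓘(ℝ, E) F y (Tl y v) = Ω y (Tl y (T ⟨y, _⟩).2) (Tl y v)
    rw [hright y hy, hΩ.apply_hamiltonianVectorField]
  refine ContMDiffAt.congr_of_eventuallyEq ?_ hcoord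
  obtain ⟨e, he⟩ := hnd x₀ hx₀
  have hinv : ContDiffAt ℝ ∞ ContinuousLinearMap.inverse (B x₀) := by
    rw [← he]
    exact contDiffAt_map_inverse e
  exact (hinv.contMDiffAt.comp x₀ hB).clm_apply hψ

end Hamiltonian

/-! ### The Poisson bracket. -/

section Poisson

variable {E M : Type*} [NormedAddCommGroup E] [NormedSpace ℝ E] [FiniteDimensional ℝ E]
  [TopologicalSpace M] [ChartedSpace E M] [IsManifold 𝓘(ℝ, E) ∞ M]
  {Ω : ∀ x : M, TangentSpace 𝓘(ℝ, E) x →L[ℝ] TangentSpace 𝓘(ℝ, E) x →L[ℝ] ℝ}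

theorem poissonBracket_eq (hΩ : IsSymplectic Ω) (F G : M → ℝ) (x : M) :
    poissonBracket Ω F G x =
      Ω x (hamiltonianVectorField Ω G x) (hamiltonianVectorField Ω F x) := by
  rw [hΩ.apply_hamiltonianVectorField]
  rfl

theorem poissonBracket_swap (hΩ : IsSymplectic Ω) (F G : M → ℝ) (x : M) :
    poissonBracket Ω F G x = -poissonBracket Ω G F x := by
  rw [poissonBracket_eq hΩ, poissonBracket_eq hΩ, hΩ.swap]

theorem contMDiff_poissonBracket (hΩ : IsSymplectic Ω) {F G : M → ℝ}
    (hF : ContMDiff 𝓘(ℝ, E) 𝓘(ℝ, ℝ) ∞ F) (hG : ContMDiff 𝓘(ℝ, E) 𝓘(ℝ, ℝ) ∞ G) :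
    ContMDiff 𝓘(ℝ, E) 𝓘(ℝ, ℝ) ∞ (poissonBracket Ω F G) := fun x =>
  ContMDiffAt.mvfderiv_along (b := fun y => y) (hG x) (hΩ.smooth_hamiltonianVectorField hF x)

theorem poissonBracket_add_right {F G₁ G₂ : M → ℝ} {x : M}
    (h₁ : MDifferentiableAt 𝓘(ℝ, E) 𝓘(ℝ, ℝ) G₁ x) (h₂ : MDifferentiableAt 𝓘(ℝ, E) 𝓘(ℝ, ℝ) G₂ x) :
    poissonBracket Ω F (G₁ + G₂) x = poissonBracket Ω F G₁ x + poissonBracket Ω F G₂ x := by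
  rw [poissonBracket, mvfderiv_add h₁ h₂]
  rfl

theorem poissonBracket_mul_right {F f G : M → ℝ} {x : M}
    (hf : MDifferentiableAt 𝓘(ℝ, E) 𝓘(ℝ, ℝ) f x) (hG : MDifferentiableAt 𝓘(ℝ, E) 𝓘(ℝ, ℝ) G x) :
    poissonBracket Ω F (f * G) x = f x * poissonBracket Ω F G x +
      mvfderiv 𝓘(ℝ, E) f x (hamiltonianVectorField Ω F x) * G x := by
  rw [poissonBracket, mvfderiv_mul hf hG]
  simp [poissonBracket, mul_comm]

theorem poissonBracket_smul_right {F G : M → ℝ} {x : M} (c : ℝ)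
    (hG : MDifferentiableAt 𝓘(ℝ, E) 𝓘(ℝ, ℝ) G x) :
    poissonBracket Ω F (c • G) x = c * poissonBracket Ω F G x := by
  have h : c • G = (fun _ => c) * G := rfl
  rw [h, poissonBracket_mul_right mdifferentiableAt_const hG, mvfderiv_const]
  simp

theorem poissonBracket_neg_right {F G : M → ℝ} {x : M} :
    poissonBracket Ω F (-G) x = -poissonBracket Ω F G x := by
  rw [poissonBracket, mvfderiv_neg]
  rfl

open VectorField in
/-- The Jacobi identity, which expresses that the symplectic form is closed. -/
theorem poissonBracket_jacobi (hΩ : IsSymplectic Ω) {F₁ F₂ F₃ : M → ℝ}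
    (h₁ : ContMDiff 𝓘(ℝ, E) 𝓘(ℝ, ℝ) ∞ F₁) (h₂ : ContMDiff 𝓘(ℝ, E) 𝓘(ℝ, ℝ) ∞ F₂)
    (h₃ : ContMDiff 𝓘(ℝ, E) 𝓘(ℝ, ℝ) ∞ F₃) (x : M) :
    poissonBracket Ω F₁ (poissonBracket Ω F₂ F₃) x + poissonBracket Ω F₂ (poissonBracket Ω F₃ F₁) x
      + poissonBracket Ω F₃ (poissonBracket Ω F₁ F₂) x = 0 := by
  have hX₁ := hΩ.smooth_hamiltonianVectorField h₁
  have hX₂ := hΩ.smooth_hamiltonianVectorField h₂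
  have hX₃ := hΩ.smooth_hamiltonianVectorField h₃
  have hcl := hΩ.closed _ _ _ hX₁ hX₂ hX₃ x
  have hpair : ∀ F G : M → ℝ, (fun y => Ω y (hamiltonianVectorField Ω F y)
      (hamiltonianVectorField Ω G y)) = poissonBracket Ω G F := fun F G =>
    funext fun y => (poissonBracket_eq hΩ G F y).symm
  have hbr : ∀ {F G K : M → ℝ}, ContMDiff 𝓘(ℝ, E) 𝓘(ℝ, ℝ) ∞ F → ContMDiff 𝓘(ℝ, E) 𝓘(ℝ, ℝ) ∞ G →
      ContMDiff 𝓘(ℝ, E) 𝓘(ℝ, ℝ) ∞ K →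
      Ω x (mlieBracket 𝓘(ℝ, E) (hamiltonianVectorField Ω F) (hamiltonianVectorField Ω G) x)
        (hamiltonianVectorField Ω K x) =
      -(poissonBracket Ω F (poissonBracket Ω G K) x - poissonBracket Ω G (poissonBracket Ω F K) x) := by
    intro F G K hF hG hK
    rw [hΩ.swap, hΩ.apply_hamiltonianVectorField,
      mvfderiv_mlieBracket hK (hΩ.smooth_hamiltonianVectorField hF)
        (hΩ.smooth_hamiltonianVectorField hG)]
    rfl
  have hsw : ∀ F G K : M → ℝ, poissonBracket Ω F (poissonBracket Ω G K) x =
      -poissonBracket Ω F (poissonBracket Ω K G) x := by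
    intro F G K
    rw [← poissonBracket_neg_right]
    congr 1
    exact funext fun y => poissonBracket_swap hΩ G K y
  -- All six terms are iterated Poisson brackets: the three derivatives add up to minus the cyclic
  -- sum, the three Lie bracket terms to twice the cyclic sum.
  unfold extDerivTwo at hcl
  rw [hpair, hpair, hpair, hbr h₁ h₂ h₃, hbr h₁ h₃ h₂, hbr h₂ h₃ h₁] at hcl
  change poissonBracket Ω F₁ (poissonBracket Ω F₃ F₂) x -
    poissonBracket Ω F₂ (poissonBracket Ω F₃ F₁) x +
    poissonBracket Ω F₃ (poissonBracket Ω F₂ F₁) x - _ + _ - _ = 0 at hcl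
  rw [hsw F₁ F₃ F₂, hsw F₃ F₂ F₁, hsw F₂ F₁ F₃] at hcl
  linarith

/-- The commutator form of the Jacobi identity. -/
theorem poissonBracket_leibniz (hΩ : IsSymplectic Ω) {F G K : M → ℝ}
    (hF : ContMDiff 𝓘(ℝ, E) 𝓘(ℝ, ℝ) ∞ F) (hG : ContMDiff 𝓘(ℝ, E) 𝓘(ℝ, ℝ) ∞ G)
    (hK : ContMDiff 𝓘(ℝ, E) 𝓘(ℝ, ℝ) ∞ K) (x : M) :
    poissonBracket Ω (poissonBracket Ω F G) K x =
      poissonBracket Ω F (poissonBracket Ω G K) x - poissonBracket Ω G (poissonBracket Ω F K) x := by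
  have h := poissonBracket_jacobi hΩ hF hG hK x
  have hsw : poissonBracket Ω G (poissonBracket Ω K F) x =
      -poissonBracket Ω G (poissonBracket Ω F K) x := by
    rw [← poissonBracket_neg_right]
    congr 1
    exact funext fun y => poissonBracket_swap hΩ K F y
  rw [hsw, poissonBracket_swap hΩ K] at h
  linarith

end Poisson

/-! ### Homogeneous functions and their Hamiltonian fields. -/

section Homogeneous

variable {ES EK S K J : Type*} [NormedAddCommGroup ES] [NormedSpace ℝ ES] [FiniteDimensional ℝ ES]
  [NormedAddCommGroup EK] [NormedSpace ℝ EK]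
  [TopologicalSpace S] [ChartedSpace ES S] [IsManifold 𝓘(ℝ, ES) ∞ S]
  [TopologicalSpace K] [ChartedSpace EK K] [IsManifold 𝓘(ℝ, EK) ∞ K]

/-- The smooth functions which are multiplied by `χ j` under the transformation `act j`. -/
def homogeneousFunctions (act : J → S → S) (χ : J → ℝ) : Submodule ℝ (S → ℝ) where
  carrier := {F | ContMDiff 𝓘(ℝ, ES) 𝓘(ℝ, ℝ) ∞ F ∧ ∀ j x, F (act j x) = χ j * F x}
  add_mem' {F G} hF hG := ⟨hF.1.add hG.1, fun j x => by
    simp only [Pi.add_apply, hF.2, hG.2, mul_add]⟩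
  zero_mem' := ⟨contMDiff_const, fun j x => by simp⟩
  smul_mem' c F hF := ⟨(contMDiff_const (c := c)).mul hF.1, fun j x => by
    simp only [Pi.smul_apply, hF.2, smul_eq_mul]; ring⟩

variable {act : J → S → S} {χ : J → ℝ} {pr : S → K}
  {Ω : ∀ x : S, TangentSpace 𝓘(ℝ, ES) x →L[ℝ] TangentSpace 𝓘(ℝ, ES) x →L[ℝ] ℝ}

/-- The transformations `act j` multiply the form by `χ j`. -/
def IsHomogeneousForm (act : J → S → S) (χ : J → ℝ)
    (Ω : ∀ x : S, TangentSpace 𝓘(ℝ, ES) x →L[ℝ] TangentSpace 𝓘(ℝ, ES) x →L[ℝ] ℝ) : Prop :=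
  ∀ j (x : S) (v w : TangentSpace 𝓘(ℝ, ES) x),
    Ω (act j x) (mfderiv 𝓘(ℝ, ES) 𝓘(ℝ, ES) (act j) x v)
      (mfderiv 𝓘(ℝ, ES) 𝓘(ℝ, ES) (act j) x w) = χ j * Ω x v w

/-- A vector killed by the derivative is Ω-orthogonal to everything, as χ j is nonzero; an injective
endomorphism in finite dimension is onto. No inverse transformation is required. -/
theorem IsHomogeneousForm.surjective_mfderiv (hact : IsHomogeneousForm act χ Ω)
    (hΩ : IsSymplectic Ω) {j : J} (hj : χ j ≠ 0) (x : S) :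
    Function.Surjective (mfderiv 𝓘(ℝ, ES) 𝓘(ℝ, ES) (act j) x) := by
  let T : ES →L[ℝ] ES := mfderiv 𝓘(ℝ, ES) 𝓘(ℝ, ES) (act j) x
  have hT : Function.Injective (T : ES →ₗ[ℝ] ES) → Function.Surjective (T : ES →ₗ[ℝ] ES) :=
    LinearMap.surjective_of_injective
  refine hT ?_
  rw [← LinearMap.ker_eq_bot, LinearMap.ker_eq_bot']
  intro v hv
  refine hΩ.nondegenerate x v fun w => ?_
  have h := hact j x v w
  have hv' : mfderiv 𝓘(ℝ, ES) 𝓘(ℝ, ES) (act j) x v = 0 := hv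
  rw [hv', map_zero] at h
  exact (mul_eq_zero.1 h.symm).resolve_left hj

theorem mvfderiv_act {F : S → ℝ} (hF : F ∈ homogeneousFunctions (ES := ES) act χ) {j : J}
    (hj : ContMDiff 𝓘(ℝ, ES) 𝓘(ℝ, ES) ∞ (act j)) (x : S) (w : TangentSpace 𝓘(ℝ, ES) x) :
    mvfderiv 𝓘(ℝ, ES) F (act j x) (mfderiv 𝓘(ℝ, ES) 𝓘(ℝ, ES) (act j) x w) =
      χ j * mvfderiv 𝓘(ℝ, ES) F x w := by
  rw [← mvfderiv_comp_apply x (hF.1.mdifferentiable (by simp) _) (hj.mdifferentiable (by simp) _)]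
  have h : F ∘ act j = (fun _ => χ j) * F := funext fun y => hF.2 j y
  rw [h, mvfderiv_mul mdifferentiableAt_const (hF.1.mdifferentiable (by simp) _), mvfderiv_const]
  simp

/-- Hamiltonian vector fields of homogeneous functions are invariant. -/
theorem hamiltonianVectorField_act (hΩ : IsSymplectic Ω) (hact : IsHomogeneousForm act χ Ω)
    {F : S → ℝ} (hF : F ∈ homogeneousFunctions (ES := ES) act χ) {j : J} (hχ : χ j ≠ 0)
    (hj : ContMDiff 𝓘(ℝ, ES) 𝓘(ℝ, ES) ∞ (act j)) (x : S) :
    hamiltonianVectorField Ω F (act j x) =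
      mfderiv 𝓘(ℝ, ES) 𝓘(ℝ, ES) (act j) x (hamiltonianVectorField Ω F x) := by
  refine hΩ.eq_of_apply_eq fun u => ?_
  obtain ⟨w, rfl⟩ := hact.surjective_mfderiv hΩ hχ x u
  rw [hact, hΩ.apply_hamiltonianVectorField, hΩ.apply_hamiltonianVectorField, mvfderiv_act hF hj]

/-- The field X_F is invariant, so the only factor is the one from dG. -/
theorem poissonBracket_mem (hΩ : IsSymplectic Ω) (hact : IsHomogeneousForm act χ Ω)
    (hpr : IsScaledFibration (ES := ES) (EK := EK) act χ pr) {F G : S → ℝ}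
    (hF : F ∈ homogeneousFunctions (ES := ES) act χ)
    (hG : G ∈ homogeneousFunctions (ES := ES) act χ) :
    poissonBracket Ω F G ∈ homogeneousFunctions (ES := ES) act χ := by
  refine ⟨contMDiff_poissonBracket hΩ hF.1 hG.1, fun j x => ?_⟩
  rw [poissonBracket, hamiltonianVectorField_act hΩ hact hF (hpr.ne_zero j) (hpr.contMDiff_act j),
    mvfderiv_act hG (hpr.contMDiff_act j)]
  rfl

/-- Some act j carries x to y; it preserves X_F and pr. The two vectors are compared in the model
space, since their base points are only propositionally equal. -/
theorem mfderiv_pr_hamiltonianVectorField (hΩ : IsSymplectic Ω) (hact : IsHomogeneousForm act χ Ω)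
    (hpr : IsScaledFibration (ES := ES) (EK := EK) act χ pr) {F : S → ℝ}
    (hF : F ∈ homogeneousFunctions (ES := ES) act χ) {x y : S} (hxy : pr x = pr y) :
    (mfderiv 𝓘(ℝ, ES) 𝓘(ℝ, EK) pr x (hamiltonianVectorField Ω F x) : EK) =
      mfderiv 𝓘(ℝ, ES) 𝓘(ℝ, EK) pr y (hamiltonianVectorField Ω F y) := by
  obtain ⟨j, rfl⟩ := (hpr.eq_iff x y).1 hxy
  rw [hamiltonianVectorField_act hΩ hact hF (hpr.ne_zero j) (hpr.contMDiff_act j)]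
  have h1 := mfderiv_comp_apply x (hpr.contMDiff.mdifferentiable (by simp) (act j x))
    ((hpr.contMDiff_act j).mdifferentiable (by simp) x) (hamiltonianVectorField Ω F x)
  have h2 : pr ∘ act j = pr := funext fun z => hpr.pr_act j z
  have h3 := congrArg (fun f : S → K => (mfderiv 𝓘(ℝ, ES) 𝓘(ℝ, EK) f x : ES →L[ℝ] EK)
    (hamiltonianVectorField Ω F x)) h2
  exact h3.symm.trans h1

/-- The projected Hamiltonian vector fields of homogeneous functions. -/
theorem exists_projected_hamiltonianVectorField (hΩ : IsSymplectic Ω)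
    (hact : IsHomogeneousForm act χ Ω)
    (hpr : IsScaledFibration (ES := ES) (EK := EK) act χ pr) {F : S → ℝ}
    (hF : F ∈ homogeneousFunctions (ES := ES) act χ) :
    ∃ X : ∀ k : K, TangentSpace 𝓘(ℝ, EK) k, SmoothVectorField X ∧
      ∀ x, mfderiv 𝓘(ℝ, ES) 𝓘(ℝ, EK) pr x (hamiltonianVectorField Ω F x) = X (pr x) := by
  choose s hs using hpr.surjective
  let X : ∀ k : K, TangentSpace 𝓘(ℝ, EK) k := fun k =>
    (mfderiv 𝓘(ℝ, ES) 𝓘(ℝ, EK) pr (s k) (hamiltonianVectorField Ω F (s k)) : EK)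
  have hX : ∀ x, mfderiv 𝓘(ℝ, ES) 𝓘(ℝ, EK) pr x (hamiltonianVectorField Ω F x) = X (pr x) :=
    fun x => mfderiv_pr_hamiltonianVectorField hΩ hact hpr hF (hs (pr x)).symm
  refine ⟨X, fun k => ?_, hX⟩
  -- The pointwise choice s is not smooth, but near k the field may be computed along the smooth
  -- section ν instead.
  obtain ⟨U, ν, r, hU, hk, hν, -, hpν, -⟩ := hpr.locallyTrivial k
  have hνk := hν.contMDiffAt (hU.mem_nhds hk)
  have h := ContMDiffAt.mfderiv_along (hpr.contMDiff (ν k))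
    ((hΩ.smooth_hamiltonianVectorField hF.1 (ν k)).comp k hνk)
  refine h.congr_of_eventuallyEq ?_
  filter_upwards [hU.mem_nhds hk] with y hy
  rw [hX (ν y), hpν y hy]

end Homogeneous

/-! ### The Kirillov bracket of a homogeneous symplectic form. -/

section Kirillov

variable {ES EK S K J : Type*} [NormedAddCommGroup ES] [NormedSpace ℝ ES] [FiniteDimensional ℝ ES]
  [NormedAddCommGroup EK] [NormedSpace ℝ EK]
  [TopologicalSpace S] [ChartedSpace ES S] [IsManifold 𝓘(ℝ, ES) ∞ S]
  [TopologicalSpace K] [ChartedSpace EK K] [IsManifold 𝓘(ℝ, EK) ∞ K]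
  {act : J → S → S} {χ : J → ℝ} {pr : S → K}
  {Ω : ∀ x : S, TangentSpace 𝓘(ℝ, ES) x →L[ℝ] TangentSpace 𝓘(ℝ, ES) x →L[ℝ] ℝ}

/-- The Poisson bracket, up to sign, as a bilinear map on homogeneous functions. -/
def homogeneousBracket (hΩ : IsSymplectic Ω) (hact : IsHomogeneousForm act χ Ω)
    (hpr : IsScaledFibration (ES := ES) (EK := EK) act χ pr) :
    homogeneousFunctions (ES := ES) act χ →ₗ[ℝ] homogeneousFunctions (ES := ES) act χ →ₗ[ℝ]
      homogeneousFunctions (ES := ES) act χ :=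
  LinearMap.mk₂ ℝ
    -- Exchanging the arguments supplies the minus sign and makes the bracket a derivation along X_G
    -- in its first slot.
    (fun F G => ⟨poissonBracket Ω G.1 F.1, poissonBracket_mem hΩ hact hpr G.2 F.2⟩)
    (fun F₁ F₂ G => Subtype.ext <| funext fun x =>
      poissonBracket_add_right (F₁.2.1.mdifferentiable (by simp) x)
        (F₂.2.1.mdifferentiable (by simp) x))
    (fun c F G => Subtype.ext <| funext fun x =>
      poissonBracket_smul_right c (F.2.1.mdifferentiable (by simp) x))
    (fun F G₁ G₂ => Subtype.ext <| funext fun x => by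
      change poissonBracket Ω (G₁.1 + G₂.1) F.1 x =
        poissonBracket Ω G₁.1 F.1 x + poissonBracket Ω G₂.1 F.1 x
      rw [poissonBracket_swap hΩ, poissonBracket_add_right (G₁.2.1.mdifferentiable (by simp) x)
        (G₂.2.1.mdifferentiable (by simp) x), poissonBracket_swap hΩ G₁.1,
        poissonBracket_swap hΩ G₂.1, neg_add])
    (fun c F G => Subtype.ext <| funext fun x => by
      change poissonBracket Ω (c • G.1) F.1 x = c * poissonBracket Ω G.1 F.1 x
      rw [poissonBracket_swap hΩ, poissonBracket_smul_right c (G.2.1.mdifferentiable (by simp) x),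
        poissonBracket_swap hΩ G.1, mul_neg])

variable {L : K → Type*} [∀ k, AddCommGroup (L k)] [∀ k, Module ℝ (L k)]
  [∀ k, TopologicalSpace (L k)] [TopologicalSpace (TotalSpace ℝ L)] [FiberBundle ℝ L]
  [VectorBundle ℝ ℝ L] {A : ∀ x : S, ℝ ≃L[ℝ] L (pr x)}

/-- Sections of the dual of a line bundle with a homogeneous frame are homogeneous functions. -/
def dualSectionEquiv [ContMDiffVectorBundle ∞ ℝ L 𝓘(ℝ, EK)]
    (hpr : IsScaledFibration (ES := ES) (EK := EK) act χ pr) (hA : IsHomogeneousFrame act χ pr A)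
    (hAsm : ContMDiff 𝓘(ℝ, ES) (𝓘(ℝ, EK).prod 𝓘(ℝ, ℝ)) ∞
      (fun x => (TotalSpace.mk' ℝ (pr x) (A x 1) : TotalSpace ℝ L))) :
    DualSection EK L ≃ₗ[ℝ] homogeneousFunctions (ES := ES) act χ :=
  LinearEquiv.ofBijective
    { toFun := fun h => ⟨fun x => (h (pr x) (A x 1) : ℝ), contMDiff_dual_frame hAsm h,
        dual_frame_act hA h⟩
      map_add' := fun _ _ => rfl
      map_smul' := fun _ _ => rfl }
    ⟨fun _ _ h => dual_section_ext hpr.surjective fun x => congrFun (congrArg Subtype.val h) x,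
      fun F => by
        obtain ⟨h, hh⟩ := hpr.exists_dual_section hA hAsm F.2.1 F.2.2
        exact ⟨h, Subtype.ext (funext hh)⟩⟩

theorem clm_ext_of_frame {V : Type*} [AddCommGroup V] [Module ℝ V] [TopologicalSpace V]
    (e : ℝ ≃L[ℝ] V) {φ ψ : V →L[ℝ] ℝ} (h : φ (e 1) = ψ (e 1)) : φ = ψ := by
  ext v
  obtain ⟨t, rfl⟩ := e.surjective v
  have ht : e t = t • e 1 := by rw [← map_smul, smul_eq_mul, mul_one]
  rw [ht, map_smul, map_smul, h]

/-- The Kirillov structure induced by a homogeneous symplectic form. -/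
theorem exists_kirillovStructure [ContMDiffVectorBundle ∞ ℝ L 𝓘(ℝ, EK)]
    (hΩ : IsSymplectic Ω) (hact : IsHomogeneousForm act χ Ω)
    (hpr : IsScaledFibration (ES := ES) (EK := EK) act χ pr) (hA : IsHomogeneousFrame act χ pr A)
    (hAsm : ContMDiff 𝓘(ℝ, ES) (𝓘(ℝ, EK).prod 𝓘(ℝ, ℝ)) ∞
      (fun x => (TotalSpace.mk' ℝ (pr x) (A x 1) : TotalSpace ℝ L))) :
    ∃ KS : KirillovStructure EK L,
      (∀ (h₁ h₂ : DualSection EK L) (x : S),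
        poissonBracket Ω (fun y => (h₁ (pr y) (A y 1) : ℝ)) (fun y => h₂ (pr y) (A y 1)) x =
          -(KS.bracket h₁ h₂ (pr x) (A x 1) : ℝ)) ∧
      ∀ (h : DualSection EK L) (x : S), mfderiv 𝓘(ℝ, ES) 𝓘(ℝ, EK) pr x
        (hamiltonianVectorField Ω (fun y => (h (pr y) (A y 1) : ℝ)) x) = KS.symbol h (pr x) := by
  let Ξ := dualSectionEquiv hpr hA hAsm
  have hΞ : ∀ h x, (Ξ h).1 x = (h (pr x) (A x 1) : ℝ) := fun h x => rfl
  let br : DualSection EK L →ₗ[ℝ] DualSection EK L →ₗ[ℝ] DualSection EK L :=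
    ((homogeneousBracket hΩ hact hpr).compl₁₂ Ξ.toLinearMap Ξ.toLinearMap).compr₂
      Ξ.symm.toLinearMap
  have hbr : ∀ h₁ h₂, Ξ (br h₁ h₂) = homogeneousBracket hΩ hact hpr (Ξ h₁) (Ξ h₂) :=
    fun h₁ h₂ => Ξ.apply_symm_apply _
  have hbr' : ∀ h₁ h₂, (Ξ (br h₁ h₂)).1 = poissonBracket Ω (Ξ h₂).1 (Ξ h₁).1 :=
    fun h₁ h₂ => congrArg Subtype.val (hbr h₁ h₂)
  choose sym hsym hsym' using fun h : DualSection EK L =>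
    exists_projected_hamiltonianVectorField hΩ hact hpr (Ξ h).2
  have hext : ∀ {h h' : DualSection EK L}, (∀ x, (Ξ h).1 x = (Ξ h').1 x) → h = h' :=
    fun H => Ξ.injective (Subtype.ext (funext H))
  let KS : KirillovStructure EK L :=
    { bracket := br
      bracket_self := fun h => hext fun x => by
        rw [hbr', poissonBracket_eq hΩ, hΩ.alternating, map_zero]
        rfl
      jacobi := fun h₁ h₂ h₃ => hext fun x => by
        rw [map_add, map_add, map_zero]
        change (Ξ (br h₁ (br h₂ h₃))).1 x + (Ξ (br h₂ (br h₃ h₁))).1 x +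
          (Ξ (br h₃ (br h₁ h₂))).1 x = 0
        rw [hbr', hbr', hbr', hbr', hbr', hbr', poissonBracket_swap hΩ _ (Ξ h₁).1,
          poissonBracket_swap hΩ _ (Ξ h₂).1, poissonBracket_swap hΩ _ (Ξ h₃).1]
        have hJ := poissonBracket_jacobi hΩ (Ξ h₁).2.1 (Ξ h₃).2.1 (Ξ h₂).2.1 x
        linarith
      symbol := sym
      smooth_symbol := hsym
      leibniz := fun f hf h₁ h₂ k => by
        obtain ⟨x, rfl⟩ := hpr.surjective k
        refine clm_ext_of_frame (A x) ?_
        -- A function on the base acts through its pullback, and X_F differentiates a pullback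
        -- through the projected field.
        have hfun : (Ξ (h₁.smulFun f hf)).1 = (f ∘ pr) * (Ξ h₁).1 := rfl
        have hfp : MDifferentiableAt 𝓘(ℝ, ES) 𝓘(ℝ, ℝ) (f ∘ pr) x :=
          (hf.comp hpr.contMDiff).mdifferentiable (by simp) x
        change (Ξ (br (h₁.smulFun f hf) h₂)).1 x = f (pr x) * (Ξ (br h₁ h₂)).1 x +
          mvfderiv 𝓘(ℝ, EK) f (pr x) (sym h₂ (pr x)) * (Ξ h₁).1 x
        rw [hbr', hbr', hfun, poissonBracket_mul_right hfp ((Ξ h₁).2.1.mdifferentiable (by simp) x),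
          mvfderiv_comp_apply x (hf.mdifferentiable (by simp) _)
            (hpr.contMDiff.mdifferentiable (by simp) x), hsym']
        rfl }
  refine ⟨KS, fun h₁ h₂ x => ?_, fun h x => hsym' h x⟩
  change poissonBracket Ω (Ξ h₁).1 (Ξ h₂).1 x = -(Ξ (br h₁ h₂)).1 x
  rw [hbr', poissonBracket_swap hΩ]

end Kirillov

/-! ### The infinitesimal generator of the scalings. -/

section ScalingFlow

variable {κ : ScalingKind}

theorem ScalingGroup.exp_zero : ScalingGroup.exp κ 0 = 1 := Subtype.ext Real.exp_zero

theorem ScalingGroup.contMDiff_val :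
    ContMDiff 𝓘(ℝ, ℝ) 𝓘(ℝ, ℝ) ∞ (fun s : ScalingGroup κ => (s : ℝ)) :=
  contMDiff_subtype_val

theorem ScalingGroup.contMDiff_exp : ContMDiff 𝓘(ℝ, ℝ) 𝓘(ℝ, ℝ) ∞ (ScalingGroup.exp κ) :=
  (ContMDiff.subtypeVal_comp_iff (I := 𝓘(ℝ, ℝ)) (I' := 𝓘(ℝ, ℝ)) (scalingSet κ)
    (ScalingGroup.exp κ)).1 Real.contDiff_exp.contMDiff

variable {E S : Type*} [NormedAddCommGroup E] [NormedSpace ℝ E]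
  [TopologicalSpace S] [ChartedSpace E S] [IsManifold 𝓘(ℝ, E) ∞ S] [MulAction (ScalingGroup κ) S]

/-- All tangent spaces are the model space by definition, so the transport in `scalingGenerator`
does nothing. -/
theorem scalingGenerator_eq (x : S) : (scalingGenerator κ x : TangentSpace 𝓘(ℝ, E) x) =
    (mfderiv 𝓘(ℝ, ℝ) 𝓘(ℝ, E) (fun t : ℝ => ScalingGroup.exp κ t • x) 0 (1 : ℝ) : E) := by
  have key : ∀ {y z : S} (h : y = z) (v : TangentSpace 𝓘(ℝ, E) y),
      (h ▸ v : TangentSpace 𝓘(ℝ, E) z) = (v : E) := by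
    intro y z h v
    subst h
    rfl
  exact key _ _

variable [ContMDiffSMul 𝓘(ℝ, ℝ) 𝓘(ℝ, E) ∞ (ScalingGroup κ) S]

theorem contMDiff_exp_smul : ContMDiff (𝓘(ℝ, ℝ).prod 𝓘(ℝ, E)) 𝓘(ℝ, E) ∞
    (fun p : ℝ × S => ScalingGroup.exp κ p.1 • p.2) :=
  (ContMDiffSMul.contMDiff_smul (I := 𝓘(ℝ, ℝ)) (I' := 𝓘(ℝ, E)) (n := ∞) (G := ScalingGroup κ)
    (M := S)).comp ((ScalingGroup.contMDiff_exp.comp contMDiff_fst).prodMk contMDiff_snd)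

theorem contMDiff_smul_const_left (s : ScalingGroup κ) :
    ContMDiff 𝓘(ℝ, E) 𝓘(ℝ, E) ∞ (fun x : S => s • x) :=
  (ContMDiffSMul.contMDiff_smul (I := 𝓘(ℝ, ℝ)) (I' := 𝓘(ℝ, E)) (n := ∞) (G := ScalingGroup κ)
    (M := S)).comp (contMDiff_const.prodMk contMDiff_id)

theorem contMDiff_exp_orbit (x : S) :
    ContMDiff 𝓘(ℝ, ℝ) 𝓘(ℝ, E) ∞ (fun t : ℝ => ScalingGroup.exp κ t • x) :=
  (contMDiff_exp_smul (κ := κ) (E := E)).comp (contMDiff_id.prodMk contMDiff_const)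

theorem exp_zero_smul (x : S) : ScalingGroup.exp κ 0 • x = x := by
  rw [ScalingGroup.exp_zero, one_smul]

/-- The t-derivative at 0 of a map smooth in (x, t) depends smoothly on x; its base point exp 0 • x
is then rewritten as x. -/
theorem smooth_scalingGenerator :
    SmoothVectorField (fun x : S => (scalingGenerator κ x : TangentSpace 𝓘(ℝ, E) x)) := by
  intro x₀
  have hf : ContMDiffAt (𝓘(ℝ, E).prod 𝓘(ℝ, ℝ)) 𝓘(ℝ, E) ∞
      (Function.uncurry fun (x : S) (t : ℝ) => ScalingGroup.exp κ t • x) (x₀, (0 : ℝ)) :=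
    ((contMDiff_exp_smul (κ := κ) (E := E)).comp
      (contMDiff_snd.prodMk contMDiff_fst)) (x₀, (0 : ℝ))
  have h := ContMDiffAt.mfderiv (n := ∞) (m := ∞) (I := 𝓘(ℝ, ℝ)) (I' := 𝓘(ℝ, E)) (J := 𝓘(ℝ, E))
    (fun (x : S) (t : ℝ) => ScalingGroup.exp κ t • x) (fun _ : S => (0 : ℝ)) hf
    contMDiffAt_const le_rfl
  have hv : ContMDiffAt 𝓘(ℝ, E) (𝓘(ℝ, ℝ).prod 𝓘(ℝ, ℝ)) ∞
      (fun _ : S => (TotalSpace.mk' ℝ (0 : ℝ) (1 : ℝ) : TangentBundle 𝓘(ℝ, ℝ) ℝ)) x₀ :=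
    contMDiffAt_const
  have hb : ContMDiffAt 𝓘(ℝ, E) 𝓘(ℝ, E) ∞ (fun x : S => ScalingGroup.exp κ 0 • x) x₀ :=
    contMDiff_smul_const_left _ x₀
  have h' := ContMDiffAt.clm_apply_of_inCoordinates (b₂ := fun x : S => ScalingGroup.exp κ 0 • x)
    (E₂ := fun y => TangentSpace 𝓘(ℝ, E) y) h hv hb
  refine h'.congr_of_eventuallyEq (.of_forall fun x => ?_)
  have key : ∀ {y z : S}, y = z → ∀ v : E,
      (TotalSpace.mk' E z (v : TangentSpace 𝓘(ℝ, E) z) : TangentBundle 𝓘(ℝ, E) S) =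
        TotalSpace.mk' E y (v : TangentSpace 𝓘(ℝ, E) y) := by
    intro y z h v
    subst h
    rfl
  dsimp only
  rw [scalingGenerator_eq]
  exact key (exp_zero_smul x) _

variable {E' N : Type*} [NormedAddCommGroup E'] [NormedSpace ℝ E'] [TopologicalSpace N]
  [ChartedSpace E' N]

/-- The derivative of a map along the scaling generator. -/
theorem mfderiv_scalingGenerator {f : S → N} {x : S}
    (hf : MDifferentiableAt 𝓘(ℝ, E) 𝓘(ℝ, E') f x) :
    (mfderiv 𝓘(ℝ, E) 𝓘(ℝ, E') f x (scalingGenerator κ x) : E') =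
      (mfderiv 𝓘(ℝ, ℝ) 𝓘(ℝ, E') (fun t : ℝ => f (ScalingGroup.exp κ t • x)) 0 (1 : ℝ) : E') := by
  rw [scalingGenerator_eq]
  exact (mfderiv_comp_apply_of_eq (0 : ℝ) hf
    ((contMDiff_exp_orbit (κ := κ) x).mdifferentiable (by simp) 0) (exp_zero_smul x) (1 : ℝ)).symm

/-- Euler's identity in degree one. -/
theorem mvfderiv_scalingGenerator {F : S → ℝ} {x : S} (hF : MDifferentiableAt 𝓘(ℝ, E) 𝓘(ℝ, ℝ) F x)
    (h : ∀ t, F (ScalingGroup.exp κ t • x) = Real.exp t * F x) :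
    mvfderiv 𝓘(ℝ, E) F x (scalingGenerator κ x) = F x := by
  refine (mfderiv_scalingGenerator hF).trans ?_
  rw [funext h, mfderiv_eq_fderiv]
  have hd : HasDerivAt (fun t => Real.exp t * F x) (Real.exp 0 * F x) 0 :=
    (Real.hasDerivAt_exp 0).mul_const _
  have := hd.hasFDerivAt.fderiv
  rw [this, Real.exp_zero, one_mul]
  exact one_smul ℝ (F x)

theorem mfderiv_scalingGenerator_of_commute {ψ : S → S} {x : S}
    (hψ : MDifferentiableAt 𝓘(ℝ, E) 𝓘(ℝ, E) ψ x)
    (h : ∀ t, ψ (ScalingGroup.exp κ t • x) = ScalingGroup.exp κ t • ψ x) :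
    mfderiv 𝓘(ℝ, E) 𝓘(ℝ, E) ψ x (scalingGenerator κ x) = scalingGenerator κ (ψ x) := by
  refine (mfderiv_scalingGenerator hψ).trans ?_
  rw [funext h, scalingGenerator_eq]
  rfl

end ScalingFlow

/-! ### Principal bundles as scaled fibrations. -/

section PrincipalBundles

variable {EG EM EK G M K : Type*}
  [NormedAddCommGroup EG] [NormedSpace ℝ EG] [NormedAddCommGroup EM] [NormedSpace ℝ EM]
  [NormedAddCommGroup EK] [NormedSpace ℝ EK]
  [TopologicalSpace G] [ChartedSpace EG G] [Group G]
  [TopologicalSpace M] [ChartedSpace EM M] [TopologicalSpace K] [ChartedSpace EK K]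
  [MulAction G M] {pr : M → K}

theorem IsPrincipalBundle.contMDiff_smul
    (h : IsPrincipalBundle (EG := EG) (EM := EM) (EK := EK) G pr) (g : G) :
    ContMDiff 𝓘(ℝ, EM) 𝓘(ℝ, EM) ∞ (fun x : M => g • x) :=
  h.contMDiffSMul.contMDiff_smul.comp (contMDiff_const.prodMk contMDiff_id)

theorem IsPrincipalBundle.apply_smul
    (h : IsPrincipalBundle (EG := EG) (EM := EM) (EK := EK) G pr) (g : G) (x : M) :
    pr (g • x) = pr x := ((h.eq_iff x (g • x)).2 ⟨g, rfl⟩).symm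

theorem IsPrincipalBundle.smul_cancel
    (h : IsPrincipalBundle (EG := EG) (EM := EM) (EK := EK) G pr) {g g' : G} {x : M}
    (hx : g • x = g' • x) : g = g' := by
  have := h.free (g'⁻¹ * g) x (by rw [mul_smul, hx, inv_smul_smul])
  exact (inv_mul_eq_one.1 this).symm

/-- A principal bundle for the scaling group, as a scaled fibration. -/
theorem IsPrincipalBundle.isScaledFibration {κ : ScalingKind} [MulAction (ScalingGroup κ) M]
    (h : IsPrincipalBundle (EG := ℝ) (EM := EM) (EK := EK) (ScalingGroup κ) pr) :
    IsScaledFibration (ES := EM) (EK := EK) (fun (s : ScalingGroup κ) (x : M) => s • x)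
      (fun s : ScalingGroup κ => (s : ℝ)) pr where
  contMDiff_act := h.contMDiff_smul
  contMDiff := h.contMDiff
  surjective := h.surjective
  eq_iff := h.eq_iff
  ne_zero := ScalingGroup.ne_zero
  locallyTrivial := fun k => by
    obtain ⟨U, σ, τ, hU, hk, hσ, hτ, hpσ, hτσ⟩ := h.locallyTrivial k
    exact ⟨U, σ, fun x => (τ x : ℝ), hU, hk, hσ,
      ScalingGroup.contMDiff_val.comp_contMDiffOn hτ, hpσ, fun x hx => ⟨τ x, hτσ x hx, rfl⟩⟩

/-- The composition of a principal bundle for the scaling group and a principal bundle for a group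
which commutes with the scalings, as a scaled fibration. -/
theorem IsPrincipalBundle.isScaledFibration_comp {κ : ScalingKind} [MulAction (ScalingGroup κ) M]
    {EB B : Type*} [NormedAddCommGroup EB] [NormedSpace ℝ EB] [TopologicalSpace B]
    [ChartedSpace EB B] [LieGroup 𝓘(ℝ, EG) ∞ G] [MulAction G K] {q : K → B}
    (h : IsPrincipalBundle (EG := ℝ) (EM := EM) (EK := EK) (ScalingGroup κ) pr)
    (hq : IsPrincipalBundle (EG := EG) (EM := EK) (EK := EB) G q)
    [ContMDiffSMul 𝓘(ℝ, EG) 𝓘(ℝ, EM) ∞ G M]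
    (hcomm : ∀ (g : G) (s : ScalingGroup κ) (x : M), g • s • x = s • g • x)
    (hequiv : ∀ (g : G) (x : M), pr (g • x) = g • pr x) :
    IsScaledFibration (ES := EM) (EK := EB) (fun (j : ScalingGroup κ × G) (x : M) => j.1 • j.2 • x)
      (fun j : ScalingGroup κ × G => (j.1 : ℝ)) (fun x => q (pr x)) where
  contMDiff_act := fun j => (h.contMDiff_smul j.1).comp
    ((ContMDiffSMul.contMDiff_smul (I := 𝓘(ℝ, EG)) (I' := 𝓘(ℝ, EM)) (n := ∞) (G := G)
      (M := M)).comp (contMDiff_const.prodMk contMDiff_id))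
  contMDiff := hq.contMDiff.comp h.contMDiff
  surjective := hq.surjective.comp h.surjective
  eq_iff := fun x y => by
    rw [hq.eq_iff]
    constructor
    · rintro ⟨g, hg⟩
      rw [← hequiv, h.eq_iff] at hg
      obtain ⟨s, hs⟩ := hg
      exact ⟨(s, g), hs⟩
    · rintro ⟨⟨s, g⟩, hj⟩
      exact ⟨g, by rw [← hequiv, h.eq_iff]; exact ⟨s, hj⟩⟩
  ne_zero := fun j => j.1.ne_zero
  locallyTrivial := fun b => by
    obtain ⟨UB, σB, τB, hUB, hb, hσB, hτB, hqσ, hτσB⟩ := hq.locallyTrivial b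
    obtain ⟨UC, σ, τ, hUC, hc, hσ, hτ, hpσ, hτσ⟩ := h.locallyTrivial (σB b)
    -- Undoing the G-coordinate τB (pr x) moves x to the fibre over the section σB, where the
    -- scaling trivialization applies; the factor r is the scaling coordinate of the moved point.
    have hmem : ∀ x, q (pr x) ∈ UB ∩ σB ⁻¹' UC →
        (τB (pr x))⁻¹ • x ∈ pr ⁻¹' UC ∧ pr ((τB (pr x))⁻¹ • x) = σB (q (pr x)) := by
      intro x hx
      have h1 : pr ((τB (pr x))⁻¹ • x) = σB (q (pr x)) := by
        rw [hequiv, inv_smul_eq_iff]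
        exact (hτσB (pr x) hx.1).symm
      refine ⟨?_, h1⟩
      rw [Set.mem_preimage, h1]
      exact hx.2
    refine ⟨UB ∩ σB ⁻¹' UC, fun y => σ (σB y), fun x => (τ ((τB (pr x))⁻¹ • x) : ℝ),
      hσB.continuousOn.isOpen_inter_preimage hUB hUC, ⟨hb, hc⟩,
      hσ.comp (hσB.mono Set.inter_subset_left) fun y hy => hy.2,
      ScalingGroup.contMDiff_val.comp_contMDiffOn (hτ.comp ?_ fun x hx => (hmem x hx).1),
      fun y hy => by rw [hpσ _ hy.2, hqσ _ hy.1], fun x hx => ?_⟩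
    · have h1 : ContMDiffOn 𝓘(ℝ, EM) 𝓘(ℝ, EG) ∞ (fun x => (τB (pr x))⁻¹)
          ((fun x => q (pr x)) ⁻¹' (UB ∩ σB ⁻¹' UC)) :=
        (contMDiff_inv 𝓘(ℝ, EG) ∞).comp_contMDiffOn
          (hτB.comp h.contMDiff.contMDiffOn fun x hx => hx.1)
      exact (ContMDiffSMul.contMDiff_smul (I := 𝓘(ℝ, EG)) (I' := 𝓘(ℝ, EM)) (n := ∞) (G := G)
        (M := M)).comp_contMDiffOn (h1.prodMk contMDiffOn_id)
    · obtain ⟨h1, h2⟩ := hmem x hx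
      refine ⟨(τ ((τB (pr x))⁻¹ • x), τB (pr x)), ?_, rfl⟩
      have h3 := hτσ _ h1
      rw [h2] at h3
      dsimp only
      rw [← hcomm, h3, smul_inv_smul]

end PrincipalBundles

/-! ### The Liouville form. -/

section Liouville

variable {ES EC S C : Type*} [NormedAddCommGroup ES] [NormedSpace ℝ ES] [FiniteDimensional ℝ ES]
  [NormedAddCommGroup EC] [NormedSpace ℝ EC]
  [TopologicalSpace S] [ChartedSpace ES S] [IsManifold 𝓘(ℝ, ES) ∞ S]
  [TopologicalSpace C] [ChartedSpace EC C] [IsManifold 𝓘(ℝ, EC) ∞ C]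
  {κ : ScalingKind} [MulAction (ScalingGroup κ) S] {pS : S → C}
  {Ω : ∀ x : S, TangentSpace 𝓘(ℝ, ES) x →L[ℝ] TangentSpace 𝓘(ℝ, ES) x →L[ℝ] ℝ}

theorem liouvilleForm_apply (x : S) (v : TangentSpace 𝓘(ℝ, ES) x) :
    liouvilleForm κ Ω x v = -Ω x (scalingGenerator κ x) v := rfl

/-- By antisymmetry λ(X_F) = Ω(X_F, Δ) = dF(Δ), and Euler's identity applies. -/
theorem liouvilleForm_hamiltonianVectorField
    [ContMDiffSMul 𝓘(ℝ, ℝ) 𝓘(ℝ, ES) ∞ (ScalingGroup κ) S] (hΩ : IsSymplectic Ω) {F : S → ℝ} {x : S}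
    (hF : MDifferentiableAt 𝓘(ℝ, ES) 𝓘(ℝ, ℝ) F x)
    (h : ∀ (s : ScalingGroup κ) (y : S), F (s • y) = (s : ℝ) * F y) :
    liouvilleForm κ Ω x (hamiltonianVectorField Ω F x) = F x := by
  rw [liouvilleForm_apply, hΩ.swap, neg_neg, hΩ.apply_hamiltonianVectorField]
  exact mvfderiv_scalingGenerator hF fun t => h _ x

/-- A map commuting with scalings preserves Δ, so λ inherits the factor of Ω. Applied to scalings
with c = s and to elements of G with c = 1. -/
theorem liouvilleForm_map [ContMDiffSMul 𝓘(ℝ, ℝ) 𝓘(ℝ, ES) ∞ (ScalingGroup κ) S] {ψ : S → S} {x : S}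
    {c : ℝ} (hψ : MDifferentiableAt 𝓘(ℝ, ES) 𝓘(ℝ, ES) ψ x)
    (hcomm : ∀ s : ScalingGroup κ, ψ (s • x) = s • ψ x)
    (hform : ∀ v w : TangentSpace 𝓘(ℝ, ES) x, Ω (ψ x) (mfderiv 𝓘(ℝ, ES) 𝓘(ℝ, ES) ψ x v)
      (mfderiv 𝓘(ℝ, ES) 𝓘(ℝ, ES) ψ x w) = c * Ω x v w) (v : TangentSpace 𝓘(ℝ, ES) x) :
    liouvilleForm κ Ω (ψ x) (mfderiv 𝓘(ℝ, ES) 𝓘(ℝ, ES) ψ x v) = c * liouvilleForm κ Ω x v := by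
  rw [liouvilleForm_apply, liouvilleForm_apply,
    ← mfderiv_scalingGenerator_of_commute hψ fun t => hcomm _, hform, mul_neg]

theorem smooth_liouvilleForm [ContMDiffSMul 𝓘(ℝ, ℝ) 𝓘(ℝ, ES) ∞ (ScalingGroup κ) S]
    (hΩ : IsSymplectic Ω) : ContMDiff 𝓘(ℝ, ES) (𝓘(ℝ, ES).prod 𝓘(ℝ, ES →L[ℝ] ℝ)) ∞
    (fun x => (TotalSpace.mk' (ES →L[ℝ] ℝ) x (liouvilleForm κ Ω x) :
      TotalSpace (ES →L[ℝ] ℝ)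
        (fun x : S => TangentSpace 𝓘(ℝ, ES) x →L[ℝ] Bundle.Trivial S ℝ x))) := fun x => by
  refine contMDiffAt_dual_section fun v => ?_
  have h1 := ContMDiffAt.clm_bundle_apply (hΩ.contMDiff x) (smooth_scalingGenerator (κ := κ) x)
  exact (ContMDiffAt.dual_apply h1 (contMDiffAt_trivialization_symm x v)).neg

theorem mfderiv_pr_smul
    (hp : IsPrincipalBundle (EG := ℝ) (EM := ES) (EK := EC) (ScalingGroup κ) pS)
    (s : ScalingGroup κ) (x : S) (v : TangentSpace 𝓘(ℝ, ES) x) :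
    (mfderiv 𝓘(ℝ, ES) 𝓘(ℝ, EC) pS (s • x)
      (mfderiv 𝓘(ℝ, ES) 𝓘(ℝ, ES) (fun y : S => s • y) x v) : EC) =
      mfderiv 𝓘(ℝ, ES) 𝓘(ℝ, EC) pS x v := by
  have h1 := mfderiv_comp_apply x (hp.contMDiff.mdifferentiable (by simp) (s • x))
    ((hp.contMDiff_smul s).mdifferentiable (by simp) x) v
  have h2 : pS ∘ (fun y : S => s • y) = pS := funext fun z => hp.apply_smul s z
  exact h1.symm.trans (congrArg (fun f : S → C =>
    (mfderiv 𝓘(ℝ, ES) 𝓘(ℝ, EC) f x : ES →L[ℝ] EC) v) h2)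

end Liouville

/-! ### Local sections of the scaling bundle. -/

section LocalSections

variable {ES EC S C : Type*} [NormedAddCommGroup ES] [NormedSpace ℝ ES] [FiniteDimensional ℝ ES]
  [NormedAddCommGroup EC] [NormedSpace ℝ EC]
  [TopologicalSpace S] [ChartedSpace ES S] [IsManifold 𝓘(ℝ, ES) ∞ S]
  [TopologicalSpace C] [ChartedSpace EC C] [IsManifold 𝓘(ℝ, EC) ∞ C]
  {κ : ScalingKind} [MulAction (ScalingGroup κ) S] {pS : S → C}
  {Ω : ∀ x : S, TangentSpace 𝓘(ℝ, ES) x →L[ℝ] TangentSpace 𝓘(ℝ, ES) x →L[ℝ] ℝ}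

/-- A local section `σ` of `pr`, with the induced trivialization `τ`. -/
structure IsLocalSection (pr : S → C) (U : Set C) (σ : C → S) (τ : S → ScalingGroup κ) :
    Prop where
  isOpen : IsOpen U
  contMDiffOn : ContMDiffOn 𝓘(ℝ, EC) 𝓘(ℝ, ES) ∞ σ U
  contMDiffOn_fiber : ContMDiffOn 𝓘(ℝ, ES) 𝓘(ℝ, ℝ) ∞ τ (pr ⁻¹' U)
  apply_section : ∀ y ∈ U, pr (σ y) = y
  smul_section : ∀ x ∈ pr ⁻¹' U, τ x • σ (pr x) = x

theorem IsPrincipalBundle.exists_isLocalSection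
    (hp : IsPrincipalBundle (EG := ℝ) (EM := ES) (EK := EC) (ScalingGroup κ) pS) (c : C) :
    ∃ (U : Set C) (σ : C → S) (τ : S → ScalingGroup κ),
      IsLocalSection (ES := ES) (EC := EC) pS U σ τ ∧ c ∈ U := by
  obtain ⟨U, σ, τ, hU, hc, h₁, h₂, h₃, h₄⟩ := hp.locallyTrivial c
  exact ⟨U, σ, τ, ⟨hU, h₁, h₂, h₃, h₄⟩, hc⟩

variable {U : Set C} {σ : C → S} {τ : S → ScalingGroup κ}

theorem mfderiv_section_of_eventually (hpr : ContMDiff 𝓘(ℝ, ES) 𝓘(ℝ, EC) ∞ pS) {y : C}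
    (hσ : MDifferentiableAt 𝓘(ℝ, EC) 𝓘(ℝ, ES) σ y) (hpσ : ∀ᶠ z in 𝓝 y, pS (σ z) = z)
    (w : TangentSpace 𝓘(ℝ, EC) y) :
    (mfderiv 𝓘(ℝ, ES) 𝓘(ℝ, EC) pS (σ y) (mfderiv 𝓘(ℝ, EC) 𝓘(ℝ, ES) σ y w) : EC) = w := by
  have h1 := mfderiv_comp_apply y (hpr.mdifferentiable (by simp) (σ y)) hσ w
  refine h1.symm.trans ?_
  have h2 : pS ∘ σ =ᶠ[𝓝 y] id := hpσ
  have h3 : (mfderiv 𝓘(ℝ, EC) 𝓘(ℝ, EC) (pS ∘ σ) y : EC →L[ℝ] EC) =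
      ContinuousLinearMap.id ℝ EC := h2.mfderiv_eq.trans mfderiv_id
  exact congrArg (fun f : EC →L[ℝ] EC => f w) h3

namespace IsLocalSection

theorem fiber_smul (h : IsLocalSection (ES := ES) (EC := EC) pS U σ τ)
    (hp : IsPrincipalBundle (EG := ℝ) (EM := ES) (EK := EC) (ScalingGroup κ) pS)
    (s : ScalingGroup κ) {x : S} (hx : pS x ∈ U) : τ (s • x) = s * τ x := by
  have h1 := h.smul_section (s • x) (by rw [Set.mem_preimage, hp.apply_smul]; exact hx)
  rw [hp.apply_smul] at h1
  refine hp.smul_cancel (x := σ (pS x)) ?_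
  rw [h1, mul_smul, h.smul_section x hx]

theorem fiber_section (h : IsLocalSection (ES := ES) (EC := EC) pS U σ τ)
    (hp : IsPrincipalBundle (EG := ℝ) (EM := ES) (EK := EC) (ScalingGroup κ) pS)
    {y : C} (hy : y ∈ U) : τ (σ y) = 1 := by
  have h1 := h.smul_section (σ y) (by rw [Set.mem_preimage, h.apply_section y hy]; exact hy)
  rw [h.apply_section y hy] at h1
  exact hp.smul_cancel (x := σ y) (h1.trans (one_smul _ _).symm)

theorem preimage_mem_nhds (h : IsLocalSection (ES := ES) (EC := EC) pS U σ τ)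
    (hp : IsPrincipalBundle (EG := ℝ) (EM := ES) (EK := EC) (ScalingGroup κ) pS)
    {x : S} (hx : pS x ∈ U) : pS ⁻¹' U ∈ 𝓝 x :=
  (h.isOpen.preimage hp.contMDiff.continuous).mem_nhds hx

theorem contMDiffAt_fiber (h : IsLocalSection (ES := ES) (EC := EC) pS U σ τ)
    (hp : IsPrincipalBundle (EG := ℝ) (EM := ES) (EK := EC) (ScalingGroup κ) pS)
    {x : S} (hx : pS x ∈ U) :
    ContMDiffAt 𝓘(ℝ, ES) 𝓘(ℝ, ℝ) ∞ (fun y => (τ y : ℝ)) x :=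
  ContMDiffAt.comp x ScalingGroup.contMDiff_val.contMDiffAt
    (h.contMDiffOn_fiber.contMDiffAt (h.preimage_mem_nhds hp hx))

theorem contMDiffAt_section (h : IsLocalSection (ES := ES) (EC := EC) pS U σ τ)
    {y : C} (hy : y ∈ U) : ContMDiffAt 𝓘(ℝ, EC) 𝓘(ℝ, ES) ∞ σ y :=
  h.contMDiffOn.contMDiffAt (h.isOpen.mem_nhds hy)

theorem mfderiv_section (h : IsLocalSection (ES := ES) (EC := EC) pS U σ τ) {y : C} (hy : y ∈ U)
    (w : TangentSpace 𝓘(ℝ, EC) y) (hpr : ContMDiff 𝓘(ℝ, ES) 𝓘(ℝ, EC) ∞ pS) :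
    (mfderiv 𝓘(ℝ, ES) 𝓘(ℝ, EC) pS (σ y) (mfderiv 𝓘(ℝ, EC) 𝓘(ℝ, ES) σ y w) : EC) = w := by
  refine mfderiv_section_of_eventually hpr
    ((h.contMDiffAt_section hy).mdifferentiableAt (by simp)) ?_ w
  filter_upwards [h.isOpen.mem_nhds hy] with z hz
  exact h.apply_section z hz

theorem mvfderiv_fiber_scalingGenerator (h : IsLocalSection (ES := ES) (EC := EC) pS U σ τ)
    (hp : IsPrincipalBundle (EG := ℝ) (EM := ES) (EK := EC) (ScalingGroup κ) pS)
    {x : S} (hx : pS x ∈ U) :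
    mvfderiv 𝓘(ℝ, ES) (fun y => (τ y : ℝ)) x (scalingGenerator κ x) = (τ x : ℝ) := by
  have := hp.contMDiffSMul
  refine mvfderiv_scalingGenerator ((h.contMDiffAt_fiber hp hx).mdifferentiableAt (by simp))
    fun t => ?_
  rw [h.fiber_smul hp _ hx]
  rfl

/-- A tangent vector is the sum of a multiple of the generator and a translate of a vector tangent
to the section. -/
theorem exists_tangent_decomposition (h : IsLocalSection (ES := ES) (EC := EC) pS U σ τ)
    (hp : IsPrincipalBundle (EG := ℝ) (EM := ES) (EK := EC) (ScalingGroup κ) pS)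
    {x : S} (hx : pS x ∈ U) (v : TangentSpace 𝓘(ℝ, ES) x) :
    let P : ES →L[ℝ] EC := mfderiv 𝓘(ℝ, ES) 𝓘(ℝ, EC) pS x
    let Q : EC →L[ℝ] ES := mfderiv 𝓘(ℝ, EC) 𝓘(ℝ, ES) σ (pS x)
    let R : ES →L[ℝ] ES := mfderiv 𝓘(ℝ, ES) 𝓘(ℝ, ES) (fun z : S => τ x • z) (σ (pS x))
    let Δ : ES := scalingGenerator κ x
    let v' : ES := v
    ∃ t : ℝ, v' = t • Δ + R (Q (P v')) := by
  have := hp.contMDiffSMul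
  -- Near x, each y equals exp(u y) • w y with u x = 0 and w x = x; differentiating this identity at
  -- x gives the decomposition. Dividing by τ x keeps the logarithm meaningful when τ is negative.
  let u : S → ℝ := fun y => Real.log ((τ y : ℝ) / τ x)
  let w : S → S := fun y => τ x • σ (pS y)
  have hτx : (τ x : ℝ) / τ x = 1 := div_self (τ x).ne_zero
  have hu : ContMDiffAt 𝓘(ℝ, ES) 𝓘(ℝ, ℝ) ∞ u x := by
    have h1 : ContMDiffAt 𝓘(ℝ, ES) 𝓘(ℝ, ℝ) ∞ (fun y => (τ y : ℝ) / τ x) x :=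
      (h.contMDiffAt_fiber hp hx).div_const _
    have h2 : ContDiffAt ℝ ∞ Real.log ((τ x : ℝ) / τ x) :=
      Real.contDiffAt_log.2 (by rw [hτx]; exact one_ne_zero)
    exact h2.contMDiffAt.comp x h1
  have hpx := hp.contMDiff.mdifferentiable (n := ∞) (by simp) x
  have hσx := (h.contMDiffAt_section hx).mdifferentiableAt (n := ∞) (by simp)
  have hsx := (hp.contMDiff_smul (τ x)).mdifferentiable (by simp) (σ (pS x))
  have hw : MDifferentiableAt 𝓘(ℝ, ES) 𝓘(ℝ, ES) w x := hsx.comp x (hσx.comp x hpx)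
  have hu0 : u x = 0 := by simp only [u]; rw [hτx, Real.log_one]
  have hwx : w x = x := h.smul_section x hx
  let m : ℝ × S → S := fun q => ScalingGroup.exp κ q.1 • q.2
  have hm : MDifferentiableAt (𝓘(ℝ, ℝ).prod 𝓘(ℝ, ES)) 𝓘(ℝ, ES) m ((0 : ℝ), x) :=
    (contMDiff_exp_smul (κ := κ) (E := ES)).mdifferentiable (by simp) _
  have hid : (fun y => m (u y, w y)) =ᶠ[𝓝 x] id := by
    have hpos : ∀ᶠ y in 𝓝 x, 0 < (τ y : ℝ) / τ x := by
      have hc : ContinuousAt (fun y => (τ y : ℝ) / τ x) x :=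
        (h.contMDiffAt_fiber hp hx).continuousAt.div_const _
      exact hc (lt_mem_nhds (by dsimp only; rw [hτx]; exact one_pos))
    filter_upwards [hpos, h.preimage_mem_nhds hp hx] with y hy hyU
    have h1 : ScalingGroup.exp κ (u y) * τ x = τ y := by
      refine Subtype.ext ?_
      change Real.exp (Real.log ((τ y : ℝ) / τ x)) * (τ x : ℝ) = τ y
      rw [Real.exp_log hy, div_mul_cancel₀ _ (τ x).ne_zero]
    change ScalingGroup.exp κ (u y) • τ x • σ (pS y) = y
    rw [← mul_smul, h1, h.smul_section y hyU]
  let U' : ES →L[ℝ] ℝ := mfderiv 𝓘(ℝ, ES) 𝓘(ℝ, ℝ) u x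
  let W' : ES →L[ℝ] ES := mfderiv 𝓘(ℝ, ES) 𝓘(ℝ, ES) w x
  have e1 := mfderiv_comp_apply_of_eq x hm ((hu.mdifferentiableAt (by simp)).prodMk hw)
    (show (u x, w x) = ((0 : ℝ), x) by rw [hu0, hwx]) v
  have e2 : (mfderiv 𝓘(ℝ, ES) 𝓘(ℝ, ES) (fun y => m (u y, w y)) x : ES →L[ℝ] ES) =
      ContinuousLinearMap.id ℝ ES := hid.mfderiv_eq.trans mfderiv_id
  have e3 : (v : ES) = (mfderiv (𝓘(ℝ, ℝ).prod 𝓘(ℝ, ES)) 𝓘(ℝ, ES) m ((0 : ℝ), x) :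
      ℝ × ES →L[ℝ] ES) (U' v, W' v) := by
    refine Eq.trans (congrArg (fun f : ES →L[ℝ] ES => f v) e2).symm (e1.trans ?_)
    rw [(hu.mdifferentiableAt (by simp)).mfderiv_prod hw]
    rfl
  have e4 := mfderiv_prod_eq_add_apply (v := (U' v, W' v)) hm
  have e5 : (mfderiv 𝓘(ℝ, ES) 𝓘(ℝ, ES) (fun z : S => m ((0 : ℝ), z)) x : ES →L[ℝ] ES) =
      ContinuousLinearMap.id ℝ ES := by
    have : (fun z : S => m ((0 : ℝ), z)) = id := funext fun z => exp_zero_smul z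
    rw [this]
    exact mfderiv_id
  have e6 : W' v = (mfderiv 𝓘(ℝ, ES) 𝓘(ℝ, ES) (fun z : S => τ x • z) (σ (pS x))
        (mfderiv 𝓘(ℝ, EC) 𝓘(ℝ, ES) σ (pS x) (mfderiv 𝓘(ℝ, ES) 𝓘(ℝ, EC) pS x v)) : ES) := by
    have a1 := mfderiv_comp_apply x hsx (hσx.comp x hpx) v
    have a2 := mfderiv_comp_apply x hσx hpx v
    refine a1.trans ?_
    exact congrArg (fun b : ES => (mfderiv 𝓘(ℝ, ES) 𝓘(ℝ, ES) (fun z : S => τ x • z) (σ (pS x)) :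
      ES →L[ℝ] ES) b) a2
  refine ⟨U' v, (e3.trans e4).trans ?_⟩
  refine congrArg₂ (fun a b : ES => a + b) ?_
    ((congrArg (fun f : ES →L[ℝ] ES => f (W' v)) e5).trans e6)
  let Z : ℝ →L[ℝ] ES := mfderiv 𝓘(ℝ, ℝ) 𝓘(ℝ, ES) (fun t : ℝ => ScalingGroup.exp κ t • x) 0
  have e7 : (scalingGenerator κ x : TangentSpace 𝓘(ℝ, ES) x) = Z 1 := scalingGenerator_eq x
  change Z (U' v) = (U' v) • (scalingGenerator κ x : ES)
  rw [e7]
  exact (congrArg Z (mul_one (U' v)).symm).trans (Z.map_smul (U' v) 1)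

end IsLocalSection

end LocalSections

theorem exists_frame_of_span {V : Type*} [NormedAddCommGroup V] [NormedSpace ℝ V] {a : V}
    (ha : a ≠ 0) (hspan : ∀ b : V, ∃ t : ℝ, t • a = b) : ∃ e : ℝ ≃L[ℝ] V, ∀ t, e t = t • a :=
  ⟨(LinearEquiv.ofBijective (LinearMap.toSpanSingleton ℝ V a)
    ⟨smul_left_injective ℝ ha, hspan⟩).toContinuousLinearEquiv, fun _ => rfl⟩

/-! ### Descent of the Liouville form to covectors on the base. -/

section ProjectedCovectors

variable {ES EC S C : Type*} [NormedAddCommGroup ES] [NormedSpace ℝ ES] [FiniteDimensional ℝ ES]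
  [NormedAddCommGroup EC] [NormedSpace ℝ EC]
  [TopologicalSpace S] [ChartedSpace ES S] [IsManifold 𝓘(ℝ, ES) ∞ S]
  [TopologicalSpace C] [ChartedSpace EC C] [IsManifold 𝓘(ℝ, EC) ∞ C]
  {κ : ScalingKind} [MulAction (ScalingGroup κ) S] {pS : S → C}
  {Ω : ∀ x : S, TangentSpace 𝓘(ℝ, ES) x →L[ℝ] TangentSpace 𝓘(ℝ, ES) x →L[ℝ] ℝ}
  {U : Set C} {σ : C → S} {τ : S → ScalingGroup κ}

theorem liouvilleForm_smul
    (hp : IsPrincipalBundle (EG := ℝ) (EM := ES) (EK := EC) (ScalingGroup κ) pS)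
    (hform : IsHomogeneousForm (fun (s : ScalingGroup κ) (x : S) => s • x)
      (fun s : ScalingGroup κ => (s : ℝ)) Ω) (s : ScalingGroup κ) (x : S)
    (v : TangentSpace 𝓘(ℝ, ES) x) :
    liouvilleForm κ Ω (s • x) (mfderiv 𝓘(ℝ, ES) 𝓘(ℝ, ES) (fun y : S => s • y) x v) =
      s * liouvilleForm κ Ω x v := by
  have := hp.contMDiffSMul
  exact liouvilleForm_map ((hp.contMDiff_smul s).mdifferentiable (by simp) x)
    (fun t => smul_comm s t x) (hform s x) v

/-- The 1-form on the base obtained by pulling back the Liouville form along a section. -/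
def sectionForm (κ : ScalingKind) [MulAction (ScalingGroup κ) S]
    (Ω : ∀ x : S, TangentSpace 𝓘(ℝ, ES) x →L[ℝ] TangentSpace 𝓘(ℝ, ES) x →L[ℝ] ℝ) (σ : C → S)
    (y : C) : TangentSpace 𝓘(ℝ, EC) y →L[ℝ] ℝ :=
  (liouvilleForm κ Ω (σ y)).comp (mfderiv 𝓘(ℝ, EC) 𝓘(ℝ, ES) σ y)

/-- In the decomposition of v the multiple of Δ is killed by λ, and the translate by τ x contributes
the factor τ x. -/
theorem liouvilleForm_eq_sectionForm (hΩ : IsSymplectic Ω)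
    (h : IsLocalSection (ES := ES) (EC := EC) pS U σ τ)
    (hp : IsPrincipalBundle (EG := ℝ) (EM := ES) (EK := EC) (ScalingGroup κ) pS)
    (hform : IsHomogeneousForm (fun (s : ScalingGroup κ) (x : S) => s • x)
      (fun s : ScalingGroup κ => (s : ℝ)) Ω) {x : S} (hx : pS x ∈ U)
    (v : TangentSpace 𝓘(ℝ, ES) x) :
    liouvilleForm κ Ω x v =
      τ x * sectionForm κ Ω σ (pS x) (mfderiv 𝓘(ℝ, ES) 𝓘(ℝ, EC) pS x v) := by
  obtain ⟨t, ht⟩ := h.exists_tangent_decomposition hp hx v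
  let Λ : S → ES →L[ℝ] ℝ := fun y => liouvilleForm κ Ω y
  have h0 : Λ x (scalingGenerator κ x : TangentSpace 𝓘(ℝ, ES) x) = 0 := by
    change -Ω x _ _ = 0
    rw [hΩ.alternating, neg_zero]
  have hlin : ∀ (f : ES →L[ℝ] ℝ) (a b : ES), f a = 0 → f (t • a + b) = f b := by
    intro f a b hfa
    rw [map_add, map_smul, hfa, smul_zero, zero_add]
  refine (congrArg (Λ x) ht).trans ((hlin (Λ x) _ _ h0).trans ?_)
  have h2 := liouvilleForm_smul hp hform (τ x) (σ (pS x))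
    (mfderiv 𝓘(ℝ, EC) 𝓘(ℝ, ES) σ (pS x) (mfderiv 𝓘(ℝ, ES) 𝓘(ℝ, EC) pS x v))
  have h3 : Λ x = Λ (τ x • σ (pS x)) := congrArg Λ (h.smul_section x hx).symm
  rw [h3]
  exact h2

theorem contMDiffAt_sectionForm [FiniteDimensional ℝ EC]
    [ContMDiffSMul 𝓘(ℝ, ℝ) 𝓘(ℝ, ES) ∞ (ScalingGroup κ) S] (hΩ : IsSymplectic Ω) {y : C}
    (hσ : ContMDiffAt 𝓘(ℝ, EC) 𝓘(ℝ, ES) ∞ σ y) :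
    ContMDiffAt 𝓘(ℝ, EC) (𝓘(ℝ, EC).prod 𝓘(ℝ, EC →L[ℝ] ℝ)) ∞
      (fun x => (TotalSpace.mk' (EC →L[ℝ] ℝ) x (sectionForm κ Ω σ x) :
        TotalSpace (EC →L[ℝ] ℝ)
          (fun x : C => TangentSpace 𝓘(ℝ, EC) x →L[ℝ] Bundle.Trivial C ℝ x))) y := by
  refine contMDiffAt_dual_section fun v => ?_
  have hT := ContMDiffAt.mfderiv_along (b := fun y => y) hσ
    (contMDiffAt_trivialization_symm y v)
  have hpair := ContMDiffAt.dual_apply (b := σ) (smooth_liouvilleForm (κ := κ) hΩ (σ y)) hT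
  exact hpair

/-- A section splits the derivative at σ (pS x), and scaling carries the splitting to x. -/
theorem IsPrincipalBundle.surjective_mfderiv
    (hp : IsPrincipalBundle (EG := ℝ) (EM := ES) (EK := EC) (ScalingGroup κ) pS) (x : S) :
    Function.Surjective (mfderiv 𝓘(ℝ, ES) 𝓘(ℝ, EC) pS x) := by
  intro w
  obtain ⟨U, σ, τ, h, hx⟩ := hp.exists_isLocalSection (pS x)
  have h1 := h.mfderiv_section hx w hp.contMDiff
  have h2 := mfderiv_pr_smul hp (τ x) (σ (pS x)) (mfderiv 𝓘(ℝ, EC) 𝓘(ℝ, ES) σ (pS x) w)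
  let P : S → ES →L[ℝ] EC := fun y => mfderiv 𝓘(ℝ, ES) 𝓘(ℝ, EC) pS y
  have h3 : P x = P (τ x • σ (pS x)) := congrArg P (h.smul_section x hx).symm
  refine ⟨(mfderiv 𝓘(ℝ, ES) 𝓘(ℝ, ES) (fun z : S => τ x • z) (σ (pS x))
    (mfderiv 𝓘(ℝ, EC) 𝓘(ℝ, ES) σ (pS x) w) : ES), ?_⟩
  exact (congrArg (fun f : ES →L[ℝ] EC => f _) h3).trans (h2.trans h1)

theorem exists_projected_covector (hΩ : IsSymplectic Ω)
    (hp : IsPrincipalBundle (EG := ℝ) (EM := ES) (EK := EC) (ScalingGroup κ) pS)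
    (hform : IsHomogeneousForm (fun (s : ScalingGroup κ) (x : S) => s • x)
      (fun s : ScalingGroup κ => (s : ℝ)) Ω) (x : S) :
    ∃ α : TangentSpace 𝓘(ℝ, EC) (pS x) →L[ℝ] ℝ, ∀ v : TangentSpace 𝓘(ℝ, ES) x,
      α (mfderiv 𝓘(ℝ, ES) 𝓘(ℝ, EC) pS x v) = liouvilleForm κ Ω x v := by
  obtain ⟨U, σ, τ, h, hx⟩ := hp.exists_isLocalSection (pS x)
  refine ⟨(τ x : ℝ) • sectionForm κ Ω σ (pS x), fun v => ?_⟩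
  rw [liouvilleForm_eq_sectionForm hΩ h hp hform hx v]
  rfl

theorem projected_covector_smul
    (hp : IsPrincipalBundle (EG := ℝ) (EM := ES) (EK := EC) (ScalingGroup κ) pS)
    (hform : IsHomogeneousForm (fun (s : ScalingGroup κ) (x : S) => s • x)
      (fun s : ScalingGroup κ => (s : ℝ)) Ω) {s : ScalingGroup κ} {x : S} {α α' : EC →L[ℝ] ℝ}
    (hα : ∀ v : TangentSpace 𝓘(ℝ, ES) x,
      α (mfderiv 𝓘(ℝ, ES) 𝓘(ℝ, EC) pS x v) = liouvilleForm κ Ω x v)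
    (hα' : ∀ v : TangentSpace 𝓘(ℝ, ES) (s • x),
      α' (mfderiv 𝓘(ℝ, ES) 𝓘(ℝ, EC) pS (s • x) v) = liouvilleForm κ Ω (s • x) v) :
    α' = (s : ℝ) • α := by
  ext w
  obtain ⟨v, rfl⟩ := hp.surjective_mfderiv x w
  have h1 := hα' (mfderiv 𝓘(ℝ, ES) 𝓘(ℝ, ES) (fun y : S => s • y) x v)
  rw [liouvilleForm_smul hp hform] at h1
  refine Eq.trans (congrArg α' (mfderiv_pr_smul hp s x v).symm) (h1.trans ?_)
  rw [← hα v]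
  rfl

/-- The distribution is spanned by images from every point of the fibre. The covectors at these
points are nonzero multiples of each other, so the one at x annihilates the whole span. -/
theorem mem_projectedDistribution_iff (hΩ : IsSymplectic Ω)
    (hp : IsPrincipalBundle (EG := ℝ) (EM := ES) (EK := EC) (ScalingGroup κ) pS)
    (hform : IsHomogeneousForm (fun (s : ScalingGroup κ) (x : S) => s • x)
      (fun s : ScalingGroup κ => (s : ℝ)) Ω) (x : S) (v : TangentSpace 𝓘(ℝ, ES) x) :
    mfderiv 𝓘(ℝ, ES) 𝓘(ℝ, EC) pS x v ∈
      (projectedDistribution κ Ω pS (pS x) : Submodule ℝ (TangentSpace 𝓘(ℝ, EC) (pS x))) ↔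
      liouvilleForm κ Ω x v = 0 := by
  constructor
  · intro hv
    obtain ⟨α, hα⟩ := exists_projected_covector hΩ hp hform x
    rw [← hα]
    have hle : (projectedDistribution κ Ω pS (pS x) :
        Submodule ℝ (TangentSpace 𝓘(ℝ, EC) (pS x))) ≤ LinearMap.ker α.toLinearMap := by
      refine Submodule.span_le.2 ?_
      rintro w ⟨⟨y, u⟩, hu, hw⟩
      have hproj : pS x = pS y := (congrArg TotalSpace.proj hw).symm
      have hw' : (w : EC) = mfderiv 𝓘(ℝ, ES) 𝓘(ℝ, EC) pS y u := by
        have key : ∀ {c c' : C} {a : TangentSpace 𝓘(ℝ, EC) c} {b : TangentSpace 𝓘(ℝ, EC) c'},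
            (⟨c, a⟩ : TangentBundle 𝓘(ℝ, EC) C) = ⟨c', b⟩ → (a : EC) = b := by
          intro c c' a b hab
          cases hab
          rfl
        exact (key hw).symm
      obtain ⟨s, rfl⟩ := (hp.eq_iff x y).1 hproj
      obtain ⟨β, hβ⟩ := exists_projected_covector hΩ hp hform (s • x)
      have hs : (β : EC →L[ℝ] ℝ) = (s : ℝ) • (α : EC →L[ℝ] ℝ) :=
        projected_covector_smul hp hform hα hβ
      have h0 : (β : EC →L[ℝ] ℝ) (w : EC) = 0 :=
        (congrArg (β : EC →L[ℝ] ℝ) hw').trans ((hβ u).trans hu)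
      have h1 : (s : ℝ) * (α : EC →L[ℝ] ℝ) (w : EC) = 0 :=
        (congrArg (fun f : EC →L[ℝ] ℝ => f (w : EC)) hs).symm.trans h0
      exact (mul_eq_zero.1 h1).resolve_left s.ne_zero
    exact hle hv
  · intro hv
    exact Submodule.subset_span ⟨⟨x, v⟩, hv, rfl⟩

/-- Otherwise Δ would vanish at x, whereas it differentiates the nonzero coordinate τ to itself. -/
theorem liouvilleForm_ne_zero (hΩ : IsSymplectic Ω)
    (hp : IsPrincipalBundle (EG := ℝ) (EM := ES) (EK := EC) (ScalingGroup κ) pS) (x : S) :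
    ∃ v : TangentSpace 𝓘(ℝ, ES) x, liouvilleForm κ Ω x v ≠ 0 := by
  by_contra! hv
  obtain ⟨U, σ, τ, h, hx⟩ := hp.exists_isLocalSection (pS x)
  have h0 : (scalingGenerator κ x : TangentSpace 𝓘(ℝ, ES) x) = 0 :=
    hΩ.nondegenerate x _ fun w => neg_eq_zero.1 (hv w)
  have h1 := h.mvfderiv_fiber_scalingGenerator hp hx
  rw [h0, map_zero] at h1
  exact (τ x).ne_zero h1.symm

/-- A covector annihilating D pulls back to a functional vanishing on ker λ, hence to a multiple of
λ. The multiple is found by evaluating at a vector v₀ with λ(v₀) ≠ 0. -/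
theorem exists_projected_frame (hΩ : IsSymplectic Ω)
    (hp : IsPrincipalBundle (EG := ℝ) (EM := ES) (EK := EC) (ScalingGroup κ) pS)
    (hform : IsHomogeneousForm (fun (s : ScalingGroup κ) (x : S) => s • x)
      (fun s : ScalingGroup κ => (s : ℝ)) Ω) [FiniteDimensional ℝ EC] (x : S) :
    ∃ A : ℝ ≃L[ℝ] annihilator (projectedDistribution κ Ω pS) (pS x),
      ∀ (t : ℝ) (v : TangentSpace 𝓘(ℝ, ES) x),
        ((A t).1 : TangentSpace 𝓘(ℝ, EC) (pS x) →L[ℝ] ℝ) (mfderiv 𝓘(ℝ, ES) 𝓘(ℝ, EC) pS x v) =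
          t * liouvilleForm κ Ω x v := by
  obtain ⟨α, hα⟩ := exists_projected_covector hΩ hp hform x
  have hmem : α ∈ annihilator (projectedDistribution κ Ω pS) (pS x) := by
    intro w hw
    obtain ⟨v, rfl⟩ := hp.surjective_mfderiv x w
    rw [hα, ← mem_projectedDistribution_iff hΩ hp hform x v]
    exact hw
  obtain ⟨v₀, hv₀⟩ := liouvilleForm_ne_zero hΩ hp x
  let V : Submodule ℝ (EC →L[ℝ] ℝ) := annihilator (projectedDistribution κ Ω pS) (pS x)
  let a : V := ⟨α, hmem⟩
  let P : ES →L[ℝ] EC := mfderiv 𝓘(ℝ, ES) 𝓘(ℝ, EC) pS x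
  have ha : a ≠ 0 := by
    intro ha
    apply hv₀
    rw [← hα]
    exact congrArg (fun b : V => b.1 (P v₀)) ha
  have hspan : ∀ b : V, ∃ t : ℝ, t • a = b := by
    intro b
    refine ⟨b.1 (P v₀) / liouvilleForm κ Ω x v₀, Subtype.ext ?_⟩
    ext w
    obtain ⟨v, rfl⟩ := hp.surjective_mfderiv x w
    let Λ : ES →L[ℝ] ℝ := liouvilleForm κ Ω x
    let v₁ : ES := v
    let v₂ : ES := v₀
    have h0 : liouvilleForm κ Ω x (v₁ - (Λ v₁ / Λ v₂) • v₂) = 0 := by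
      change Λ (v₁ - (Λ v₁ / Λ v₂) • v₂) = 0
      rw [map_sub, map_smul, smul_eq_mul, div_mul_cancel₀ (Λ v₁) (show Λ v₂ ≠ 0 from hv₀), sub_self]
    have h1 : b.1 (P (v₁ - (Λ v₁ / Λ v₂) • v₂)) = 0 :=
      b.2 _ ((mem_projectedDistribution_iff hΩ hp hform x _).2 h0)
    rw [map_sub, map_smul, map_sub, map_smul, sub_eq_zero, smul_eq_mul] at h1
    change (b.1 (P v₂) / Λ v₂) * α (P v₁) = b.1 (P v₁)
    rw [h1]
    have h2 : α (P v₁) = Λ v₁ := hα v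
    rw [h2]
    ring
  obtain ⟨e, he⟩ := exists_frame_of_span (V := ↥V) (a := a) ha hspan
  refine ⟨e, fun t v => ?_⟩
  refine (congrArg (fun b : V => b.1 (P v)) (he t)).trans ?_
  change t * α (P v) = _
  exact congrArg (fun b => t * b) (hα v)

end ProjectedCovectors

/-! ### The annihilator as a subbundle of the cotangent bundle. -/

section AnnihilatorFrame

variable {ES EC S C : Type*} [NormedAddCommGroup ES] [NormedSpace ℝ ES] [FiniteDimensional ℝ ES]
  [NormedAddCommGroup EC] [NormedSpace ℝ EC]
  [TopologicalSpace S] [ChartedSpace ES S] [IsManifold 𝓘(ℝ, ES) ∞ S]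
  [TopologicalSpace C] [ChartedSpace EC C] [IsManifold 𝓘(ℝ, EC) ∞ C]
  {κ : ScalingKind} [MulAction (ScalingGroup κ) S] {pS : S → C}
  {Ω : ∀ x : S, TangentSpace 𝓘(ℝ, ES) x →L[ℝ] TangentSpace 𝓘(ℝ, ES) x →L[ℝ] ℝ}

theorem mk_annihilator_eq {D : ∀ c : C, Submodule ℝ (TangentSpace 𝓘(ℝ, EC) c)} {c c' : C}
    {α : annihilator D c} {α' : annihilator D c'} (h : c = c')
    (hα : (α.1 : EC →L[ℝ] ℝ) = α'.1) :
    (TotalSpace.mk' ℝ c α : TotalSpace ℝ fun c => annihilator D c) = TotalSpace.mk' ℝ c' α' := by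
  subst h
  exact congrArg (TotalSpace.mk' ℝ c) (Subtype.ext hα)

theorem annihilator_eq_of_mk_eq {D : ∀ c : C, Submodule ℝ (TangentSpace 𝓘(ℝ, EC) c)} {c c' : C}
    {α : annihilator D c} {α' : annihilator D c'}
    (h : (TotalSpace.mk' ℝ c α : TotalSpace ℝ fun c => annihilator D c) = TotalSpace.mk' ℝ c' α') :
    (α.1 : EC →L[ℝ] ℝ) = α'.1 := by
  cases h
  rfl

/-- The frame `A` of the annihilator of the projected distribution is induced by the Liouville
form. -/
def IsLiouvilleFrame
    (Ω : ∀ x : S, TangentSpace 𝓘(ℝ, ES) x →L[ℝ] TangentSpace 𝓘(ℝ, ES) x →L[ℝ] ℝ) (pS : S → C)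
    (A : ∀ x, ℝ ≃L[ℝ] annihilator (E := EC) (projectedDistribution κ Ω pS) (pS x)) : Prop :=
  ∀ (x : S) (t : ℝ) (v : TangentSpace 𝓘(ℝ, ES) x),
    ((A x t).1 : TangentSpace 𝓘(ℝ, EC) (pS x) →L[ℝ] ℝ) (mfderiv 𝓘(ℝ, ES) 𝓘(ℝ, EC) pS x v) =
      t * liouvilleForm κ Ω x v

variable {A : ∀ x, ℝ ≃L[ℝ] annihilator (E := EC) (projectedDistribution κ Ω pS) (pS x)}

theorem IsLiouvilleFrame.isHomogeneousFrame (hA : IsLiouvilleFrame Ω pS A)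
    (hp : IsPrincipalBundle (EG := ℝ) (EM := ES) (EK := EC) (ScalingGroup κ) pS)
    (hform : IsHomogeneousForm (fun (s : ScalingGroup κ) (x : S) => s • x)
      (fun s : ScalingGroup κ => (s : ℝ)) Ω) :
    IsHomogeneousFrame (L := fun c => annihilator (E := EC) (projectedDistribution κ Ω pS) c)
      (fun (s : ScalingGroup κ) (x : S) => s • x)
      (fun s : ScalingGroup κ => (s : ℝ)) pS A := by
  intro s x t
  refine mk_annihilator_eq (hp.apply_smul s x) ?_
  ext w
  obtain ⟨v, rfl⟩ := hp.surjective_mfderiv x w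
  have h1 := hA (s • x) t (mfderiv 𝓘(ℝ, ES) 𝓘(ℝ, ES) (fun y : S => s • y) x v)
  rw [liouvilleForm_smul hp hform] at h1
  refine Eq.trans (congrArg ((A (s • x) t).1 : EC →L[ℝ] ℝ) (mfderiv_pr_smul hp s x v).symm)
    (h1.trans (Eq.trans ?_ (hA x (s * t) v).symm))
  ring

/-- Evaluates the frame on Tσ(w), a lift of w; only the germ of a section is required, so the result
also serves sections obtained from local lifts. -/
theorem IsLiouvilleFrame.apply_eq_of_mk_eq (hA : IsLiouvilleFrame Ω pS A)
    (hp : ContMDiff 𝓘(ℝ, ES) 𝓘(ℝ, EC) ∞ pS) {σ : C → S} {y : C}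
    (hσ : MDifferentiableAt 𝓘(ℝ, EC) 𝓘(ℝ, ES) σ y) (hpσ : ∀ᶠ z in 𝓝 y, pS (σ z) = z) {t : ℝ}
    {β : annihilator (E := EC) (projectedDistribution κ Ω pS) y}
    (h : (TotalSpace.mk' ℝ y β :
      TotalSpace ℝ fun c => annihilator (E := EC) (projectedDistribution κ Ω pS) c) =
      TotalSpace.mk' ℝ (pS (σ y)) (A (σ y) t)) (w : TangentSpace 𝓘(ℝ, EC) y) :
    (β.1 : TangentSpace 𝓘(ℝ, EC) y →L[ℝ] ℝ) w = t * sectionForm κ Ω σ y w := by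
  have h1 := annihilator_eq_of_mk_eq h
  have h2 := mfderiv_section_of_eventually hp hσ hpσ w
  refine (congrArg (fun f : EC →L[ℝ] ℝ => f w) h1).trans ?_
  refine (congrArg ((A (σ y) t).1 : EC →L[ℝ] ℝ) h2.symm).trans ?_
  exact hA (σ y) t (mfderiv 𝓘(ℝ, EC) 𝓘(ℝ, ES) σ y w)

/-- A section smooth in D° lifts to a function t and a local section s of pS, and as a form it is t
s*λ. Conversely a smooth form α in D° is c η with η = σ*λ and c = α(X)/η(X), for a local field X
with η(X) ≠ 0. -/
theorem IsLiouvilleFrame.isCotangentSubbundle [FiniteDimensional ℝ EC]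
    [TopologicalSpace
      (TotalSpace ℝ fun c => annihilator (E := EC) (projectedDistribution κ Ω pS) c)]
    [FiberBundle ℝ fun c => annihilator (E := EC) (projectedDistribution κ Ω pS) c]
    [VectorBundle ℝ ℝ fun c => annihilator (E := EC) (projectedDistribution κ Ω pS) c]
    [ContMDiffVectorBundle ∞ ℝ (fun c => annihilator (E := EC) (projectedDistribution κ Ω pS) c)
      𝓘(ℝ, EC)]
    (hA : IsLiouvilleFrame Ω pS A) (hΩ : IsSymplectic Ω)
    (hp : IsPrincipalBundle (EG := ℝ) (EM := ES) (EK := EC) (ScalingGroup κ) pS)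
    (hform : IsHomogeneousForm (fun (s : ScalingGroup κ) (x : S) => s • x)
      (fun s : ScalingGroup κ => (s : ℝ)) Ω)
    (hAsm : ContMDiff 𝓘(ℝ, ES) (𝓘(ℝ, EC).prod 𝓘(ℝ, ℝ)) ∞
      (fun x => (TotalSpace.mk' ℝ (pS x) (A x 1) :
        TotalSpace ℝ fun c => annihilator (E := EC) (projectedDistribution κ Ω pS) c))) :
    IsCotangentSubbundle (E := EC) (projectedDistribution κ Ω pS) := by
  have := hp.contMDiffSMul
  intro α y
  constructor
  · intro hα
    obtain ⟨t, s, ht, hs, hz⟩ := hp.isScaledFibration.exists_local_lift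
      (L := fun c => annihilator (E := EC) (projectedDistribution κ Ω pS) c) hAsm
      (TotalSpace.mk' ℝ y (α y))
    have ht' := ht.comp y hα
    have hs' := hs.comp y hα
    have hz' := hα.continuousAt.eventually hz
    have hps : ∀ᶠ z in 𝓝 y, pS (s (TotalSpace.mk' ℝ z (α z))) = z := by
      filter_upwards [hz'] with z hz
      exact (congrArg TotalSpace.proj hz).symm
    refine contMDiffAt_dual_section fun v => ?_
    have h1 := ht'.mul (ContMDiffAt.dual_apply (b := fun z => z)
      (contMDiffAt_sectionForm (κ := κ) hΩ hs') (contMDiffAt_trivialization_symm y v))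
    refine h1.congr_of_eventuallyEq ?_
    -- Order one is used because smoothness at a point extends to a neighbourhood only for a fixed
    -- finite order.
    filter_upwards [hz', hps.eventually_nhds, 
      (contMDiffAt_iff_contMDiffAt_nhds (n := 1) (by simp)).1 (hs'.of_le (by simp))]
      with z hz hpz hsz
    exact hA.apply_eq_of_mk_eq hp.contMDiff (hsz.mdifferentiableAt (by simp)) hpz hz _
  · intro hα
    obtain ⟨U, σ, τ, h, hy⟩ := hp.exists_isLocalSection y
    have hσ := h.contMDiffAt_section hy
    let N : C → EC →L[ℝ] ℝ := fun z => sectionForm κ Ω σ z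
    obtain ⟨w, hw⟩ : ∃ w : EC, N y w ≠ 0 := by
      obtain ⟨v, hv⟩ := liouvilleForm_ne_zero hΩ hp (σ y)
      have hyσ : pS (σ y) ∈ U := by
        rw [h.apply_section y hy]
        exact hy
      refine ⟨(mfderiv 𝓘(ℝ, ES) 𝓘(ℝ, EC) pS (σ y) v : EC), fun h0 => hv ?_⟩
      rw [liouvilleForm_eq_sectionForm hΩ h hp hform hyσ v]
      have hN : N (pS (σ y)) = N y := congrArg N (h.apply_section y hy)
      exact (congrArg (fun f : EC →L[ℝ] ℝ => (τ (σ y) : ℝ) * f _) hN).trans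
        ((congrArg (fun a : ℝ => (τ (σ y) : ℝ) * a) h0).trans (mul_zero _))
    let T := trivializationAt EC (TangentSpace 𝓘(ℝ, EC) : C → Type _) y
    have hyT : y ∈ T.baseSet := FiberBundle.mem_baseSet_trivializationAt' y
    let X : ∀ z : C, TangentSpace 𝓘(ℝ, EC) z := fun z => T.symm z (T ⟨y, w⟩).2
    have hXy : X y = w := T.symm_apply_apply_mk hyT w
    have hX := contMDiffAt_trivialization_symm (E := EC) (V := (TangentSpace 𝓘(ℝ, EC) : C → Type _))
      y (T ⟨y, w⟩).2
    have hη := ContMDiffAt.dual_apply (b := fun z => z) (contMDiffAt_sectionForm (κ := κ) hΩ hσ) hX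
    have hαX := ContMDiffAt.dual_apply (b := fun z => z) hα hX
    have hne : sectionForm κ Ω σ y (X y) ≠ 0 := by
      rw [hXy]
      exact hw
    have hc := hαX.div₀ hη hne
    have hframe := ((contMDiff_frame
      (L := fun c => annihilator (E := EC) (projectedDistribution κ Ω pS) c) hAsm) (_, σ y)).comp y
      (hc.prodMk hσ)
    refine hframe.congr_of_eventuallyEq ?_
    filter_upwards [h.isOpen.mem_nhds hy, hη.continuousAt.eventually_ne hne] with z hz hzne
    have hpz : ∀ᶠ z' in 𝓝 z, pS (σ z') = z' := by
      filter_upwards [h.isOpen.mem_nhds hz] with z' hz'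
      exact h.apply_section z' hz'
    obtain ⟨e, he⟩ := exists_frame_eq
      (L := fun c => annihilator (E := EC) (projectedDistribution κ Ω pS) c) A
      (h.apply_section z hz)
    obtain ⟨t, ht⟩ := e.surjective (α z)
    have h1 := (congrArg (TotalSpace.mk' ℝ z) ht.symm).trans (he t)
    have h2 := hA.apply_eq_of_mk_eq hp.contMDiff
      ((h.contMDiffAt_section hz).mdifferentiableAt (by simp)) hpz h1 (X z)
    refine h1.trans ?_
    have h3 : t = (α z).1 (X z) / sectionForm κ Ω σ z (X z) := by
      rw [h2, mul_div_cancel_right₀ _ hzne]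
    rw [h3]
    rfl

end AnnihilatorFrame

/-! ### Pointwise dependence of the exterior derivative. -/

section ExteriorDerivative

variable {E M : Type*} [NormedAddCommGroup E] [NormedSpace ℝ E] [FiniteDimensional ℝ E]
  [TopologicalSpace M] [ChartedSpace E M] [IsManifold 𝓘(ℝ, E) ∞ M]

/-- The derivative at a zero of a 1-form `θ` of its value on a vector field depends only on the
value of the vector field there. -/
theorem mvfderiv_apply_congr_of_eq_zero {θ : ∀ x : M, TangentSpace 𝓘(ℝ, E) x →L[ℝ] ℝ} {y : M}
    (hθ : ContMDiffAt 𝓘(ℝ, E) (𝓘(ℝ, E).prod 𝓘(ℝ, E →L[ℝ] ℝ)) ∞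
      (fun x => (TotalSpace.mk' (E →L[ℝ] ℝ) x (θ x) : TotalSpace (E →L[ℝ] ℝ)
        (fun x : M => TangentSpace 𝓘(ℝ, E) x →L[ℝ] Bundle.Trivial M ℝ x))) y)
    (h0 : θ y = 0) {X X' : ∀ x : M, TangentSpace 𝓘(ℝ, E) x} (hX : SmoothVectorField X)
    (hX' : SmoothVectorField X') (h : X y = X' y) (w : TangentSpace 𝓘(ℝ, E) y) :
    mvfderiv 𝓘(ℝ, E) (fun z => θ z (X z)) y w = mvfderiv 𝓘(ℝ, E) (fun z => θ z (X' z)) y w := by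
  let T := trivializationAt E (TangentSpace 𝓘(ℝ, E) : M → Type _) y
  have hy : y ∈ T.baseSet := FiberBundle.mem_baseSet_trivializationAt' y
  let g : M → E →L[ℝ] ℝ := fun z => (θ z : E →L[ℝ] ℝ).comp (T.symmL ℝ z)
  have hg : ContMDiffAt 𝓘(ℝ, E) 𝓘(ℝ, E →L[ℝ] ℝ) ∞ g y := by
    refine contMDiffAt_clm_of_forall fun v => ?_
    refine (ContMDiffAt.dual_apply (b := fun z => z) hθ
      (contMDiffAt_trivialization_symm y v)).congr_of_eventuallyEq ?_
    filter_upwards [T.open_baseSet.mem_nhds hy] with z hz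
    exact congrArg (θ z) (T.symmL_apply hz v)
  have hg0 : g y = 0 := by
    ext v
    exact congrArg (fun f : E →L[ℝ] ℝ => f (T.symmL ℝ y v)) h0
  let dg : E →L[ℝ] E →L[ℝ] ℝ := mfderiv 𝓘(ℝ, E) 𝓘(ℝ, E →L[ℝ] ℝ) g y
  have key : ∀ {Y : ∀ x : M, TangentSpace 𝓘(ℝ, E) x}, SmoothVectorField Y →
      mvfderiv 𝓘(ℝ, E) (fun z => θ z (Y z)) y w =
        dg w (T ⟨y, Y y⟩).2 := by
    intro Y hY
    have hc : ContMDiffAt 𝓘(ℝ, E) 𝓘(ℝ, E) ∞ (fun z => (T ⟨z, Y z⟩).2) y :=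
      (contMDiffAt_section y).1 (hY y)
    have heq : (fun z => θ z (Y z)) =ᶠ[𝓝 y]
        (fun q : (E →L[ℝ] ℝ) × E => q.1 q.2) ∘ (fun z => (g z, (T ⟨z, Y z⟩).2)) := by
      filter_upwards [T.open_baseSet.mem_nhds hy] with z hz
      have h1 : (T.symmL ℝ z (T ⟨z, Y z⟩).2) = Y z :=
        (T.symmL_apply hz _).trans (T.symm_apply_apply_mk hz (Y z))
      exact congrArg (θ z) h1.symm
    have hB : HasMFDerivAt 𝓘(ℝ, (E →L[ℝ] ℝ) × E) 𝓘(ℝ, ℝ)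
        (fun q : (E →L[ℝ] ℝ) × E => q.1 q.2) (g y, (T ⟨y, Y y⟩).2) _ :=
      (isBoundedBilinearMap_apply.hasFDerivAt (𝕜 := ℝ) (g y, (T ⟨y, Y y⟩).2)).hasMFDerivAt
    have h1 := (hg.mdifferentiableAt (n := ∞) (by simp)).hasMFDerivAt
    have h2 := (hc.mdifferentiableAt (n := ∞) (by simp)).hasMFDerivAt
    let dc : E →L[ℝ] E := mfderiv 𝓘(ℝ, E) 𝓘(ℝ, E) (fun z => (T ⟨z, Y z⟩).2) y
    have hgc : HasMFDerivAt 𝓘(ℝ, E) 𝓘(ℝ, (E →L[ℝ] ℝ) × E) (fun z => (g z, (T ⟨z, Y z⟩).2)) y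
        (dg.prod dc) := ⟨h1.1.prodMk h2.1, h1.2.prodMk h2.2⟩
    have hcomp := HasMFDerivAt.comp (f := fun z => (g z, (T ⟨z, Y z⟩).2)) y hB hgc
    have h2 := (hcomp.congr_of_eventuallyEq heq).mfderiv
    refine (congrArg (fun f : E →L[ℝ] ℝ => f w) h2).trans ?_
    -- Product rule: the term that differentiates Y is paired with g y, which is zero.
    refine Eq.trans (b := g y _ + dg w (T ⟨y, Y y⟩).2) rfl ?_
    rw [hg0]
    exact zero_add _
  rw [key hX, key hX', h]

variable [T2Space M]

/-- The exterior derivative of a 1-form depends only on the value of the first vector field. -/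
theorem extDerivOne_congr_left {η : ∀ x : M, TangentSpace 𝓘(ℝ, E) x →L[ℝ] ℝ} {y : M}
    (hη : ContMDiffAt 𝓘(ℝ, E) (𝓘(ℝ, E).prod 𝓘(ℝ, E →L[ℝ] ℝ)) ∞
      (fun x => (TotalSpace.mk' (E →L[ℝ] ℝ) x (η x) : TotalSpace (E →L[ℝ] ℝ)
        (fun x : M => TangentSpace 𝓘(ℝ, E) x →L[ℝ] Bundle.Trivial M ℝ x))) y)
    {X X' Y : ∀ x : M, TangentSpace 𝓘(ℝ, E) x} (hX : SmoothVectorField X)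
    (hX' : SmoothVectorField X') (hY : SmoothVectorField Y) (h : X y = X' y) :
    extDerivOne η X Y y = extDerivOne η X' Y y := by
  have := FiniteDimensional.complete ℝ E
  -- Subtracting df makes the form vanish at y, and costs nothing because d(df) = 0 by the
  -- commutator formula.
  obtain ⟨f, hf, -, hfη, -⟩ := exists_contMDiff_mvfderiv_eq (x := y) Filter.univ_mem (η y)
  let θ : ∀ x : M, TangentSpace 𝓘(ℝ, E) x →L[ℝ] ℝ := fun x => η x - mvfderiv 𝓘(ℝ, E) f x
  have hθ : ContMDiffAt 𝓘(ℝ, E) (𝓘(ℝ, E).prod 𝓘(ℝ, E →L[ℝ] ℝ)) ∞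
      (fun x => (TotalSpace.mk' (E →L[ℝ] ℝ) x (θ x) : TotalSpace (E →L[ℝ] ℝ)
        (fun x : M => TangentSpace 𝓘(ℝ, E) x →L[ℝ] Bundle.Trivial M ℝ x))) y := by
    refine contMDiffAt_dual_section fun v => ?_
    exact (ContMDiffAt.dual_apply (b := fun z => z) hη
      (contMDiffAt_trivialization_symm y v)).sub
      (ContMDiffAt.mvfderiv_along (b := fun z => z) (hf y) (contMDiffAt_trivialization_symm y v))
  have h0 : θ y = 0 := by
    change η y - mvfderiv 𝓘(ℝ, E) f y = 0
    rw [hfη, sub_self]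
  have hsub : ∀ {Z : ∀ x : M, TangentSpace 𝓘(ℝ, E) x}, SmoothVectorField Z →
      mvfderiv 𝓘(ℝ, E) (fun z => θ z (Z z)) y (Y y) =
        mvfderiv 𝓘(ℝ, E) (fun z => η z (Z z)) y (Y y) -
        mvfderiv 𝓘(ℝ, E) (fun z => mvfderiv 𝓘(ℝ, E) f z (Z z)) y (Y y) := by
    intro Z hZ
    have h1 : MDifferentiableAt 𝓘(ℝ, E) 𝓘(ℝ, ℝ) (fun z => η z (Z z)) y :=
      (ContMDiffAt.dual_apply (b := fun z => z) hη (hZ y)).mdifferentiableAt (by simp)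
    have h2 : MDifferentiableAt 𝓘(ℝ, E) 𝓘(ℝ, ℝ) (fun z => mvfderiv 𝓘(ℝ, E) f z (Z z)) y :=
      (ContMDiffAt.mvfderiv_along (b := fun z => z) (hf y) (hZ y)).mdifferentiableAt (by simp)
    exact congrArg (fun f : E →L[ℝ] ℝ => f (Y y)) (mvfderiv_sub h1 h2)
  have hbr : ∀ {Z : ∀ x : M, TangentSpace 𝓘(ℝ, E) x}, SmoothVectorField Z →
      η y (VectorField.mlieBracket 𝓘(ℝ, E) Z Y y) =
        mvfderiv 𝓘(ℝ, E) (fun z => mvfderiv 𝓘(ℝ, E) f z (Y z)) y (Z y) -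
        mvfderiv 𝓘(ℝ, E) (fun z => mvfderiv 𝓘(ℝ, E) f z (Z z)) y (Y y) := by
    intro Z hZ
    rw [← mvfderiv_mlieBracket hf hZ hY, hfη]
  have hA := mvfderiv_apply_congr_of_eq_zero hθ h0 hX hX' h (Y y)
  rw [hsub hX, hsub hX'] at hA
  unfold extDerivOne
  rw [hbr hX, hbr hX', h]
  linarith

end ExteriorDerivative

/-! ### Lie brackets of projected Hamiltonian fields. -/

section Projection

variable {ES EK S K J : Type*} [NormedAddCommGroup ES] [NormedSpace ℝ ES] [FiniteDimensional ℝ ES]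
  [NormedAddCommGroup EK] [NormedSpace ℝ EK] [FiniteDimensional ℝ EK]
  [TopologicalSpace S] [ChartedSpace ES S] [IsManifold 𝓘(ℝ, ES) ∞ S]
  [TopologicalSpace K] [ChartedSpace EK K] [IsManifold 𝓘(ℝ, EK) ∞ K] [T2Space K]
  {Ω : ∀ x : S, TangentSpace 𝓘(ℝ, ES) x →L[ℝ] TangentSpace 𝓘(ℝ, ES) x →L[ℝ] ℝ} {pr : S → K}

/-- The Lie bracket of projections of Hamiltonian vector fields. -/
theorem mfderiv_hamiltonianVectorField_poissonBracket (hΩ : IsSymplectic Ω)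
    (hpr : ContMDiff 𝓘(ℝ, ES) 𝓘(ℝ, EK) ∞ pr) {F G : S → ℝ}
    (hF : ContMDiff 𝓘(ℝ, ES) 𝓘(ℝ, ℝ) ∞ F) (hG : ContMDiff 𝓘(ℝ, ES) 𝓘(ℝ, ℝ) ∞ G)
    {X Y : ∀ k : K, TangentSpace 𝓘(ℝ, EK) k} (hX : SmoothVectorField X) (hY : SmoothVectorField Y)
    (hFX : ∀ x, mfderiv 𝓘(ℝ, ES) 𝓘(ℝ, EK) pr x (hamiltonianVectorField Ω F x) = X (pr x))
    (hGY : ∀ x, mfderiv 𝓘(ℝ, ES) 𝓘(ℝ, EK) pr x (hamiltonianVectorField Ω G x) = Y (pr x)) (x : S) :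
    mfderiv 𝓘(ℝ, ES) 𝓘(ℝ, EK) pr x (hamiltonianVectorField Ω (poissonBracket Ω F G) x) =
      VectorField.mlieBracket 𝓘(ℝ, EK) X Y (pr x) := by
  have := FiniteDimensional.complete ℝ EK
  -- Tested on f, both sides are the commutator of the Poisson actions of F and G on f ∘ pr.
  refine eq_of_forall_mvfderiv_eq fun f hf => ?_
  have hcomp : ∀ {g : K → ℝ} (_ : ContMDiff 𝓘(ℝ, EK) 𝓘(ℝ, ℝ) ∞ g) (H : S → ℝ) (y : S),
      mvfderiv 𝓘(ℝ, EK) g (pr y)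
        (mfderiv 𝓘(ℝ, ES) 𝓘(ℝ, EK) pr y (hamiltonianVectorField Ω H y)) =
      poissonBracket Ω H (g ∘ pr) y := fun {g} hg H y =>
    (mvfderiv_comp_apply y (hg.mdifferentiable (by simp) _) (hpr.mdifferentiable (by simp) _) _).symm
  have hXf : ContMDiff 𝓘(ℝ, EK) 𝓘(ℝ, ℝ) ∞ (fun k => mvfderiv 𝓘(ℝ, EK) f k (X k)) :=
    fun k => ContMDiffAt.mvfderiv_along (b := fun k => k) (hf k) (hX k)
  have hYf : ContMDiff 𝓘(ℝ, EK) 𝓘(ℝ, ℝ) ∞ (fun k => mvfderiv 𝓘(ℝ, EK) f k (Y k)) :=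
    fun k => ContMDiffAt.mvfderiv_along (b := fun k => k) (hf k) (hY k)
  have hXp : (fun k => mvfderiv 𝓘(ℝ, EK) f k (X k)) ∘ pr = poissonBracket Ω F (f ∘ pr) :=
    funext fun y => by
      change mvfderiv 𝓘(ℝ, EK) f (pr y) (X (pr y)) = _
      rw [← hFX, hcomp hf]
  have hYp : (fun k => mvfderiv 𝓘(ℝ, EK) f k (Y k)) ∘ pr = poissonBracket Ω G (f ∘ pr) :=
    funext fun y => by
      change mvfderiv 𝓘(ℝ, EK) f (pr y) (Y (pr y)) = _
      rw [← hGY, hcomp hf]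
  rw [mvfderiv_mlieBracket hf hX hY, hcomp hf, poissonBracket_leibniz hΩ hF hG (hf.comp hpr),
    ← hXp, ← hYp, ← hcomp hXf, ← hcomp hYf, hFX, hGY]

end Projection

/-! ### The contact form on the base. -/

section Contact

variable {ES EC S C : Type*} [NormedAddCommGroup ES] [NormedSpace ℝ ES] [FiniteDimensional ℝ ES]
  [NormedAddCommGroup EC] [NormedSpace ℝ EC] [FiniteDimensional ℝ EC]
  [TopologicalSpace S] [ChartedSpace ES S] [IsManifold 𝓘(ℝ, ES) ∞ S]
  [TopologicalSpace C] [ChartedSpace EC C] [IsManifold 𝓘(ℝ, EC) ∞ C] [T2Space C]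
  {κ : ScalingKind} [MulAction (ScalingGroup κ) S] {pS : S → C}
  {Ω : ∀ x : S, TangentSpace 𝓘(ℝ, ES) x →L[ℝ] TangentSpace 𝓘(ℝ, ES) x →L[ℝ] ℝ}
  {U : Set C} {σ : C → S} {τ : S → ScalingGroup κ}

/-- Homogeneous functions with a prescribed differential along a section. -/
theorem IsLocalSection.exists_homogeneous_mvfderiv_eq
    (h : IsLocalSection (ES := ES) (EC := EC) pS U σ τ)
    (hp : IsPrincipalBundle (EG := ℝ) (EM := ES) (EK := EC) (ScalingGroup κ) pS) {y : C}
    (hy : y ∈ U) (l : EC →L[ℝ] ℝ) :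
    ∃ F ∈ homogeneousFunctions (ES := ES) (fun (s : ScalingGroup κ) (x : S) => s • x)
      (fun s : ScalingGroup κ => (s : ℝ)), F (σ y) = 0 ∧
      ∀ v : TangentSpace 𝓘(ℝ, ES) (σ y), mvfderiv 𝓘(ℝ, ES) F (σ y) v =
        l (mfderiv 𝓘(ℝ, ES) 𝓘(ℝ, EC) pS (σ y) v) := by
  obtain ⟨f, hf, hfy, hfl, hfU⟩ := exists_contMDiff_mvfderiv_eq (x := y) (h.isOpen.mem_nhds hy) l
  have hpy := h.apply_section y hy
  have hfp : ContMDiff 𝓘(ℝ, ES) 𝓘(ℝ, ℝ) ∞ (fun x => f (pS x)) := hf.comp hp.contMDiff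
  have hf0 : ∀ {c}, c ∉ U → f c = 0 := fun hc =>
    image_eq_zero_of_notMem_tsupport fun hc' => hc (hfU hc')
  have hfy' : f (pS (σ y)) = 0 := by rw [hpy, hfy]
  have hyU : pS (σ y) ∈ U := by rw [hpy]; exact hy
  -- The coordinate τ carries the degree, and the support of f inside U lets the product extend by
  -- zero. At σ y one has f = 0 and τ = 1, so only df contributes to the differential.
  refine ⟨(fun x => (τ x : ℝ)) * fun x => f (pS x), ⟨fun x => ?_, fun s x => ?_⟩, ?_, fun v => ?_⟩
  · by_cases hx : pS x ∈ U
    · exact (h.contMDiffAt_fiber hp hx).mul (hfp x)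
    · have hzero : ∀ᶠ z in 𝓝 x, f (pS z) = 0 :=
        hp.contMDiff.continuous.continuousAt.eventually
          (notMem_tsupport_iff_eventuallyEq.1 fun hx' => hx (hfU hx'))
      refine (contMDiffAt_const (c := (0 : ℝ))).congr_of_eventuallyEq ?_
      filter_upwards [hzero] with z hz
      rw [Pi.mul_apply, hz, mul_zero]
  · simp only [Pi.mul_apply]
    rw [hp.apply_smul]
    by_cases hx : pS x ∈ U
    · rw [h.fiber_smul hp s hx]
      exact mul_assoc _ _ _
    · rw [hf0 hx, mul_zero, mul_zero, mul_zero]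
  · rw [Pi.mul_apply, hfy', mul_zero]
  · rw [mvfderiv_mul ((h.contMDiffAt_fiber hp hyU).mdifferentiableAt (by simp))
      (hfp.mdifferentiable (by simp) _)]
    have h1 : ((τ (σ y) : ScalingGroup κ) : ℝ) = 1 := by rw [h.fiber_section hp hy]; rfl
    rw [hfy', h1, one_smul, zero_smul, add_zero]
    refine (mvfderiv_comp_apply (σ y) (hf.mdifferentiable (by simp) _)
      (hp.contMDiff.mdifferentiable (by simp) _) v).trans ?_
    let df : C → EC →L[ℝ] ℝ := fun c => mvfderiv 𝓘(ℝ, EC) f c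
    have h2 : df (pS (σ y)) = l := (congrArg df hpy).trans hfl
    exact congrArg (fun f : EC →L[ℝ] ℝ => f (mfderiv 𝓘(ℝ, ES) 𝓘(ℝ, EC) pS (σ y) v)) h2

end Contact

section ContactForm

variable {ES EC S C : Type*} [NormedAddCommGroup ES] [NormedSpace ℝ ES] [FiniteDimensional ℝ ES]
  [NormedAddCommGroup EC] [NormedSpace ℝ EC] [FiniteDimensional ℝ EC]
  [TopologicalSpace S] [ChartedSpace ES S] [IsManifold 𝓘(ℝ, ES) ∞ S]
  [TopologicalSpace C] [ChartedSpace EC C] [IsManifold 𝓘(ℝ, EC) ∞ C] [T2Space C]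
  {κ : ScalingKind} [MulAction (ScalingGroup κ) S] {pS : S → C}
  {Ω : ∀ x : S, TangentSpace 𝓘(ℝ, ES) x →L[ℝ] TangentSpace 𝓘(ℝ, ES) x →L[ℝ] ℝ}
  {U : Set C} {σ : C → S} {τ : S → ScalingGroup κ}

/-- A functional which vanishes on the generator does not distinguish a vector at a point of a
section from the tangent vector to the section with the same projection. -/
theorem IsLocalSection.apply_mfderiv_section
    (h : IsLocalSection (ES := ES) (EC := EC) pS U σ τ)
    (hp : IsPrincipalBundle (EG := ℝ) (EM := ES) (EK := EC) (ScalingGroup κ) pS) {y : C}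
    (hy : y ∈ U) (ζ : TangentSpace 𝓘(ℝ, ES) (σ y) →L[ℝ] ℝ) (hζ : ζ (scalingGenerator κ (σ y)) = 0)
    (v : TangentSpace 𝓘(ℝ, ES) (σ y)) {w : TangentSpace 𝓘(ℝ, EC) y}
    (hw : (w : EC) = mfderiv 𝓘(ℝ, ES) 𝓘(ℝ, EC) pS (σ y) v) :
    ζ (mfderiv 𝓘(ℝ, EC) 𝓘(ℝ, ES) σ y w) = ζ v := by
  have hpy := h.apply_section y hy
  obtain ⟨t, ht⟩ := h.exists_tangent_decomposition hp (x := σ y) (by rw [hpy]; exact hy) v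
  let ζ' : ES →L[ℝ] ℝ := ζ
  let Q : C → EC →L[ℝ] ES := fun c => mfderiv 𝓘(ℝ, EC) 𝓘(ℝ, ES) σ c
  let R : (S → S) → ES →L[ℝ] ES := fun f => mfderiv 𝓘(ℝ, ES) 𝓘(ℝ, ES) f (σ (pS (σ y)))
  have hQ : Q (pS (σ y)) = Q y := congrArg Q hpy
  -- On the section the scaling coordinate is 1, so the translation in the decomposition is trivial.
  have hR : R (fun z : S => τ (σ y) • z) = ContinuousLinearMap.id ℝ ES := by
    have : (fun z : S => τ (σ y) • z) = id := funext fun z => by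
      rw [h.fiber_section hp hy]
      exact one_smul _ z
    rw [this]
    exact mfderiv_id
  have hlin : ∀ a b : ES, ζ' a = 0 → ζ' (t • a + b) = ζ' b := by
    intro a b ha
    rw [map_add, map_smul, ha, smul_zero, zero_add]
  have h1 := (congrArg ζ' ht).trans (hlin _ _ hζ)
  refine Eq.trans ?_ h1.symm
  let P : ES →L[ℝ] EC := mfderiv 𝓘(ℝ, ES) 𝓘(ℝ, EC) pS (σ y)
  change ζ' (Q y w) = ζ' (R (fun z : S => τ (σ y) • z) (Q (pS (σ y)) (P v)))
  rw [hR, hQ]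
  exact congrArg (fun b : EC => ζ' (Q y b)) hw

/-- The pull-back of the Liouville form along a section is a contact form. -/
theorem isContactFormAt_sectionForm (hΩ : IsSymplectic Ω)
    (h : IsLocalSection (ES := ES) (EC := EC) pS U σ τ)
    (hp : IsPrincipalBundle (EG := ℝ) (EM := ES) (EK := EC) (ScalingGroup κ) pS)
    (hform : IsHomogeneousForm (fun (s : ScalingGroup κ) (x : S) => s • x)
      (fun s : ScalingGroup κ => (s : ℝ)) Ω) {y : C} (hy : y ∈ U) :
    IsContactFormAt (sectionForm κ Ω σ : ∀ y, TangentSpace 𝓘(ℝ, EC) y →L[ℝ] ℝ) y := by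
  have := hp.contMDiffSMul
  have hpy := h.apply_section y hy
  let N : C → EC →L[ℝ] ℝ := fun z => sectionForm κ Ω σ z
  have hN1 : ∀ z ∈ U, ∀ v : TangentSpace 𝓘(ℝ, ES) (σ z),
      liouvilleForm κ Ω (σ z) v = N z (mfderiv 𝓘(ℝ, ES) 𝓘(ℝ, EC) pS (σ z) v) := by
    intro z hz v
    have hpz := h.apply_section z hz
    have h1 := liouvilleForm_eq_sectionForm hΩ h hp hform (x := σ z) (by rw [hpz]; exact hz) v
    rw [h.fiber_section hp hz] at h1
    refine (h1.trans (one_mul _)).trans ?_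
    exact congrArg (fun c => N c (mfderiv 𝓘(ℝ, ES) 𝓘(ℝ, EC) pS (σ z) v)) hpz
  refine ⟨fun h0 => ?_, fun X hX hX0 hXY => ?_⟩
  · obtain ⟨v, hv⟩ := liouvilleForm_ne_zero hΩ hp (σ y)
    refine hv ((hN1 y hy v).trans ?_)
    exact congrArg (fun f : EC →L[ℝ] ℝ => f _) h0
  let x₀ := σ y
  let v₀ : TangentSpace 𝓘(ℝ, ES) x₀ := mfderiv 𝓘(ℝ, EC) 𝓘(ℝ, ES) σ y (X y)
  have hv₀ : (mfderiv 𝓘(ℝ, ES) 𝓘(ℝ, EC) pS x₀ v₀ : EC) = X y := h.mfderiv_section hy _ hp.contMDiff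
  have hpr := hp.isScaledFibration
  -- the projected Hamiltonian vector fields
  have hproj : ∀ F ∈ homogeneousFunctions (ES := ES) (fun (s : ScalingGroup κ) (x : S) => s • x)
      (fun s : ScalingGroup κ => (s : ℝ)), F x₀ = 0 →
      ∃ Z : ∀ c : C, TangentSpace 𝓘(ℝ, EC) c, SmoothVectorField Z ∧
        (∀ x, mfderiv 𝓘(ℝ, ES) 𝓘(ℝ, EC) pS x (hamiltonianVectorField Ω F x) = Z (pS x)) ∧
        ((Z y : EC) = mfderiv 𝓘(ℝ, ES) 𝓘(ℝ, EC) pS x₀ (hamiltonianVectorField Ω F x₀)) ∧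
        sectionForm κ Ω σ y (Z y) = 0 ∧
        ∀ (v : TangentSpace 𝓘(ℝ, ES) x₀) (w : TangentSpace 𝓘(ℝ, EC) y),
          (w : EC) = mfderiv 𝓘(ℝ, ES) 𝓘(ℝ, EC) pS x₀ v →
          mvfderiv 𝓘(ℝ, EC) (fun z => sectionForm κ Ω σ z (Z z)) y w =
            mvfderiv 𝓘(ℝ, ES) F x₀ v := by
    intro F hF hF0
    obtain ⟨Z, hZ, hFZ⟩ := exists_projected_hamiltonianVectorField hΩ hform hpr hF
    -- Euler's identity λ(X_F) = F, read along the section.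
    have hval : ∀ z ∈ U, sectionForm κ Ω σ z (Z z) = F (σ z) := by
      intro z hz
      have h1 := hN1 z hz (hamiltonianVectorField Ω F (σ z))
      rw [liouvilleForm_hamiltonianVectorField hΩ (hF.1.mdifferentiable (by simp) _) hF.2] at h1
      let Z' : C → EC := Z
      have h2 : (mfderiv 𝓘(ℝ, ES) 𝓘(ℝ, EC) pS (σ z) (hamiltonianVectorField Ω F (σ z)) : EC) =
        Z' z := (hFZ (σ z)).trans (congrArg Z' (h.apply_section z hz))
      exact (h1.trans (congrArg (N z) h2)).symm
    refine ⟨Z, hZ, hFZ, ?_, (hval y hy).trans hF0, fun v w hvw => ?_⟩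
    · let Z' : C → EC := Z
      exact ((hFZ x₀).trans (congrArg Z' hpy)).symm
    · have heq : (fun z => sectionForm κ Ω σ z (Z z)) =ᶠ[𝓝 y] F ∘ σ := by
        filter_upwards [h.isOpen.mem_nhds hy] with z hz
        exact hval z hz
      have h1 : mvfderiv 𝓘(ℝ, EC) (fun z => sectionForm κ Ω σ z (Z z)) y w =
          mvfderiv 𝓘(ℝ, EC) (F ∘ σ) y w :=
        congrArg (fun f : EC →L[ℝ] ℝ => f w) heq.mfderiv_eq
      rw [h1, mvfderiv_comp_apply y (hF.1.mdifferentiable (by simp) _)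
        ((h.contMDiffAt_section hy).mdifferentiableAt (by simp))]
      refine h.apply_mfderiv_section hp hy (mvfderiv 𝓘(ℝ, ES) F x₀) ?_ v hvw
      rw [mvfderiv_scalingGenerator (hF.1.mdifferentiable (by simp) _) fun t => hF.2 _ _]
      exact hF0
  -- a homogeneous function with prescribed projected Hamiltonian vector
  obtain ⟨G, hG, hG0, hdG⟩ := h.exists_homogeneous_mvfderiv_eq hp hy
    (((Ω x₀ v₀).comp (mfderiv 𝓘(ℝ, EC) 𝓘(ℝ, ES) σ y) :
      TangentSpace 𝓘(ℝ, EC) y →L[ℝ] ℝ) : EC →L[ℝ] ℝ)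
  -- This is η(X) = 0. It makes Ω(v₀, ·) recoverable from its restriction to the section, so X_G
  -- equals v₀ exactly and not just modulo Δ.
  have hΔ : Ω x₀ v₀ (scalingGenerator κ x₀) = 0 := by
    rw [hΩ.swap, ← liouvilleForm_apply]
    exact hX0
  have hGv : hamiltonianVectorField Ω G x₀ = v₀ := by
    refine hΩ.eq_of_apply_eq fun u => ?_
    rw [hΩ.apply_hamiltonianVectorField, hdG]
    exact h.apply_mfderiv_section hp hy (Ω x₀ v₀) hΔ u rfl
  obtain ⟨Y, hY, hGY, hYy, hY0, hdY⟩ := hproj G hG hG0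
  have hXY' : X y = Y y := by
    refine Eq.trans ?_ hYy.symm
    rw [hGv]
    exact hv₀.symm
  -- For each l, an F with differential l ∘ TpS at σ y turns l(X y) into a Poisson bracket with G.
  refine (SeparatingDual.eq_zero_of_forall_dual_eq_zero (R := ℝ) (V := EC) fun l => ?_ :
    (X y : EC) = 0)
  obtain ⟨F, hF, hF0, hdF⟩ := h.exists_homogeneous_mvfderiv_eq hp hy l
  obtain ⟨Z, hZ, hFZ, hZy, hZ0, hdZ⟩ := hproj F hF hF0
  have hη := contMDiffAt_sectionForm (κ := κ) hΩ (h.contMDiffAt_section hy)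
  have hd := hXY Z hZ hZ0
  rw [extDerivOne_congr_left hη hX hY hZ hXY'] at hd
  have hlY : poissonBracket Ω G F x₀ = l (X y) := by
    rw [poissonBracket, hGv, hdF]
    exact congrArg l hv₀
  have hGF := poissonBracket_mem hΩ hform hpr hG hF
  have hbr : sectionForm κ Ω σ y (VectorField.mlieBracket 𝓘(ℝ, EC) Y Z y) =
      poissonBracket Ω G F x₀ := by
    let V : C → EC := fun c => VectorField.mlieBracket 𝓘(ℝ, EC) Y Z c
    have h1 : (mfderiv 𝓘(ℝ, ES) 𝓘(ℝ, EC) pS x₀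
        (hamiltonianVectorField Ω (poissonBracket Ω G F) x₀) : EC) = V y :=
      (mfderiv_hamiltonianVectorField_poissonBracket hΩ hp.contMDiff hG.1 hF.1 hY hZ hGY hFZ
        x₀).trans (congrArg V hpy)
    rw [← liouvilleForm_hamiltonianVectorField hΩ (hGF.1.mdifferentiable (by simp) x₀) hGF.2]
    exact (congrArg (N y) h1).symm.trans (hN1 y hy _).symm
  -- The three terms are {G,F} - {F,G} - {G,F}, which is {G,F}.
  rw [extDerivOne, hbr, hdZ _ _ hYy, hdY _ _ hZy] at hd
  change poissonBracket Ω G F x₀ - poissonBracket Ω F G x₀ - _ = 0 at hd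
  rw [poissonBracket_swap hΩ F G] at hd
  rw [← hlY]
  linarith

/-- The projected distribution is a contact structure. -/
theorem isContactStructure_projectedDistribution (hΩ : IsSymplectic Ω)
    (hp : IsPrincipalBundle (EG := ℝ) (EM := ES) (EK := EC) (ScalingGroup κ) pS)
    (hform : IsHomogeneousForm (fun (s : ScalingGroup κ) (x : S) => s • x)
      (fun s : ScalingGroup κ => (s : ℝ)) Ω) :
    IsContactStructure (E := EC) (projectedDistribution κ Ω pS) := by
  have := hp.contMDiffSMul
  intro c
  obtain ⟨U, σ, τ, h, hc⟩ := hp.exists_isLocalSection c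
  refine ⟨U, sectionForm κ Ω σ, h.isOpen, hc, fun y hy =>
    (contMDiffAt_sectionForm (κ := κ) hΩ (h.contMDiffAt_section hy)).contMDiffWithinAt,
    fun y hy => ⟨isContactFormAt_sectionForm hΩ h hp hform hy, fun v => ?_⟩⟩
  have hpy := h.apply_section y hy
  have key : ∀ {c c' : C} (_ : c = c') (w : EC),
      (w : TangentSpace 𝓘(ℝ, EC) c) ∈ projectedDistribution κ Ω pS c ↔
      (w : TangentSpace 𝓘(ℝ, EC) c') ∈ projectedDistribution κ Ω pS c' := by
    rintro c _ rfl w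
    rfl
  have hv := h.mfderiv_section hy v hp.contMDiff
  refine (key hpy v).symm.trans ?_
  have h1 := mem_projectedDistribution_iff hΩ hp hform (σ y) (mfderiv 𝓘(ℝ, EC) 𝓘(ℝ, ES) σ y v)
  exact (Eq.to_iff (congrArg (fun w : EC => (w : TangentSpace 𝓘(ℝ, EC) (pS (σ y))) ∈
    projectedDistribution κ Ω pS (pS (σ y))) hv.symm)).trans h1

end ContactForm

/-! ### The group action on the line bundle. -/

section FrameAction

variable {ES EK EG S K J G : Type*} [NormedAddCommGroup ES] [NormedSpace ℝ ES]
  [NormedAddCommGroup EK] [NormedSpace ℝ EK] [NormedAddCommGroup EG] [NormedSpace ℝ EG]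
  [TopologicalSpace S] [ChartedSpace ES S] [TopologicalSpace K] [ChartedSpace EK K]
  [Group G] [MulAction G S]
  {act : J → S → S} {χ : J → ℝ} {pr : S → K}
  {L : K → Type*} [∀ k, AddCommGroup (L k)] [∀ k, Module ℝ (L k)]
  [∀ k, TopologicalSpace (L k)] {A : ∀ x : S, ℝ ≃L[ℝ] L (pr x)}

/-- Transformations which commute with the scalings act on the line bundle. -/
theorem IsHomogeneousFrame.exists_mulAction (hA : IsHomogeneousFrame act χ pr A)
    (hpr : IsScaledFibration (ES := ES) (EK := EK) act χ pr)
    (hcomm : ∀ (g : G) (j : J) (x : S), g • act j x = act j (g • x)) :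
    ∃ _ : MulAction G (TotalSpace ℝ L), ∀ (g : G) (x : S) (t : ℝ),
      g • (TotalSpace.mk' ℝ (pr x) (A x t) : TotalSpace ℝ L) =
        TotalSpace.mk' ℝ (pr (g • x)) (A (g • x) t) := by
  -- Two coordinates (x, t) of one vector are related by some act j, which commutes with g.
  have hwell : ∀ (g : G) {x y : S} {t t' : ℝ},
      (TotalSpace.mk' ℝ (pr x) (A x t) : TotalSpace ℝ L) = TotalSpace.mk' ℝ (pr y) (A y t') →
      (TotalSpace.mk' ℝ (pr (g • x)) (A (g • x) t) : TotalSpace ℝ L) =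
        TotalSpace.mk' ℝ (pr (g • y)) (A (g • y) t') := by
    intro g x y t t' h
    obtain ⟨j, rfl⟩ := (hpr.eq_iff x y).1 (congrArg TotalSpace.proj h)
    rw [hA j x t'] at h
    rw [frame_mk_inj h, hcomm, hA]
  choose x t hxt using exists_frame_coordinate hpr.surjective A
  have hsmul : ∀ (g : G) (y : S) (t' : ℝ),
      (TotalSpace.mk' ℝ (pr (g • x (TotalSpace.mk' ℝ (pr y) (A y t'))))
        (A (g • x (TotalSpace.mk' ℝ (pr y) (A y t'))) (t (TotalSpace.mk' ℝ (pr y) (A y t')))) :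
        TotalSpace ℝ L) = TotalSpace.mk' ℝ (pr (g • y)) (A (g • y) t') :=
    fun g y t' => hwell g (hxt _).symm
  let inst : MulAction G (TotalSpace ℝ L) :=
    { smul := fun g z => TotalSpace.mk' ℝ (pr (g • x z)) (A (g • x z) (t z))
      one_smul := fun z => by
        change TotalSpace.mk' ℝ (pr ((1 : G) • x z)) (A ((1 : G) • x z) (t z)) = z
        rw [one_smul, ← hxt]
      mul_smul := fun g g' z => by
        change TotalSpace.mk' ℝ (pr ((g * g') • x z)) (A ((g * g') • x z) (t z)) = _
        rw [mul_smul]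
        exact (hsmul g (g' • x z) (t z)).symm }
  exact ⟨inst, hsmul⟩

variable [MulAction G (TotalSpace ℝ L)]

/-- The action of `G` on the total space is induced by the action on the base of the frame. -/
def IsFrameAction (G : Type*) [Group G] [MulAction G S] [MulAction G (TotalSpace ℝ L)]
    (pr : S → K) (A : ∀ x : S, ℝ ≃L[ℝ] L (pr x)) : Prop :=
  ∀ (g : G) (x : S) (t : ℝ), g • (TotalSpace.mk' ℝ (pr x) (A x t) : TotalSpace ℝ L) =
    TotalSpace.mk' ℝ (pr (g • x)) (A (g • x) t)

section Smooth

variable [TopologicalSpace (TotalSpace ℝ L)] [FiberBundle ℝ L] [VectorBundle ℝ ℝ L]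

theorem IsFrameAction.contMDiffSMul [ContMDiffVectorBundle ∞ ℝ L 𝓘(ℝ, EK)]
    [TopologicalSpace G] [ChartedSpace EG G] [ContMDiffSMul 𝓘(ℝ, EG) 𝓘(ℝ, ES) ∞ G S]
    (hG : IsFrameAction G pr A)
    (hpr : IsScaledFibration (ES := ES) (EK := EK) act χ pr)
    (hAsm : ContMDiff 𝓘(ℝ, ES) (𝓘(ℝ, EK).prod 𝓘(ℝ, ℝ)) ∞
      (fun x => (TotalSpace.mk' ℝ (pr x) (A x 1) : TotalSpace ℝ L))) :
    ContMDiffSMul 𝓘(ℝ, EG) (𝓘(ℝ, EK).prod 𝓘(ℝ, ℝ)) ∞ G (TotalSpace ℝ L) := by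
  refine ⟨fun p => ?_⟩
  obtain ⟨t, s, ht, hs, hz⟩ := hpr.exists_local_lift hAsm p.2
  have ht' : ContMDiffAt (𝓘(ℝ, EG).prod (𝓘(ℝ, EK).prod 𝓘(ℝ, ℝ))) 𝓘(ℝ, ℝ) ∞
      (fun q : G × TotalSpace ℝ L => t q.2) p := ht.comp p contMDiffAt_snd
  have hs' : ContMDiffAt (𝓘(ℝ, EG).prod (𝓘(ℝ, EK).prod 𝓘(ℝ, ℝ))) 𝓘(ℝ, ES) ∞
      (fun q : G × TotalSpace ℝ L => q.1 • s q.2) p :=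
    ContMDiffAt.comp p (ContMDiffSMul.contMDiff_smul (I := 𝓘(ℝ, EG)) (I' := 𝓘(ℝ, ES)) (n := ∞)
      (G := G) (M := S) (p.1, s p.2)) (contMDiffAt_fst.prodMk (hs.comp p contMDiffAt_snd))
  have h := (contMDiff_frame hAsm (t p.2, p.1 • s p.2)).comp p (ht'.prodMk hs')
  refine h.congr_of_eventuallyEq ?_
  filter_upwards [continuousAt_snd.eventually hz] with q hq
  refine (congrArg (fun z : TotalSpace ℝ L => q.1 • z) hq).trans ?_
  exact hG q.1 (s q.2) (t q.2)

/-- Frames go to frames and span the fibres, so equivariance becomes invariance of the associated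
function on S. -/
theorem IsFrameAction.isEquivariant_iff (hG : IsFrameAction G pr A)
    (hpr : Function.Surjective pr) {h : DualSection EK L} :
    h.IsEquivariant G ↔ ∀ (g : G) (x : S), (h (pr (g • x)) (A (g • x) 1) : ℝ) = h (pr x) (A x 1) := by
  have hval : ∀ (g : G) (x : S) (t : ℝ), (h (g • (TotalSpace.mk' ℝ (pr x) (A x t) :
      TotalSpace ℝ L)).proj (g • (TotalSpace.mk' ℝ (pr x) (A x t) : TotalSpace ℝ L)).snd : ℝ) =
      h (pr (g • x)) (A (g • x) t) := fun g x t =>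
    congrArg (fun z : TotalSpace ℝ L => (h z.proj z.snd : ℝ)) (hG g x t)
  have hlin : ∀ (x : S) (t : ℝ), (h (pr x) (A x t) : ℝ) = t * h (pr x) (A x 1) := fun x t => by
    have ht : A x t = t • A x 1 := by rw [← map_smul, smul_eq_mul, mul_one]
    rw [ht]
    exact (h (pr x)).map_smul t (A x 1)
  constructor
  · intro hh g x
    exact (hval g x 1).symm.trans (hh g (TotalSpace.mk' ℝ (pr x) (A x 1)))
  · intro hh g z
    obtain ⟨x, t, rfl⟩ := exists_frame_coordinate hpr A z
    refine (hval g x t).trans ?_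
    rw [hlin, hh g x, ← hlin]

end Smooth

end FrameAction

/-! ### Linear structure on fibres that are bare sets. -/

section FiberStructure

variable {ES EB S B J : Type*} [NormedAddCommGroup ES] [NormedSpace ℝ ES]
  [NormedAddCommGroup EB] [NormedSpace ℝ EB]
  [TopologicalSpace S] [ChartedSpace ES S] [TopologicalSpace B] [ChartedSpace EB B]
  {act : J → S → S} {χ : J → ℝ} {pr : S → B} {L : B → Type*}

/-- Transport of structure; needed because a fibre of the orbit space is only a set of orbits. -/
theorem exists_continuousLinearEquiv_of_equiv {V : Type*} (e : ℝ ≃ V) :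
    ∃ (_ : AddCommGroup V) (_ : Module ℝ V) (_ : TopologicalSpace V) (e' : ℝ ≃L[ℝ] V),
      ∀ t, e' t = e t := by
  let i₁ : AddCommGroup V := e.symm.addCommGroup
  let i₂ : Module ℝ V := e.symm.module ℝ
  let i₃ : TopologicalSpace V := TopologicalSpace.induced e.symm inferInstance
  refine ⟨i₁, i₂, i₃, ⟨(e.symm.linearEquiv ℝ).symm, ?_, ?_⟩, fun t => rfl⟩
  · refine continuous_induced_rng.2 ?_
    have : e.symm ∘ e = id := funext fun t => e.symm_apply_apply t
    change Continuous (e.symm ∘ e)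
    rw [this]
    exact continuous_id
  · exact continuous_induced_dom

/-- Homogeneous bijections from the real line to the fibres make the fibres real lines. -/
theorem IsScaledFibration.exists_homogeneousFrame
    (hpr : IsScaledFibration (ES := ES) (EK := EB) act χ pr) {o : ∀ x : S, ℝ → L (pr x)}
    (ho : ∀ x, Function.Bijective (o x))
    (hact : ∀ j x t, (TotalSpace.mk' ℝ (pr (act j x)) (o (act j x) t) : TotalSpace ℝ L) =
      TotalSpace.mk' ℝ (pr x) (o x (χ j * t))) :
    ∃ (_ : ∀ b, AddCommGroup (L b)) (_ : ∀ b, Module ℝ (L b)) (_ : ∀ b, TopologicalSpace (L b))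
      (A : ∀ x, ℝ ≃L[ℝ] L (pr x)), (∀ x t, A x t = o x t) ∧ IsHomogeneousFrame act χ pr A := by
  -- One point per fibre defines the structure; the maps from the other points differ by
  -- multiplication by some χ j, hence are linear as well.
  have hex : ∀ b, ∃ (x : S) (e : ℝ ≃ L b), ∀ t,
      (TotalSpace.mk' ℝ b (e t) : TotalSpace ℝ L) = TotalSpace.mk' ℝ (pr x) (o x t) := by
    intro b
    obtain ⟨x, rfl⟩ := hpr.surjective b
    exact ⟨x, Equiv.ofBijective (o x) (ho x), fun t => rfl⟩
  choose x e he using hex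
  choose i₁ i₂ i₃ e' he' using fun b => exists_continuousLinearEquiv_of_equiv (e b)
  have hA : ∀ y, ∃ A : ℝ ≃L[ℝ] L (pr y), ∀ t, A t = o y t := by
    intro y
    have hxy : pr (x (pr y)) = pr y := (congrArg TotalSpace.proj (he (pr y) 0)).symm
    obtain ⟨j, hj⟩ := (hpr.eq_iff _ _).1 hxy
    refine ⟨(ContinuousLinearEquiv.smulLeft (Units.mk0 (χ j) (hpr.ne_zero j))).trans (e' (pr y)),
      fun t => ?_⟩
    have h1 := hact j (x (pr y)) t
    rw [hj, ← he] at h1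
    rw [TotalSpace.mk_injective (F := ℝ) (pr y) h1, ← he']
    rfl
  choose A hAo using hA
  refine ⟨i₁, i₂, i₃, A, hAo, fun j y t => ?_⟩
  rw [hAo, hAo]
  exact hact j y t

end FiberStructure

/-! ### Comparison with the cotangent lift. -/

section CotangentLift

variable {ES EC S C G : Type*} [NormedAddCommGroup ES] [NormedSpace ℝ ES] [FiniteDimensional ℝ ES]
  [NormedAddCommGroup EC] [NormedSpace ℝ EC] [FiniteDimensional ℝ EC]
  [TopologicalSpace S] [ChartedSpace ES S] [IsManifold 𝓘(ℝ, ES) ∞ S]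
  [TopologicalSpace C] [ChartedSpace EC C] [IsManifold 𝓘(ℝ, EC) ∞ C]
  {κ : ScalingKind} [MulAction (ScalingGroup κ) S] {pS : S → C}
  {Ω : ∀ x : S, TangentSpace 𝓘(ℝ, ES) x →L[ℝ] TangentSpace 𝓘(ℝ, ES) x →L[ℝ] ℝ}
  {A : ∀ x, ℝ ≃L[ℝ] annihilator (E := EC) (projectedDistribution κ Ω pS) (pS x)}
  [Group G] [MulAction G S] [MulAction G C]

/-- Surjectivity in finite dimension makes `inverse` a true inverse. -/
theorem comp_inverse_eq_of_surjective {V : Type*} [NormedAddCommGroup V] [NormedSpace ℝ V]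
    [FiniteDimensional ℝ V] {f : V →L[ℝ] V} (hf : Function.Surjective f) {α β : V →L[ℝ] ℝ}
    (h : ∀ v, β (f v) = α v) : β = α.comp f.inverse := by
  have hinj : Function.Injective f.toLinearMap := LinearMap.injective_iff_surjective.2 hf
  let e : V ≃L[ℝ] V := (LinearEquiv.ofBijective f.toLinearMap ⟨hinj, hf⟩).toContinuousLinearEquiv
  have he : (e : V →L[ℝ] V) = f := by
    ext v
    rfl
  rw [← he, ContinuousLinearMap.inverse_equiv]
  ext w
  obtain ⟨v, rfl⟩ := hf w
  rw [h]
  exact congrArg α (e.symm_apply_apply v).symm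

/-- Elements of G preserve Ω and commute with scalings, so they preserve λ. Since pS is equivariant,
the covector at g • x composed with the derivative of g on C is the covector at x. -/
theorem IsLiouvilleFrame.exists_cotangentLift (hA : IsLiouvilleFrame Ω pS A)
    [MulAction G (TotalSpace ℝ fun c => annihilator (E := EC) (projectedDistribution κ Ω pS) c)]
    (hG : IsFrameAction (L := fun c => annihilator (E := EC) (projectedDistribution κ Ω pS) c)
      G pS A) (hΩ : IsSymplectic Ω)
    (hp : IsPrincipalBundle (EG := ℝ) (EM := ES) (EK := EC) (ScalingGroup κ) pS)
    (hGS : ∀ g : G, ContMDiff 𝓘(ℝ, ES) 𝓘(ℝ, ES) ∞ (fun x : S => g • x))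
    (hGC : ∀ g : G, ContMDiff 𝓘(ℝ, EC) 𝓘(ℝ, EC) ∞ (fun c : C => g • c))
    (hGΩ : IsHomogeneousForm (fun (g : G) (x : S) => g • x) (fun _ : G => (1 : ℝ)) Ω)
    (hcomm : ∀ (g : G) (s : ScalingGroup κ) (x : S), g • s • x = s • g • x)
    (hequiv : ∀ (g : G) (x : S), pS (g • x) = g • pS x) (g : G) (c : C) :
    ∃ T : annihilator (E := EC) (projectedDistribution κ Ω pS) c ≃ₗ[ℝ]
        annihilator (E := EC) (projectedDistribution κ Ω pS) (g • c),
      ∀ α : annihilator (E := EC) (projectedDistribution κ Ω pS) c,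
        (T α).1 = cotangentLift g c α.1 ∧
        g • (TotalSpace.mk' ℝ c α :
          TotalSpace ℝ fun c => annihilator (E := EC) (projectedDistribution κ Ω pS) c) =
          TotalSpace.mk' ℝ (g • c) (T α) := by
  have := hp.contMDiffSMul
  obtain ⟨x, rfl⟩ := hp.surjective c
  obtain ⟨e, he⟩ := exists_frame_eq
    (L := fun c => annihilator (E := EC) (projectedDistribution κ Ω pS) c) A (hequiv g x)
  refine ⟨(A x).symm.toLinearEquiv.trans e.toLinearEquiv, fun α => ?_⟩
  obtain ⟨t, rfl⟩ := (A x).surjective α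
  have hT : ((A x).symm.toLinearEquiv.trans e.toLinearEquiv) (A x t) = e t :=
    congrArg e ((A x).symm_apply_apply t)
  rw [hT]
  refine ⟨?_, (hG g x t).trans (he t).symm⟩
  let P : S → ES →L[ℝ] EC := fun y => mfderiv 𝓘(ℝ, ES) 𝓘(ℝ, EC) pS y
  let R : ES →L[ℝ] ES := mfderiv 𝓘(ℝ, ES) 𝓘(ℝ, ES) (fun y : S => g • y) x
  let R' : EC →L[ℝ] EC := mfderiv 𝓘(ℝ, EC) 𝓘(ℝ, EC) (fun c : C => g • c) (pS x)
  have hPR : ∀ v : ES, R' (P x v) = P (g • x) (R v) := by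
    intro v
    have h1 := mfderiv_comp_apply x ((hGC g).mdifferentiable (by simp) (pS x))
      (hp.contMDiff.mdifferentiable (by simp) x) v
    have h2 := mfderiv_comp_apply x (hp.contMDiff.mdifferentiable (by simp) (g • x))
      ((hGS g).mdifferentiable (by simp) x) v
    have h3 : (fun c : C => g • c) ∘ pS = pS ∘ fun y : S => g • y :=
      funext fun y => (hequiv g y).symm
    have h4 := congrArg (fun f : S → C => (mfderiv 𝓘(ℝ, ES) 𝓘(ℝ, EC) f x : ES →L[ℝ] EC) v) h3
    exact h1.symm.trans (h4.trans h2)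
  have hR : Function.Surjective R := hGΩ.surjective_mfderiv hΩ one_ne_zero x
  have hR' : Function.Surjective R' := by
    intro w
    obtain ⟨u, hu⟩ := hp.surjective_mfderiv (g • x) w
    obtain ⟨v, rfl⟩ := hR u
    exact ⟨P x v, (hPR v).trans hu⟩
  let β : EC →L[ℝ] ℝ := (e t).1
  let α : EC →L[ℝ] ℝ := (A x t).1
  have hβ : β = (A (g • x) t).1 := annihilator_eq_of_mk_eq (he t)
  refine (comp_inverse_eq_of_surjective (α := α) (β := β) hR' fun w => ?_)
  obtain ⟨v, rfl⟩ : ∃ v : ES, P x v = w := hp.surjective_mfderiv x w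
  rw [hPR, hβ]
  have h1 : liouvilleForm κ Ω (g • x) (R v) = 1 * liouvilleForm κ Ω x v :=
    liouvilleForm_map ((hGS g).mdifferentiable (by simp) x) (hcomm g · x) (hGΩ g x) v
  refine (hA (g • x) t (R v)).trans (Eq.trans ?_ (hA x t v).symm)
  rw [h1, one_mul]

end CotangentLift

/-! ### The orbit bundle and reduction. -/

section OrbitLineBundle

variable {ES EC EB S C B J JB G : Type*} [NormedAddCommGroup ES] [NormedSpace ℝ ES]
  [NormedAddCommGroup EC] [NormedSpace ℝ EC] [NormedAddCommGroup EB] [NormedSpace ℝ EB]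
  [TopologicalSpace S] [ChartedSpace ES S] [TopologicalSpace C] [ChartedSpace EC C]
  [TopologicalSpace B] [ChartedSpace EB B] [Group G] [MulAction G S] [MulAction G C]
  {pr : S → C} {q : C → B} {L : C → Type*} [∀ c, AddCommGroup (L c)] [∀ c, Module ℝ (L c)]
  [∀ c, TopologicalSpace (L c)] {A : ∀ x : S, ℝ ≃L[ℝ] L (pr x)} [MulAction G (TotalSpace ℝ L)]

theorem mk_orbitClass_eq {z z' : TotalSpace ℝ L} (h : q z.proj = q z'.proj)
    (hz : MulAction.orbitRel G (TotalSpace ℝ L) z z') :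
    (TotalSpace.mk' ℝ (q z.proj) (orbitClass G L q z) : TotalSpace ℝ (OrbitFiber G L q)) =
      TotalSpace.mk' ℝ (q z'.proj) (orbitClass G L q z') := by
  have key : ∀ {b b' : B} (o : OrbitFiber G L q b) (o' : OrbitFiber G L q b'), b = b' →
      o.1 = o'.1 → (TotalSpace.mk' ℝ b o : TotalSpace ℝ (OrbitFiber G L q)) =
        TotalSpace.mk' ℝ b' o' := by
    rintro b _ o o' rfl ho
    exact congrArg (TotalSpace.mk' ℝ b) (Subtype.ext ho)
  exact key _ _ h (Quotient.sound hz)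

/-- The map to the fibre of the orbit space given by a frame. -/
def orbitFrame (G : Type*) [Group G] [MulAction G (TotalSpace ℝ L)] (q : C → B)
    (A : ∀ x : S, ℝ ≃L[ℝ] L (pr x)) (x : S) (t : ℝ) : OrbitFiber G L q (q (pr x)) :=
  orbitClass G L q (TotalSpace.mk' ℝ (pr x) (A x t))

/-- Injective because G acts freely on the base, so an orbit meets each fibre at most once; onto
because G is transitive on the fibres of q. -/
theorem IsFrameAction.bijective_orbitFrame (hG : IsFrameAction G pr A)
    (hequiv : ∀ (g : G) (x : S), pr (g • x) = g • pr x)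
    (hq : ∀ c c' : C, q c = q c' ↔ ∃ g : G, g • c = c')
    (hfree : ∀ (g : G) (c : C), g • c = c → g = 1) (hpr : Function.Surjective pr) (x : S) :
    Function.Bijective (orbitFrame G q A x) := by
  have hproj : ∀ (g : G) (z : TotalSpace ℝ L), (g • z).proj = g • z.proj := by
    intro g z
    obtain ⟨y, t, rfl⟩ := exists_frame_coordinate hpr A z
    exact (congrArg TotalSpace.proj (hG g y t)).trans (hequiv g y)
  constructor
  · intro t t' h
    obtain ⟨g, hg⟩ : MulAction.orbitRel G (TotalSpace ℝ L) (TotalSpace.mk' ℝ (pr x) (A x t))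
        (TotalSpace.mk' ℝ (pr x) (A x t')) := Quotient.exact (congrArg Subtype.val h)
    have hg' : g • (TotalSpace.mk' ℝ (pr x) (A x t') : TotalSpace ℝ L) =
      TotalSpace.mk' ℝ (pr x) (A x t) := hg
    have h1 : g = 1 := hfree g (pr x) ((hproj g _).symm.trans (congrArg TotalSpace.proj hg'))
    rw [h1, one_smul] at hg'
    exact (frame_mk_inj hg').symm
  · rintro ⟨o, z, hz, hb⟩
    obtain ⟨g, hg⟩ := (hq z.proj (pr x)).1 hb
    obtain ⟨v, hv⟩ : ∃ v : L (pr x), g • z = TotalSpace.mk' ℝ (pr x) v := by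
      have h1 : (g • z).proj = pr x := (hproj g z).trans hg
      generalize g • z = z' at h1
      obtain ⟨c, v⟩ := z'
      obtain rfl : c = pr x := h1
      exact ⟨v, rfl⟩
    obtain ⟨t, rfl⟩ := (A x).surjective v
    refine ⟨t, Subtype.ext ?_⟩
    refine Eq.trans ?_ hz
    refine Quotient.sound ?_
    change MulAction.orbitRel G (TotalSpace ℝ L) _ z
    exact ⟨g, hv⟩

end OrbitLineBundle

section Reduction

variable {ES EC EB S C B J G : Type*} [NormedAddCommGroup ES] [NormedSpace ℝ ES]
  [NormedAddCommGroup EC] [NormedSpace ℝ EC] [NormedAddCommGroup EB] [NormedSpace ℝ EB]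
  [TopologicalSpace S] [ChartedSpace ES S] [TopologicalSpace C] [ChartedSpace EC C]
  [TopologicalSpace B] [ChartedSpace EB B] [Group G] [MulAction G S] [MulAction G C]
  {act : J → S → S} {χ : J → ℝ}
  {pr : S → C} {q : C → B} {L : C → Type*} [∀ c, AddCommGroup (L c)] [∀ c, Module ℝ (L c)]
  [∀ c, TopologicalSpace (L c)] {A : ∀ x : S, ℝ ≃L[ℝ] L (pr x)} [MulAction G (TotalSpace ℝ L)]

theorem IsFrameAction.orbitFrame_act (hG : IsFrameAction G pr A)
    (hA : IsHomogeneousFrame act χ pr A)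
    (hprB : IsScaledFibration (ES := ES) (EK := EB) (fun (j : J × G) (x : S) => act j.1 (j.2 • x))
      (fun j : J × G => χ j.1) (fun x => q (pr x))) (j : J × G) (x : S) (t : ℝ) :
    (TotalSpace.mk' ℝ (q (pr (act j.1 (j.2 • x)))) (orbitFrame G q A (act j.1 (j.2 • x)) t) :
      TotalSpace ℝ (OrbitFiber G L q)) =
      TotalSpace.mk' ℝ (q (pr x)) (orbitFrame G q A x (χ j.1 * t)) := by
  refine mk_orbitClass_eq (q := q)
    (z := TotalSpace.mk' ℝ (pr (act j.1 (j.2 • x))) (A (act j.1 (j.2 • x)) t))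
    (z' := TotalSpace.mk' ℝ (pr x) (A x (χ j.1 * t))) (hprB.pr_act j x) ?_
  rw [hA j.1 (j.2 • x) t, ← hG j.2 x]
  exact ⟨j.2, rfl⟩

section Structure

variable [TopologicalSpace (TotalSpace ℝ L)] [FiberBundle ℝ L] [VectorBundle ℝ ℝ L]
  [ContMDiffVectorBundle ∞ ℝ L 𝓘(ℝ, EC)]

/-- The orbit space of a line bundle with a frame action is a line bundle. -/
theorem IsFrameAction.exists_quotientLineBundle (hG : IsFrameAction G pr A)
    (hpr : IsScaledFibration (ES := ES) (EK := EC) act χ pr)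
    (hA : IsHomogeneousFrame act χ pr A)
    (hAsm : ContMDiff 𝓘(ℝ, ES) (𝓘(ℝ, EC).prod 𝓘(ℝ, ℝ)) ∞
      (fun x => (TotalSpace.mk' ℝ (pr x) (A x 1) : TotalSpace ℝ L)))
    (hprB : IsScaledFibration (ES := ES) (EK := EB) (fun (j : J × G) (x : S) => act j.1 (j.2 • x))
      (fun j : J × G => χ j.1) (fun x => q (pr x)))
    (hequiv : ∀ (g : G) (x : S), pr (g • x) = g • pr x)
    (hq : ∀ c c' : C, q c = q c' ↔ ∃ g : G, g • c = c')
    (hfree : ∀ (g : G) (c : C), g • c = c → g = 1) :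
    ∃ (_ : ∀ b, AddCommGroup (OrbitFiber G L q b)) (_ : ∀ b, Module ℝ (OrbitFiber G L q b))
      (_ : ∀ b, TopologicalSpace (OrbitFiber G L q b))
      (_ : TopologicalSpace (TotalSpace ℝ (OrbitFiber G L q)))
      (_ : FiberBundle ℝ (OrbitFiber G L q)) (_ : VectorBundle ℝ ℝ (OrbitFiber G L q))
      (_ : ContMDiffVectorBundle ∞ ℝ (OrbitFiber G L q) 𝓘(ℝ, EB)),
      IsQuotientLineBundle (EC := EC) (EB := EB) G L q ∧
      ∃ AB : ∀ x : S, ℝ ≃L[ℝ] OrbitFiber G L q (q (pr x)),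
        (∀ x t, AB x t = orbitFrame G q A x t) ∧
        IsHomogeneousFrame (fun (j : J × G) (x : S) => act j.1 (j.2 • x))
          (fun j : J × G => χ j.1) (fun x => q (pr x)) AB ∧
        ContMDiff 𝓘(ℝ, ES) (𝓘(ℝ, EB).prod 𝓘(ℝ, ℝ)) ∞
          (fun x => (TotalSpace.mk' ℝ (q (pr x)) (AB x 1) :
            TotalSpace ℝ (OrbitFiber G L q))) := by
  obtain ⟨i₁, i₂, i₃, AB, hAB, hABh⟩ := hprB.exists_homogeneousFrame (L := OrbitFiber G L q)
    (o := orbitFrame G q A) (hG.bijective_orbitFrame hequiv hq hfree hpr.surjective)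
    (hG.orbitFrame_act hA hprB)
  obtain ⟨i₄, i₅, i₆, i₇, hABsm⟩ := hprB.exists_lineBundle hABh
  refine ⟨i₁, i₂, i₃, i₄, i₅, i₆, i₇, ⟨fun z => ?_, fun c => ?_⟩, AB, hAB, hABh, hABsm⟩
  -- Locally the orbit map is a smooth lift to pairs (t, x) followed by the orbit frame.
  · obtain ⟨t, s, ht, hs, hz⟩ := hpr.exists_local_lift hAsm z
    have h := (contMDiff_frame (L := OrbitFiber G L q) hABsm (t z, s z)).comp z (ht.prodMk hs)
    refine h.congr_of_eventuallyEq ?_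
    filter_upwards [hz] with z' hz'
    refine (congrArg (fun y : TotalSpace ℝ L => (TotalSpace.mk' ℝ (q y.proj) (orbitClass G L q y) :
      TotalSpace ℝ (OrbitFiber G L q))) hz').trans ?_
    exact congrArg (TotalSpace.mk' ℝ (q (pr (s z')))) (hAB (s z') (t z')).symm
  · obtain ⟨x, rfl⟩ := hpr.surjective c
    refine ⟨(A x).symm.toLinearEquiv.trans (AB x).toLinearEquiv, fun v => ?_⟩
    obtain ⟨t, rfl⟩ := (A x).surjective v
    have h1 : ((A x).symm.toLinearEquiv.trans (AB x).toLinearEquiv) (A x t) = AB x t :=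
      congrArg (AB x) ((A x).symm_apply_apply t)
    rw [h1, hAB]
    rfl

end Structure

section Functions

/-- The bridge between the two levels, C and C/G: it matches equivariant sections with sections over
the quotient. -/
theorem mem_homogeneousFunctions_prod_iff
    (hpr : IsScaledFibration (ES := ES) (EK := EC) act χ pr) {F : S → ℝ} :
    F ∈ homogeneousFunctions (ES := ES) (fun (j : J × G) (x : S) => act j.1 (j.2 • x))
        (fun j : J × G => χ j.1) ↔
      F ∈ homogeneousFunctions (ES := ES) act χ ∧ ∀ (g : G) (x : S), F (g • x) = F x := by
  constructor
  · intro hF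
    have h1 : ∀ (j : J) (x : S), F (act j x) = χ j * F x := fun j x => by
      have h := hF.2 (j, 1) x
      dsimp only at h
      rwa [one_smul] at h
    refine ⟨⟨hF.1, h1⟩, fun g x => ?_⟩
    -- J is only an index type; reflexivity provides an index whose nonzero factor can be cancelled.
    obtain ⟨j, -⟩ := (hpr.eq_iff x x).1 rfl
    exact mul_left_cancel₀ (hpr.ne_zero j) ((h1 j (g • x)).symm.trans (hF.2 (j, g) x))
  · rintro ⟨hF, hinv⟩
    exact ⟨hF.1, fun j x => (hF.2 j.1 (j.2 • x)).trans (by rw [hinv])⟩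

end Functions

section Sections

variable [TopologicalSpace (TotalSpace ℝ L)] [FiberBundle ℝ L] [VectorBundle ℝ ℝ L]
  [ContMDiffVectorBundle ∞ ℝ L 𝓘(ℝ, EC)]
  {M : B → Type*} [∀ b, AddCommGroup (M b)] [∀ b, Module ℝ (M b)] [∀ b, TopologicalSpace (M b)]
  [TopologicalSpace (TotalSpace ℝ M)] [FiberBundle ℝ M] [VectorBundle ℝ ℝ M]
  [ContMDiffVectorBundle ∞ ℝ M 𝓘(ℝ, EB)] {AB : ∀ x : S, ℝ ≃L[ℝ] M (q (pr x))}

/-- Equivariant sections correspond to sections over the quotient. -/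
theorem exists_reductionEquiv (hG : IsFrameAction G pr A)
    (hpr : IsScaledFibration (ES := ES) (EK := EC) act χ pr)
    (hA : IsHomogeneousFrame act χ pr A)
    (hAsm : ContMDiff 𝓘(ℝ, ES) (𝓘(ℝ, EC).prod 𝓘(ℝ, ℝ)) ∞
      (fun x => (TotalSpace.mk' ℝ (pr x) (A x 1) : TotalSpace ℝ L)))
    (hprB : IsScaledFibration (ES := ES) (EK := EB) (fun (j : J × G) (x : S) => act j.1 (j.2 • x))
      (fun j : J × G => χ j.1) (fun x => q (pr x)))
    (hAB : IsHomogeneousFrame (fun (j : J × G) (x : S) => act j.1 (j.2 • x))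
      (fun j : J × G => χ j.1) (fun x => q (pr x)) AB)
    (hABsm : ContMDiff 𝓘(ℝ, ES) (𝓘(ℝ, EB).prod 𝓘(ℝ, ℝ)) ∞
      (fun x => (TotalSpace.mk' ℝ (q (pr x)) (AB x 1) : TotalSpace ℝ M))) :
    ∃ Θ : {h : DualSection EC L // h.IsEquivariant G} ≃ DualSection EB M,
      ∀ h x, (Θ h (q (pr x)) (AB x 1) : ℝ) = h.1 (pr x) (A x 1) := by
  let Ξ := dualSectionEquiv hpr hA hAsm
  let ΞB := dualSectionEquiv hprB hAB hABsm
  have hmem : ∀ h : DualSection EC L, h.IsEquivariant G ↔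
      (Ξ h).1 ∈ homogeneousFunctions (ES := ES) (fun (j : J × G) (x : S) => act j.1 (j.2 • x))
        (fun j : J × G => χ j.1) := fun h => by
    rw [mem_homogeneousFunctions_prod_iff hpr, hG.isEquivariant_iff hpr.surjective]
    exact ⟨fun h' => ⟨(Ξ h).2, h'⟩, fun h' => h'.2⟩
  refine ⟨⟨fun h => ΞB.symm ⟨(Ξ h.1).1, (hmem h.1).1 h.2⟩,
    fun k => ⟨Ξ.symm ⟨(ΞB k).1, ((mem_homogeneousFunctions_prod_iff hpr).1 (ΞB k).2).1⟩, ?_⟩,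
    fun h => ?_, fun k => ?_⟩, fun h x => ?_⟩
  · rw [hmem, Ξ.apply_symm_apply]
    exact (ΞB k).2
  · refine Subtype.ext (Ξ.injective (Subtype.ext ?_))
    dsimp only
    rw [Ξ.apply_symm_apply, ΞB.apply_symm_apply]
  · refine ΞB.injective (Subtype.ext ?_)
    dsimp only
    rw [ΞB.apply_symm_apply]
    exact congrArg (fun F : homogeneousFunctions (ES := ES) act χ => F.1) (Ξ.apply_symm_apply _)
  · exact congrFun (congrArg Subtype.val (ΞB.apply_symm_apply ⟨(Ξ h.1).1, (hmem h.1).1 h.2⟩)) x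

end Sections
end Reduction

section Symmetric

variable {ES EC EG S C G : Type*} [NormedAddCommGroup ES] [NormedSpace ℝ ES] [FiniteDimensional ℝ ES]
  [NormedAddCommGroup EC] [NormedSpace ℝ EC] [NormedAddCommGroup EG] [NormedSpace ℝ EG]
  [TopologicalSpace S] [ChartedSpace ES S] [IsManifold 𝓘(ℝ, ES) ∞ S]
  [TopologicalSpace C] [ChartedSpace EC C] [IsManifold 𝓘(ℝ, EC) ∞ C]
  {κ : ScalingKind} [MulAction (ScalingGroup κ) S]
  {Ω : ∀ x : S, TangentSpace 𝓘(ℝ, ES) x →L[ℝ] TangentSpace 𝓘(ℝ, ES) x →L[ℝ] ℝ}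
  [Group G] [MulAction G S]

theorem IsHomogeneousForm.prod
    (hs : ∀ s : ScalingGroup κ, ContMDiff 𝓘(ℝ, ES) 𝓘(ℝ, ES) ∞ (fun x : S => s • x))
    (hg : ∀ g : G, ContMDiff 𝓘(ℝ, ES) 𝓘(ℝ, ES) ∞ (fun x : S => g • x))
    (hform : IsHomogeneousForm (fun (s : ScalingGroup κ) (x : S) => s • x)
      (fun s : ScalingGroup κ => (s : ℝ)) Ω)
    (hformG : IsHomogeneousForm (fun (g : G) (x : S) => g • x) (fun _ : G => (1 : ℝ)) Ω) :
    IsHomogeneousForm (fun (j : ScalingGroup κ × G) (x : S) => j.1 • j.2 • x)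
      (fun j : ScalingGroup κ × G => (j.1 : ℝ)) Ω := by
  rintro ⟨s, g⟩ x v w
  have hcomp : ∀ u : TangentSpace 𝓘(ℝ, ES) x,
      mfderiv 𝓘(ℝ, ES) 𝓘(ℝ, ES) (fun y : S => s • g • y) x u =
        mfderiv 𝓘(ℝ, ES) 𝓘(ℝ, ES) (fun y : S => s • y) (g • x)
          (mfderiv 𝓘(ℝ, ES) 𝓘(ℝ, ES) (fun y : S => g • y) x u) := fun u =>
    mfderiv_comp_apply x ((hs s).mdifferentiable (by simp) (g • x))
      ((hg g).mdifferentiable (by simp) x) u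
  dsimp only
  rw [hcomp, hcomp]
  refine (hform s (g • x) _ _).trans ?_
  rw [hformG g x v w, one_mul]

end Symmetric

end

/-! ### The reduction theorem. -/

set_option maxHeartbeats 2000000 in
theorem mainTheorem4
    {ES EG EP EC EB S G P C B : Type*}
    [NormedAddCommGroup ES] [NormedSpace ℝ ES] [FiniteDimensional ℝ ES]
    [NormedAddCommGroup EG] [NormedSpace ℝ EG] [FiniteDimensional ℝ EG]
    [NormedAddCommGroup EP] [NormedSpace ℝ EP] [FiniteDimensional ℝ EP]
    [NormedAddCommGroup EC] [NormedSpace ℝ EC] [FiniteDimensional ℝ EC]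
    [NormedAddCommGroup EB] [NormedSpace ℝ EB] [FiniteDimensional ℝ EB]
    -- the symplectic Hamiltonian system
    [TopologicalSpace S] [ChartedSpace ES S] [IsManifold 𝓘(ℝ, ES) ∞ S]
    [T2Space S] [SecondCountableTopology S]
    (Ω : ∀ x : S, TangentSpace 𝓘(ℝ, ES) x →L[ℝ] TangentSpace 𝓘(ℝ, ES) x →L[ℝ] ℝ)
    (hΩ : IsSymplectic Ω)
    (H : S → ℝ) (hH : ContMDiff 𝓘(ℝ, ES) 𝓘(ℝ, ℝ) ∞ H)
    -- the scaling symmetry, with quotient `pS : S → C`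
    (κ : ScalingKind) [MulAction (ScalingGroup κ) S]
    [TopologicalSpace C] [ChartedSpace EC C] [IsManifold 𝓘(ℝ, EC) ∞ C]
    [T2Space C] [SecondCountableTopology C]
    (pS : S → C) (hscaling : IsScalingSymmetry (EC := EC) κ Ω H pS)
    -- the compatible symplectic `G`-symmetry, with quotient `qS : S → P`
    [Group G] [TopologicalSpace G] [ChartedSpace EG G] [LieGroup 𝓘(ℝ, EG) ∞ G]
    [MulAction G S]
    [TopologicalSpace P] [ChartedSpace EP P] [IsManifold 𝓘(ℝ, EP) ∞ P]
    [T2Space P] [SecondCountableTopology P]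
    (qS : S → P) (hsymm : IsSymplecticSymmetry (EG := EG) (EP := EP) G Ω H qS)
    (hcomm : ∀ (g : G) (s : ScalingGroup κ) (x : S), g • s • x = s • g • x)
    -- the induced `G`-action on `C`, which is principal, with quotient `qC : C → B`
    [MulAction G C] (hequiv : ∀ (g : G) (x : S), pS (g • x) = g • pS x)
    [TopologicalSpace B] [ChartedSpace EB B] [IsManifold 𝓘(ℝ, EB) ∞ B]
    [T2Space B] [SecondCountableTopology B]
    (qC : C → B) (hprincipal : IsPrincipalBundle (EG := EG) (EM := EC) (EK := EB) G qC) :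
    let lam : ∀ x : S, TangentSpace 𝓘(ℝ, ES) x →L[ℝ] ℝ := liouvilleForm κ Ω
    let D : ∀ c : C, Submodule ℝ (TangentSpace 𝓘(ℝ, EC) c) := projectedDistribution κ Ω pS
    let L : C → Type _ := fun c => annihilator D c
    -- the kernel of `λ` projects onto `D`, which is a contact structure
    (∀ (x : S) (v : TangentSpace 𝓘(ℝ, ES) x),
      mfderiv 𝓘(ℝ, ES) 𝓘(ℝ, EC) pS x v ∈ D (pS x) ↔ lam x v = 0) ∧
    IsContactStructure D ∧
    -- `L = D°` is a line bundle, a subbundle of the cotangent bundle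
    ∃ (_ : TopologicalSpace (TotalSpace ℝ L)) (_ : FiberBundle ℝ L) (_ : VectorBundle ℝ ℝ L)
      (_ : ContMDiffVectorBundle ∞ ℝ L 𝓘(ℝ, EC)),
    IsCotangentSubbundle D ∧
    -- `a` is the canonical map from `S` to `D°`
    ∃ a : ∀ x : S, L (pS x),
    (∀ (x : S) (v : TangentSpace 𝓘(ℝ, ES) x),
      (a x).1 (mfderiv 𝓘(ℝ, ES) 𝓘(ℝ, EC) pS x v) = lam x v) ∧
    -- sections of the dual of `D°` correspond to homogeneous functions on `S`
    (∀ h : DualSection EC L, ContMDiff 𝓘(ℝ, ES) 𝓘(ℝ, ℝ) ∞ (fun x => h (pS x) (a x)) ∧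
      ∀ (s : ScalingGroup κ) (x : S), h (pS (s • x)) (a (s • x)) = (s : ℝ) * h (pS x) (a x)) ∧
    (∀ F : S → ℝ, ContMDiff 𝓘(ℝ, ES) 𝓘(ℝ, ℝ) ∞ F →
      (∀ (s : ScalingGroup κ) (x : S), F (s • x) = (s : ℝ) * F x) →
      ∃! h : DualSection EC L, ∀ x, h (pS x) (a x) = F x) ∧
    -- the contact Kirillov bracket
    ∃ KC : KirillovStructure EC L,
    (∀ (h₁ h₂ : DualSection EC L) (x : S),
      poissonBracket Ω (fun y => h₁ (pS y) (a y)) (fun y => h₂ (pS y) (a y)) x =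
        -(KC.bracket h₁ h₂ (pS x) (a x))) ∧
    -- the representation of `G` on `D°` by cotangent lifts
    ∃ _ : MulAction G (TotalSpace ℝ L),
    ContMDiffSMul 𝓘(ℝ, EG) (𝓘(ℝ, EC).prod 𝓘(ℝ, ℝ)) ∞ G (TotalSpace ℝ L) ∧
    (∀ (g : G) (c : C), ∃ T : L c ≃ₗ[ℝ] L (g • c), ∀ α : L c,
      (T α).1 = cotangentLift g c α.1 ∧
      g • (TotalSpace.mk' ℝ c α : TotalSpace ℝ L) = TotalSpace.mk' ℝ (g • c) (T α)) ∧
    -- the representation is compatible with the Kirillov bracket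
    ∃ hcompat : ∀ h₁ h₂ : DualSection EC L, h₁.IsEquivariant G → h₂.IsEquivariant G →
      DualSection.IsEquivariant G (KC.bracket h₁ h₂),
    -- the orbit space `D°/G` is a line bundle over `B = C/G`
    ∃ (_ : ∀ b, AddCommGroup (OrbitFiber G L qC b)) (_ : ∀ b, Module ℝ (OrbitFiber G L qC b))
      (_ : ∀ b, TopologicalSpace (OrbitFiber G L qC b))
      (_ : TopologicalSpace (TotalSpace ℝ (OrbitFiber G L qC)))
      (_ : FiberBundle ℝ (OrbitFiber G L qC)) (_ : VectorBundle ℝ ℝ (OrbitFiber G L qC))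
      (_ : ContMDiffVectorBundle ∞ ℝ (OrbitFiber G L qC) 𝓘(ℝ, EB)),
    IsQuotientLineBundle (EC := EC) (EB := EB) G L qC ∧
    -- equivariant sections `h` correspond to sections `Θ h = h^G` of the dual of `D°/G`
    ∃ Θ : {h : DualSection EC L // h.IsEquivariant G} ≃ DualSection EB (OrbitFiber G L qC),
    (∀ h (z : TotalSpace ℝ L),
      Θ h (qC z.proj) (orbitClass G L qC z) = h.1 z.proj z.snd) ∧
    -- the reduced Kirillov bracket
    ∃ KB : KirillovStructure EB (OrbitFiber G L qC),
    (∀ h₁ h₂ : {h : DualSection EC L // h.IsEquivariant G},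
      KB.bracket (Θ h₁) (Θ h₂) = Θ ⟨KC.bracket h₁.1 h₂.1, hcompat _ _ h₁.2 h₂.2⟩) ∧
    -- the section `h_H` and the reduced dynamics
    ∃ hsec : {h : DualSection EC L // h.IsEquivariant G},
    (∀ x : S, hsec.1 (pS x) (a x) = H x) ∧
    (∀ x : S, mfderiv 𝓘(ℝ, ES) 𝓘(ℝ, EC) pS x (hamiltonianVectorField Ω H x) =
      KC.symbol hsec.1 (pS x)) ∧
    (∀ (g : G) (c : C), mfderiv 𝓘(ℝ, EC) 𝓘(ℝ, EC) (fun y => g • y) c (KC.symbol hsec.1 c) =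
      KC.symbol hsec.1 (g • c)) ∧
    (∀ c : C, mfderiv 𝓘(ℝ, EC) 𝓘(ℝ, EB) qC c (KC.symbol hsec.1 c) =
      KB.symbol (Θ hsec) (qC c)) ∧
    (∀ x : S, mfderiv 𝓘(ℝ, ES) 𝓘(ℝ, EB) (fun y => qC (pS y)) x (hamiltonianVectorField Ω H x) =
      KB.symbol (Θ hsec) (qC (pS x))) := by
  intro lam D L
  have hp := hscaling.principal
  have hSκ := hp.contMDiffSMul
  have hSG := hsymm.principal.contMDiffSMul
  have hgS := hsymm.principal.contMDiff_smul
  have hgC := hprincipal.contMDiff_smul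
  have hform : IsHomogeneousForm (fun (s : ScalingGroup κ) (x : S) => s • x)
    (fun s : ScalingGroup κ => (s : ℝ)) Ω := hscaling.form
  have hformG : IsHomogeneousForm (fun (g : G) (x : S) => g • x) (fun _ : G => (1 : ℝ)) Ω :=
    fun g x v w => (hsymm.form g x v w).trans (one_mul _).symm
  have hformB := IsHomogeneousForm.prod hp.contMDiff_smul hgS hform hformG
  have hprC := hp.isScaledFibration
  have hprB := hp.isScaledFibration_comp hprincipal hcomm hequiv
  refine ⟨mem_projectedDistribution_iff hΩ hp hform,
    isContactStructure_projectedDistribution hΩ hp hform, ?_⟩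
  choose A hA using exists_projected_frame (EC := EC) hΩ hp hform
  have hAL : IsLiouvilleFrame Ω pS A := hA
  have hAh := hAL.isHomogeneousFrame hp hform
  obtain ⟨i₁, i₂, i₃, i₄, hAsm⟩ := hprC.exists_lineBundle hAh
  refine ⟨i₁, i₂, i₃, i₄, hAL.isCotangentSubbundle hΩ hp hform hAsm, fun x => A x 1,
    fun x v => (hA x 1 v).trans (one_mul _),
    fun h => ⟨contMDiff_dual_frame hAsm h, dual_frame_act hAh h⟩, fun F hF hFact => ?_, ?_⟩
  · obtain ⟨h, hh⟩ := hprC.exists_dual_section hAh hAsm hF hFact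
    exact ⟨h, hh, fun h' hh' => dual_section_ext hprC.surjective fun x =>
      (hh' x).trans (hh x).symm⟩
  obtain ⟨KC, hKC, hKCs⟩ := exists_kirillovStructure hΩ hform hprC hAh hAsm
  obtain ⟨i₅, hG⟩ := hAh.exists_mulAction hprC hcomm
  have hG' : IsFrameAction (L := L) G pS A := hG
  -- Equivariance as homogeneity for the product, so that `poissonBracket_mem` on S → B yields
  -- compatibility with the bracket.
  have hmem : ∀ h : DualSection EC L, h.IsEquivariant G ↔
      (fun x => (h (pS x) (A x 1) : ℝ)) ∈ homogeneousFunctions (ES := ES)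
        (fun (j : ScalingGroup κ × G) (x : S) => j.1 • j.2 • x)
        (fun j : ScalingGroup κ × G => (j.1 : ℝ)) := fun h => by
    rw [hG'.isEquivariant_iff hprC.surjective]
    refine Iff.trans ?_ (mem_homogeneousFunctions_prod_iff (G := G) hprC).symm
    exact ⟨fun h' => ⟨⟨contMDiff_dual_frame hAsm h, dual_frame_act hAh h⟩, h'⟩, fun h' => h'.2⟩
  have hcompat : ∀ h₁ h₂ : DualSection EC L, h₁.IsEquivariant G → h₂.IsEquivariant G →
      DualSection.IsEquivariant G (KC.bracket h₁ h₂) := by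
    intro h₁ h₂ hh₁ hh₂
    rw [hmem]
    have h1 := Submodule.neg_mem _
      (poissonBracket_mem hΩ hformB hprB ((hmem h₁).1 hh₁) ((hmem h₂).1 hh₂))
    have h2 : (fun x => (KC.bracket h₁ h₂ (pS x) (A x 1) : ℝ)) =
        -poissonBracket Ω (fun x => (h₁ (pS x) (A x 1) : ℝ)) (fun x => h₂ (pS x) (A x 1)) :=
      funext fun x => (neg_eq_iff_eq_neg.2 (hKC h₁ h₂ x)).symm
    rw [h2]
    exact h1
  refine ⟨KC, hKC, i₅, hG'.contMDiffSMul hprC hAsm,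
    hAL.exists_cotangentLift hG' hΩ hp hgS hgC hformG hcomm hequiv, hcompat, ?_⟩
  obtain ⟨j₁, j₂, j₃, j₄, j₅, j₆, j₇, hquot, AB, hABo, hABh, hABsm⟩ :=
    hG'.exists_quotientLineBundle hprC hAh hAsm hprB hequiv hprincipal.eq_iff hprincipal.free
  refine ⟨j₁, j₂, j₃, j₄, j₅, j₆, j₇, hquot, ?_⟩
  obtain ⟨Θ, hΘ⟩ := exists_reductionEquiv hG' hprC hAh hAsm hprB hABh hABsm
  -- The reduced bracket comes directly from S → B, not from the bracket on C.
  obtain ⟨KB, hKB, hKBs⟩ := exists_kirillovStructure hΩ hformB hprB hABh hABsm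
  have hΘfun : ∀ h, (fun x => (Θ h (qC (pS x)) (AB x 1) : ℝ)) = fun x => h.1 (pS x) (A x 1) :=
    fun h => funext (hΘ h)
  have hHmem : H ∈ homogeneousFunctions (ES := ES) (fun (s : ScalingGroup κ) (x : S) => s • x)
      (fun s : ScalingGroup κ => (s : ℝ)) := ⟨hH, hscaling.function⟩
  obtain ⟨hsec, hhsec⟩ := hprC.exists_dual_section hAh hAsm hH hscaling.function
  have hhfun : (fun x => (hsec (pS x) (A x 1) : ℝ)) = H := funext hhsec
  have hsecG : hsec.IsEquivariant G := by
    rw [hmem, hhfun]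
    exact (mem_homogeneousFunctions_prod_iff (G := G) hprC).2 ⟨hHmem, hsymm.function⟩
  have hsymC : ∀ x, mfderiv 𝓘(ℝ, ES) 𝓘(ℝ, EC) pS x (hamiltonianVectorField Ω H x) =
      KC.symbol hsec (pS x) := by
    intro x
    rw [← hKCs, hhfun]
  have hsymB : ∀ x, mfderiv 𝓘(ℝ, ES) 𝓘(ℝ, EB) (fun y => qC (pS y)) x
      (hamiltonianVectorField Ω H x) = KB.symbol (Θ ⟨hsec, hsecG⟩) (qC (pS x)) := by
    intro x
    rw [← hKBs, hΘfun, hhfun]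
  refine ⟨Θ, fun h z => ?_, KB, fun h₁ h₂ => ?_, ⟨hsec, hsecG⟩, hhsec, hsymC, fun g c => ?_,
    fun c => ?_, hsymB⟩
  · obtain ⟨x, t, rfl⟩ := exists_frame_coordinate hprC.surjective A z
    have h1 : orbitClass G L qC (TotalSpace.mk' ℝ (pS x) (A x t)) = AB x t := (hABo x t).symm
    have h2 : AB x t = t • AB x 1 := by rw [← map_smul, smul_eq_mul, mul_one]
    have h3 : A x t = t • A x 1 := by rw [← map_smul, smul_eq_mul, mul_one]
    change (Θ h (qC (pS x)) (orbitClass G L qC (TotalSpace.mk' ℝ (pS x) (A x t))) : ℝ) =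
      h.1 (pS x) (A x t)
    rw [h1, h2, h3]
    refine ((Θ h (qC (pS x))).map_smul t (AB x 1)).trans
      (Eq.trans ?_ ((h.1 (pS x)).map_smul t (A x 1)).symm)
    exact congrArg (fun a : ℝ => t * a) (hΘ h x)
  -- Both sides evaluate to minus the Poisson bracket of the same two functions on S.
  · refine dual_section_ext (A := AB) hprB.surjective fun x => ?_
    have h1 := hKB (Θ h₁) (Θ h₂) x
    rw [hΘfun, hΘfun] at h1
    have h2 := hKC h₁.1 h₂.1 x
    exact (neg_inj.1 (h1.symm.trans h2)).trans (hΘ ⟨KC.bracket h₁.1 h₂.1, _⟩ x).symm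
  -- Invariance of X_H on S, pushed down by the equivariant projection pS.
  · obtain ⟨x, rfl⟩ := hp.surjective c
    have h1 := mfderiv_comp_apply x ((hgC g).mdifferentiable (by simp) (pS x))
      (hp.contMDiff.mdifferentiable (by simp) x) (hamiltonianVectorField Ω H x)
    have h2 := mfderiv_comp_apply x (hp.contMDiff.mdifferentiable (by simp) (g • x))
      ((hgS g).mdifferentiable (by simp) x) (hamiltonianVectorField Ω H x)
    have h3 : (fun c : C => g • c) ∘ pS = pS ∘ fun y : S => g • y :=
      funext fun y => (hequiv g y).symm
    have h4 := congrArg (fun f : S → C => (mfderiv 𝓘(ℝ, ES) 𝓘(ℝ, EC) f x : ES →L[ℝ] EC)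
      (hamiltonianVectorField Ω H x)) h3
    have h5 : hamiltonianVectorField Ω H (g • x) = mfderiv 𝓘(ℝ, ES) 𝓘(ℝ, ES)
        (fun y : S => g • y) x (hamiltonianVectorField Ω H x) :=
      hamiltonianVectorField_act hΩ hformG (F := H)
        ⟨hH, fun g x => (hsymm.function g x).trans (one_mul _).symm⟩ one_ne_zero (hgS g) x
    have h6 := hsymC (g • x)
    rw [h5] at h6
    let Z : C → EC := KC.symbol hsec
    rw [← hsymC x]
    exact h1.symm.trans (h4.trans (h2.trans (h6.trans (congrArg Z (hequiv g x)))))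
  · obtain ⟨x, rfl⟩ := hp.surjective c
    rw [← hsymC x, ← hsymB x]
    exact (mfderiv_comp_apply x (hprincipal.contMDiff.mdifferentiable (by simp) (pS x))
      (hp.contMDiff.mdifferentiable (by simp) x) (hamiltonianVectorField Ω H x)).symm
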